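/- **Theorem A.** Let $R$ be a commutative ring (for instance a commutative algebra over a field $\mathbf k$) and let $n\ge 0$. *The category.* Let $\mathcal A_n$ be the graded category with two objects $X,Y$ whose morphism spaces have the bases $\theta_1,\dots,\theta_n\in \mathrm{Hom}^0(X,Y)$, $\eta_1,\dots,\eta_n\in\mathrm{Hom}^1(Y,X)$, $\mathrm{id}_X\in \mathrm{Hom}^0(X,X)$, $\xi_X\in\mathrm{Hom}^1(X,X)$, $\mathrm{id}_Y\in\mathrm{Hom}^0(Y,Y)$, $\xi_Y\in\mathrm{Hom}^1(Y,Y)$, with $$\mu_2(a,\mathrm{id})=a,\quad \mu_2(\mathrm{id},a)=(-1)^{|a|}a,\quad \mu_2(\eta_\alpha,\theta_\beta)=\delta_{\alpha\beta}\xi_X,\quad \mu_2(\theta_\alpha,\eta_\beta)=-\delta_{\alpha\beta}\xi_Y$$ and all other products of basis elements zero, and with the pairing $\langle\eta_\alpha,\theta_\beta\rangle=-\langle\theta_\beta,\eta_\alpha\rangle=\delta_{\alpha\beta}$, $\langle \xi_X,\mathrm{id}_X\rangle=-\langle \mathrm{id}_X,\xi_X\rangle=\langle \xi_Y,\mathrm{id}_Y\rangle=-\langle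 \mathrm{id}_Y,\xi_Y\rangle=1$. *$A_\infty$-structures.* Consider minimal ($\mu_1=0$), strictly unital $A_\infty$-structures $(\mu_k)$ on $\mathcal A_n\otimes R$ with this $\mu_2$, i.e. families of $R$-multilinear operations $\mu_k$ of degree $2-k$ with $$\sum_{m,j}(-1)^{|a_1|+\dots+|a_j|-j}\mu_{d-m+1}(a_d,\dots,a_{j+m+1},\mu_m(a_{j+m},\dots,a_{j+1}),a_j,\dots,a_1)=0,$$ which are cyclic: $$\langle a_{k+1},\mu_k(a_k,\dots,a_1)\rangle=(-1)^{(|a_{k+1}|-1)(|a_1|+\dots+|a_k|-k)}\langle a_k,\mu_k(a_{k-1},\dots,a_1,a_{k+1})\rangle .$$ A cyclic $A_\infty$-equivalence from $(\mu_k)$ to $(\mu_k')$ is a strictly unital $A_\infty$-functor $(f^k)_{k\ge1}$, $\deg f^k=1-k$, identical on objects, with $f^1$ invertible, such that $\langle f^1(a_2),f^1(a_1)\rangle=\langle a_2,a_1\rangle$ and $\sum_{k+l=d}\langle f^l(a_d,\dots,a_{k+1}),f^k(a_k,\dots,a_1)\rangle=0$ for all $d\ge3$. It is strict if $f^1=\mathrm{id}$.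 Let $\mathcal M_\infty(\mathcal A_n\otimes R)$ be the set of these structures up to strict cyclic $A_\infty$-equivalence. *Formal solutions.* Consider elements $$r^{x_1x_2}_{y_1y_2}\in \mathrm{Mat}_n\otimes\mathrm{Mat}_n\otimes R[[x_1,x_2,y_1,y_2]][(x_2-x_1)^{-1}(y_2-y_1)^{-1}],$$ $$r^{x_1x_2}_{y_1y_2}\equiv\frac{\mathrm{id}\otimes\mathrm{id}}{x_2-x_1}+\frac{P}{y_1-y_2}\mod \mathrm{Mat}_n\otimes\mathrm{Mat}_n\otimes R[[x_1,x_2,y_1,y_2]],\qquad P(v\otimes w)=w\otimes v,$$ that are skew-symmetric, $(r^{x_1x_2}_{y_1y_2})^{21}=-r^{x_2x_1}_{y_2y_1}$, and satisfy the set-theoretic associative Yang–Baxter equation $$(r^{x_2x_1}_{y_2y_3})^{12}(r^{x_1x_3}_{y_1y_3})^{13}-(r^{x_1x_3}_{y_1y_2})^{23}(r^{x_2x_3}_{y_2y_3})^{12}+(r^{x_2x_3}_{y_1y_3})^{13}(r^{x_1x_2}_{y_1y_2})^{23}=0$$ over $R[[x_1,x_2,x_3,y_1,y_2,y_3]][\Delta^{-1}]$,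 $\Delta=\prod_{i<j}(x_j-x_i)(y_j-y_i)$. Two solutions are gauge equivalent via $\varphi=\varphi^x_y\in\mathrm{Mat}_n(R)[[x,y]]$ (with invertible constant term) if $$\widetilde r^{\,x_1x_2}_{\,y_1y_2}=(\varphi^{x_1}_{y_2}\otimes\varphi^{x_2}_{y_1})\,r^{x_1x_2}_{y_1y_2}\,(\varphi^{x_2}_{y_2}\otimes\varphi^{x_1}_{y_1})^{-1}.$$ *Massey products.* For a structure $(\mu_k)$ consider, over $R[[x_1,x_2,y_1,y_2]][(x_2-x_1)^{-1}(y_2-y_1)^{-1}]$, the twisted objects $X_i=(X,x_i\xi_X)$, $Y_i=(Y,y_i\xi_Y)$, $i=1,2$, with the twisted products $\mu^t_d(a_d,\dots,a_1)=\sum_{i_0,\dots,i_d\ge0}\mu(\delta^{i_d},a_d,\delta^{i_{d-1}},\dots,a_1,\delta^{i_0})$, where the $\delta$'s are the twisting elements. The triple Massey product of closed morphisms $a_1,a_2,a_3$ is $\mathrm{MP}(a_3,a_2,a_1)=\mu_3^t(a_3,a_2,a_1)-\mu_2^t(h_2,a_1)-\mu_2^t(a_3,h_1)$ modulo $\mathrm{Im}\,\mu_1^t$,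 where $\mu_1^t(h_1)=\mu_2^t(a_2,a_1)$, $\mu_1^t(h_2)=\mu_2^t(a_3,a_2)$. *Claim.* The four relations — strict cyclic $A_\infty$-equivalence, cyclic $A_\infty$-equivalence, gauge equivalence with $\varphi\in\mathrm{Id}+(x,y)$, and gauge equivalence with $\varphi$ having an arbitrary invertible constant term — are equivalence relations. For every structure $(\mu_k)$ as above the triple Massey products of $X_1\xrightarrow{\theta_\alpha}Y_1\xrightarrow{\eta_\beta}X_2\xrightarrow{\theta_{\alpha'}}Y_2$ are well defined and univalued, and $$r^{x_1x_2}_{y_1y_2}=\sum_{\alpha,\alpha',\beta,\beta'}\langle \mathrm{MP}(\theta_{\alpha'},\eta_\beta,\theta_\alpha),\eta_{\beta'}\rangle\; e_{\beta'\alpha'}\otimes e_{\beta\alpha}$$ is a formal skew-symmetric solution of the above type. The map $(\mu_k)\mapsto r^{x_1x_2}_{y_1y_2}$ is compatible with change of the coefficient ring $R\to S$ and induces 1. a bijection from $\mathcal M_\infty(\mathcal A_n\otimes R)$ onto the set of these solutions up to gauge equivalence with $\varphi^x_y\in \mathrm{Id}+(x,y)$; 2. a bijection from the set of these $A_\infty$-structures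 up to general cyclic $A_\infty$-equivalence onto the set of these solutions up to gauge equivalence with $\varphi^x_y$ having an arbitrary invertible constant term. -/

import Mathlib

open scoped Kronecker

noncomputable section

namespace AYBE

/-! ### The graded category `A_n` -/

/-- The two objects of `A_n`. -/
inductive Obj
  | X
  | Y
deriving DecidableEq

instance : Fintype Obj where
  elems := {Obj.X, Obj.Y}
  complete o := by cases o <;> simp

/-- The homogeneous basis of the morphism spaces of `A_n`: the identities `id_X, id_Y`,
the elements `ξ_X, ξ_Y`, and `θ_1, …, θ_n : X → Y`, `η_1, …, η_n : Y → X`. -/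
inductive Gen (n : ℕ)
  | one (o : Obj)
  | xi (o : Obj)
  | theta (i : Fin n)
  | eta (i : Fin n)
deriving DecidableEq, Fintype

namespace Gen

variable {n : ℕ}

/-- Source of a basis morphism. -/
def src : Gen n → Obj
  | one o => o
  | xi o => o
  | theta _ => Obj.X
  | eta _ => Obj.Y

/-- Target of a basis morphism. -/
def tgt : Gen n → Obj
  | one o => o
  | xi o => o
  | theta _ => Obj.Y
  | eta _ => Obj.X

/-- Degree of a basis morphism. -/
def deg : Gen n → ℤ
  | one _ => 0
  | xi _ => 1
  | theta _ => 0
  | eta _ => 1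

end Gen

section AInfinity

variable (R : Type*) [CommRing R] {n : ℕ}

/-- The sign `(-1)^z` in `R`. -/
def sgn (z : ℤ) : R := ((z.negOnePow : ℤ) : R)

/-- The pairing on the morphism spaces: `⟨η_i, θ_j⟩ = δ_ij = -⟨θ_j, η_i⟩` and
`⟨ξ, id⟩ = 1 = -⟨id, ξ⟩` for each of the two objects. -/
def pairing : Gen n → Gen n → R
  | .eta i, .theta j => if i = j then 1 else 0
  | .theta i, .eta j => if i = j then -1 else 0
  | .xi o, .one o' => if o = o' then 1 else 0
  | .one o, .xi o' => if o = o' then -1 else 0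
  | _, _ => 0

/-- The prescribed product: `mu2 R a b c` is the coefficient of `c` in `μ₂(a, b)`. Thus
`μ₂(a, id) = a`, `μ₂(id, a) = (-1)^|a| a`, `μ₂(η_i, θ_j) = δ_ij ξ_X`,
`μ₂(θ_i, η_j) = -δ_ij ξ_Y`, and all other products of basis elements vanish. -/
def mu2 : Gen n → Gen n → Gen n → R
  | a, .one o, c => if a.src = o ∧ c = a then 1 else 0
  | .one o, b, c => if b.tgt = o ∧ c = b then sgn R b.deg else 0
  | .eta i, .theta j, c => if i = j ∧ c = .xi .X then 1 else 0
  | .theta i, .eta j, c => if i = j ∧ c = .xi .Y then -1 else 0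
  | _, _, _ => 0

variable (n) in
/-- A family of `R`-multilinear operations, one for each number of inputs, on the morphism spaces
of `A_n ⊗ R`, given by its values on basis elements: `F [a_k, …, a_1] c` is the coefficient of `c`
in `F_k(a_k, …, a_1)`. As in the notation for compositions, `a_1` is applied first. -/
abbrev Ops := List (Gen n) → Gen n → R

variable {R}

/-- `[a_k, …, a_1]` is a string of composable morphisms. -/
def Composable (w : List (Gen n)) : Prop := w.IsChain fun a b => a.src = b.tgt

/-- The reduced degree `∑ (|a_i| - 1)` of a word. -/
def redDeg (w : List (Gen n)) : ℤ := (w.map fun a => a.deg - 1).sum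

/-- The operations `F_k`, `k ≥ 1`, are defined on composable strings `X_0 → ⋯ → X_k`, take values
in `Hom(X_0, X_k)`, and `F_k` has degree `s k`. (By convention the coefficients are `0` on all other
words, including the empty one.) -/
def Homogeneous (s : ℕ → ℤ) (F : Ops R n) : Prop :=
  ∀ w c, F w c ≠ 0 →
    w ≠ [] ∧ Composable w ∧
      w.head?.map Gen.tgt = some c.tgt ∧ w.getLast?.map Gen.src = some c.src ∧
      c.deg = (w.map Gen.deg).sum + s w.length

/-- The signed sum over all ways to apply `G` to a block of consecutive letters of `w` and then `F`
to the resulting word; the coefficient of `c` in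
`∑ (-1)^{|a_1| + ⋯ + |a_j| - j} F(a_d, …, a_{j+m+1}, G_m(a_{j+m}, …, a_{j+1}), a_j, …, a_1)`. -/
def insertion (F G : Ops R n) (w : List (Gen n)) (c : Gen n) : R :=
  ∑ q ∈ Finset.range (w.length + 1), ∑ p ∈ Finset.range (q + 1),
    sgn R (redDeg (w.drop q)) *
      ∑ b : Gen n, G ((w.drop p).take (q - p)) b * F (w.take p ++ b :: w.drop q) c

variable (R n) in
/-- A cyclic, strictly unital, minimal `A_∞`-structure on `A_n ⊗ R` with the prescribed `μ₂`. -/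
@[ext]
structure CyclicAInf where
  /-- The operations `μ_k`. -/
  op : Ops R n
  homogeneous : Homogeneous (fun k => 2 - (k : ℤ)) op
  minimal : ∀ a c, op [a] c = 0
  op_two : ∀ a b c, op [a, b] c = mu2 R a b c
  strictly_unital : ∀ (w : List (Gen n)) (o : Obj) (c : Gen n),
    3 ≤ w.length → Gen.one o ∈ w → op w c = 0
  ainf : ∀ w, Composable w → ∀ c, insertion op op w c = 0
  /-- `⟨a, μ_k(b, w)⟩ = ± ⟨b, μ_k(w, a)⟩`. Both sides vanish unless `a, b, w` is a cyclically
  composable string. -/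
  cyclic : ∀ (a b : Gen n) (w : List (Gen n)),
    ∑ c, pairing R a c * op (b :: w) c =
      sgn R ((a.deg - 1) * redDeg (b :: w)) * ∑ c, pairing R b c * op (w ++ [a]) c

/-- The coefficient of `c` in
`∑ G_r(F(a_d, …), …, F(…, a_1))`, the sum over all ways to cut the word `w = [a_d, …, a_1]` into
`r ≥ 1` nonempty blocks of consecutive letters. -/
def blockSum (G F : Ops R n) (w : List (Gen n)) (c : Gen n) : R :=
  ∑ κ : Composition w.length, ∑ b : Fin κ.length → Gen n,
    (∏ i : Fin κ.length, F ((w.splitWrtComposition κ).getD i []) (b i)) * G (List.ofFn b) c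

/-- A strictly unital cyclic `A_∞`-functor `(A_n ⊗ R, μ) → (A_n ⊗ R, μ')` which is the identity on
objects. -/
structure CyclicFunctor (m m' : CyclicAInf R n) where
  /-- The components `f^k`. -/
  map : Ops R n
  homogeneous : Homogeneous (fun k => 1 - (k : ℤ)) map
  map_one : ∀ o c, map [Gen.one o] c = if c = Gen.one o then 1 else 0
  strictly_unital : ∀ (w : List (Gen n)) (o : Obj) (c : Gen n),
    2 ≤ w.length → Gen.one o ∈ w → map w c = 0
  functor_eq : ∀ w, w ≠ [] → Composable w → ∀ c, blockSum m'.op map w c = insertion map m.op w c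
  cyclic_one : ∀ a b : Gen n,
    ∑ c, ∑ d, map [a] c * map [b] d * pairing R c d = pairing R a b
  /-- `∑ ⟨f^l(a_k, …), f^{k-l}(…, a_1)⟩ = 0` for words of length at least `3`. -/
  cyclic : ∀ w : List (Gen n), 3 ≤ w.length → Composable w →
    ∑ l ∈ Finset.Ioo 0 w.length, ∑ c, ∑ d,
      map (w.take l) c * map (w.drop l) d * pairing R c d = 0

/-- The linear component `f^1`, as a matrix in the standard basis. -/
def CyclicFunctor.linear {m m' : CyclicAInf R n} (f : CyclicFunctor m m') :
    Matrix (Gen n) (Gen n) R := Matrix.of fun c a => f.map [a] c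

/-- Cyclic `A_∞`-equivalence: a cyclic `A_∞`-functor with `f^1` invertible. -/
def CyclicEquiv (m m' : CyclicAInf R n) : Prop :=
  ∃ f : CyclicFunctor m m', IsUnit f.linear

/-- Strict cyclic `A_∞`-equivalence: a cyclic `A_∞`-functor with `f^1 = id`. -/
def StrictCyclicEquiv (m m' : CyclicAInf R n) : Prop :=
  ∃ f : CyclicFunctor m m', f.linear = 1

end AInfinity

/-! ### Rings of formal functions -/

section Rings

variable (R : Type*) [CommRing R]

/-- The ring `R[[x_1, …, x_N, y_1, …, y_N]]`. The variables are indexed by pairs consisting of an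
object of `A_n` and a number: `(X, i)` stands for `x_i` and `(Y, i)` for `y_i`
(numbering starts from `0`). -/
abbrev PS (N : ℕ) := MvPowerSeries (Obj × Fin N) R

variable {N : ℕ}

/-- The variable `x_i`. -/
def xvar (i : Fin N) : PS R N := MvPowerSeries.X (Obj.X, i)

/-- The variable `y_i`. -/
def yvar (i : Fin N) : PS R N := MvPowerSeries.X (Obj.Y, i)

variable (N) in
/-- `Δ = ∏_{i < j} (x_j - x_i)(y_j - y_i)`. -/
def disc : PS R N :=
  ∏ i : Fin N, ∏ j ∈ Finset.Ioi i, ((xvar R j - xvar R i) * (yvar R j - yvar R i))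

variable (N) in
/-- The ring `R[[x_1, …, x_N, y_1, …, y_N]][Δ⁻¹]`. -/
abbrev Coef := Localization.Away (disc R N)

/-- `x_j - x_i` in the localized ring. -/
def dx (i j : Fin N) : Coef R N := algebraMap (PS R N) (Coef R N) (xvar R j - xvar R i)

/-- `y_j - y_i` in the localized ring. -/
def dy (i j : Fin N) : Coef R N := algebraMap (PS R N) (Coef R N) (yvar R j - yvar R i)

theorem isUnit_dx_mul_dy_of_lt {i j : Fin N} (h : i < j) : IsUnit (dx R i j * dy R i j) := by
  have hd : (xvar R j - xvar R i) * (yvar R j - yvar R i) ∣ disc R N :=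
    (Finset.dvd_prod_of_mem (fun j => (xvar R j - xvar R i) * (yvar R j - yvar R i))
      (Finset.mem_Ioi.mpr h)).trans
      (Finset.dvd_prod_of_mem
        (fun i => ∏ j ∈ Finset.Ioi i, ((xvar R j - xvar R i) * (yvar R j - yvar R i)))
        (Finset.mem_univ i))
  rw [dx, dy, ← map_mul]
  exact isUnit_of_dvd_unit (map_dvd _ hd)
    (IsLocalization.Away.algebraMap_isUnit (S := Coef R N) (disc R N))

theorem isUnit_dx {i j : Fin N} (h : i ≠ j) : IsUnit (dx R i j) := by
  rcases lt_or_gt_of_ne h with h | h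
  · exact isUnit_of_mul_isUnit_left (isUnit_dx_mul_dy_of_lt R h)
  · have := isUnit_of_mul_isUnit_left (isUnit_dx_mul_dy_of_lt R h)
    rw [show dx R i j = -dx R j i by simp [dx]]
    exact this.neg

theorem isUnit_dy {i j : Fin N} (h : i ≠ j) : IsUnit (dy R i j) := by
  rcases lt_or_gt_of_ne h with h | h
  · exact isUnit_of_mul_isUnit_right (isUnit_dx_mul_dy_of_lt R h)
  · have := isUnit_of_mul_isUnit_right (isUnit_dx_mul_dy_of_lt R h)
    rw [show dy R i j = -dy R j i by simp [dy]]
    exact this.neg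

theorem disc_two :
    disc R 2 = (xvar R 1 - xvar R 0) * (yvar R 1 - yvar R 0) := by
  have h0 : Finset.Ioi (0 : Fin 2) = {1} := by decide
  have h1 : Finset.Ioi (1 : Fin 2) = ∅ := by decide
  simp [disc, h0, h1]

/-- The renaming `x_1 ↦ x_i, x_2 ↦ x_j, y_1 ↦ y_k, y_2 ↦ y_l` of variables. -/
def renameVar (i j k l : Fin N) : Obj × Fin 2 → Obj × Fin N
  | (.X, s) => (.X, ![i, j] s)
  | (.Y, s) => (.Y, ![k, l] s)

theorem isUnit_rename_disc (i j k l : Fin N) (hij : i ≠ j) (hkl : k ≠ l) :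
    IsUnit (((algebraMap (PS R N) (Coef R N)).comp
      (MvPowerSeries.rename (R := R) (renameVar i j k l)).toRingHom) (disc R 2)) := by
  have h : ((algebraMap (PS R N) (Coef R N)).comp
      (MvPowerSeries.rename (R := R) (renameVar i j k l)).toRingHom) (disc R 2)
      = dx R i j * dy R k l := by
    simp [disc_two, dx, dy, xvar, yvar, renameVar, MvPowerSeries.rename_X]
  rw [h]
  exact (isUnit_dx R hij).mul (isUnit_dy R hkl)

/-- The ring homomorphism
`R[[x_1, x_2, y_1, y_2]][Δ⁻¹] → R[[x_1, …, x_N, y_1, …, y_N]][Δ⁻¹]` substituting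
`x_i, x_j, y_k, y_l` for `x_1, x_2, y_1, y_2`. -/
def substVar (i j k l : Fin N) (hij : i ≠ j) (hkl : k ≠ l) : Coef R 2 →+* Coef R N :=
  IsLocalization.Away.lift (disc R 2) (isUnit_rename_disc R i j k l hij hkl)

variable {R}

theorem isUnit_map_disc {S : Type*} [CommRing S] (g : R →+* S) :
    IsUnit (((algebraMap (PS S N) (Coef S N)).comp
      (MvPowerSeries.map (σ := Obj × Fin N) g)) (disc R N)) := by
  have h : MvPowerSeries.map (σ := Obj × Fin N) g (disc R N) = disc S N := by
    simp [disc, xvar, yvar]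
  rw [RingHom.comp_apply, h]
  exact IsLocalization.Away.algebraMap_isUnit (S := Coef S N) (disc S N)

variable (N) in
/-- Change of the coefficient ring along `g : R → S`. -/
def Coef.baseChange {S : Type*} [CommRing S] (g : R →+* S) : Coef R N →+* Coef S N :=
  IsLocalization.Away.lift (disc R N) (isUnit_map_disc g)

end Rings

/-! ### Formal solutions of the set-theoretic associative Yang–Baxter equation

`Mat_n ⊗ Mat_n` over a commutative ring `K` is identified with the matrices over `K` indexed by
`Fin n × Fin n`, by means of the Kronecker product. -/

section Solutions

variable {K : Type*} [CommRing K] {n : ℕ}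

variable (K n) in
/-- The transposition operator `P(x ⊗ y) = y ⊗ x`. -/
def flipMatrix : Matrix (Fin n × Fin n) (Fin n × Fin n) K :=
  Matrix.of fun I J => if I.1 = J.2 ∧ I.2 = J.1 then 1 else 0

/-- `r ↦ r^{12}`. -/
def leg12 (r : Matrix (Fin n × Fin n) (Fin n × Fin n) K) :
    Matrix (Fin n × Fin n × Fin n) (Fin n × Fin n × Fin n) K :=
  Matrix.of fun I J => if I.2.2 = J.2.2 then r (I.1, I.2.1) (J.1, J.2.1) else 0

/-- `r ↦ r^{13}`. -/
def leg13 (r : Matrix (Fin n × Fin n) (Fin n × Fin n) K) :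
    Matrix (Fin n × Fin n × Fin n) (Fin n × Fin n × Fin n) K :=
  Matrix.of fun I J => if I.2.1 = J.2.1 then r (I.1, I.2.2) (J.1, J.2.2) else 0

/-- `r ↦ r^{23}`. -/
def leg23 (r : Matrix (Fin n × Fin n) (Fin n × Fin n) K) :
    Matrix (Fin n × Fin n × Fin n) (Fin n × Fin n × Fin n) K :=
  Matrix.of fun I J => if I.1 = J.1 then r (I.2.1, I.2.2) (J.2.1, J.2.2) else 0

/-- `r ↦ r^{21}`, the exchange of the two tensor factors of `Mat_n ⊗ Mat_n`. -/
def leg21 (r : Matrix (Fin n × Fin n) (Fin n × Fin n) K) :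
    Matrix (Fin n × Fin n) (Fin n × Fin n) K :=
  Matrix.of fun I J => r (I.2, I.1) (J.2, J.1)

variable (R : Type*) [CommRing R]

variable {R} in
/-- `r^{x_i x_j}_{y_k y_l}`, the result of substituting `x_i, x_j, y_k, y_l` for
`x_1, x_2, y_1, y_2` in `r`. -/
def at4 {N : ℕ} (r : Matrix (Fin n × Fin n) (Fin n × Fin n) (Coef R 2)) (i j k l : Fin N)
    (hij : i ≠ j) (hkl : k ≠ l) : Matrix (Fin n × Fin n) (Fin n × Fin n) (Coef R N) :=
  r.map (substVar R i j k l hij hkl)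

/-- A formal skew-symmetric solution of the set-theoretic associative Yang–Baxter equation, with
singular part `(id ⊗ id)/(x_2 - x_1) + P/(y_1 - y_2)`. -/
@[ext]
structure FormalSolution (n : ℕ) where
  /-- The tensor `r^{x_1 x_2}_{y_1 y_2}`. -/
  r : Matrix (Fin n × Fin n) (Fin n × Fin n) (Coef R 2)
  singular_part : ∃ f : Matrix (Fin n × Fin n) (Fin n × Fin n) (PS R 2),
    r = f.map (algebraMap (PS R 2) (Coef R 2))
      + Ring.inverse (dx R (N := 2) 0 1) •
        ((1 : Matrix (Fin n) (Fin n) (Coef R 2)) ⊗ₖ (1 : Matrix (Fin n) (Fin n) (Coef R 2)))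
      + Ring.inverse (dy R (N := 2) 1 0) • flipMatrix (Coef R 2) n
  /-- `(r^{x_1 x_2}_{y_1 y_2})^{21} = - r^{x_2 x_1}_{y_2 y_1}`. -/
  skew : leg21 r = -at4 (N := 2) r 1 0 1 0 (by decide) (by decide)
  /-- The set-theoretic AYBE over `R[[x_1, x_2, x_3, y_1, y_2, y_3]][Δ⁻¹]`:
  `(r^{x_2 x_1}_{y_2 y_3})^{12} (r^{x_1 x_3}_{y_1 y_3})^{13}
    - (r^{x_1 x_3}_{y_1 y_2})^{23} (r^{x_2 x_3}_{y_2 y_3})^{12}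
    + (r^{x_2 x_3}_{y_1 y_3})^{13} (r^{x_1 x_2}_{y_1 y_2})^{23} = 0`. -/
  aybe :
    leg12 (at4 (N := 3) r 1 0 1 2 (by decide) (by decide)) *
        leg13 (at4 (N := 3) r 0 2 0 2 (by decide) (by decide))
      - leg23 (at4 (N := 3) r 0 2 0 1 (by decide) (by decide)) *
        leg12 (at4 (N := 3) r 1 2 1 2 (by decide) (by decide))
      + leg13 (at4 (N := 3) r 1 2 0 2 (by decide) (by decide)) *
        leg23 (at4 (N := 3) r 0 1 0 1 (by decide) (by decide)) = 0

variable {R}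

/-- The renaming `x ↦ x_i, y ↦ y_j`. -/
def gaugeVar (i j : Fin 2) : Obj → Obj × Fin 2
  | .X => (.X, i)
  | .Y => (.Y, j)

/-- `φ^{x_i}_{y_j}` for a matrix `φ^x_y` over `R[[x, y]]` (the variables `x, y` are indexed by the
objects `X, Y`). -/
def gaugeAt (φ : Matrix (Fin n) (Fin n) (MvPowerSeries Obj R)) (i j : Fin 2) :
    Matrix (Fin n) (Fin n) (Coef R 2) :=
  φ.map fun s => algebraMap (PS R 2) (Coef R 2) (MvPowerSeries.rename (gaugeVar i j) s)

/-- The constant term `φ^0_0`. -/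
def constTerm (φ : Matrix (Fin n) (Fin n) (MvPowerSeries Obj R)) : Matrix (Fin n) (Fin n) R :=
  φ.map MvPowerSeries.constantCoeff

/-- The action of a gauge transformation:
`(φ^{x_1}_{y_2} ⊗ φ^{x_2}_{y_1}) r^{x_1 x_2}_{y_1 y_2} (φ^{x_2}_{y_2} ⊗ φ^{x_1}_{y_1})⁻¹`. -/
def gauge (φ : Matrix (Fin n) (Fin n) (MvPowerSeries Obj R))
    (r : Matrix (Fin n × Fin n) (Fin n × Fin n) (Coef R 2)) :
    Matrix (Fin n × Fin n) (Fin n × Fin n) (Coef R 2) :=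
  (gaugeAt φ 0 1 ⊗ₖ gaugeAt φ 1 0) * r * (gaugeAt φ 1 1 ⊗ₖ gaugeAt φ 0 0)⁻¹

/-- Equivalence of solutions by gauge transformations with invertible constant term. -/
def GaugeEquiv (s s' : FormalSolution R n) : Prop :=
  ∃ φ : Matrix (Fin n) (Fin n) (MvPowerSeries Obj R),
    IsUnit (constTerm φ) ∧ s'.r = gauge φ s.r

/-- Equivalence of solutions by gauge transformations `φ ∈ Id + (x, y)`. -/
def StrictGaugeEquiv (s s' : FormalSolution R n) : Prop :=
  ∃ φ : Matrix (Fin n) (Fin n) (MvPowerSeries Obj R),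
    constTerm φ = 1 ∧ s'.r = gauge φ s.r

end Solutions

/-! ### Twisted objects and Massey products

For `o` in `{X, Y}` and a number `i`, the pair `T = (o, i)` stands for the twisted object
`X_i = (X, x_i ξ_X)` or `Y_i = (Y, y_i ξ_Y)`, with twisting element `δ_T = (variable T) · ξ_o`.
(The Maurer–Cartan equation holds for it because there are no morphisms of degree `2`.) -/

section Massey

variable {R : Type*} [CommRing R] {n N : ℕ}

/-- The word `ξ^{k_0}, a_0, ξ^{k_1}, a_1, …, a_{d-1}, ξ^{k_d}`, where the `ξ`'s are those of the
objects `o_0, o_1, …, o_d`. -/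
def insertXi {d : ℕ} (o : Fin (d + 1) → Obj) (a : Fin d → Gen n) (k : Fin (d + 1) → ℕ) :
    List (Gen n) :=
  List.replicate (k 0) (Gen.xi (o 0)) ++
    (List.ofFn fun j : Fin d => a j :: List.replicate (k j.succ) (Gen.xi (o j.succ))).flatten

/-- The coefficient of `c` in the twisted product
`μ_d^t(a_0, …, a_{d-1}) = ∑ μ(δ^{k_0}, a_0, δ^{k_1}, …, a_{d-1}, δ^{k_d})` of basis morphisms
`T_d → T_{d-1} → ⋯ → T_0` of twisted objects. Its coefficient at a monomial `e` is the sum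
of the terms with `∏ (variable T_j)^{k_j} = e`. -/
def twistedOp (m : CyclicAInf R n) {d : ℕ} (T : Fin (d + 1) → Obj × Fin N) (a : Fin d → Gen n)
    (c : Gen n) : PS R N := fun e =>
  ∑ k ∈ (Fintype.piFinset fun j => Finset.range (e (T j) + 1)) with
      ∑ j, Finsupp.single (T j) (k j) = e,
    m.op (insertXi (fun j => (T j).1) a k) c

/-- Morphisms between twisted objects, with coefficients in `R[[x, y]][Δ⁻¹]`. -/
abbrev TwMor (R : Type*) [CommRing R] (n N : ℕ) := Gen n → Coef R N

/-- `v` lies in `Hom^p(S, T)`. -/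
def InHom (p : ℤ) (S T : Obj × Fin N) (v : TwMor R n N) : Prop :=
  ∀ a, v a ≠ 0 → a.src = S.1 ∧ a.tgt = T.1 ∧ a.deg = p

/-- A basis element, as a morphism of twisted objects. -/
def basisMor (a : Gen n) : TwMor R n N := Pi.single a 1

/-- The twisted product `μ_d^t(v_0, …, v_{d-1})` of morphisms `T_d → T_{d-1} → ⋯ → T_0`. -/
def twistedMul (m : CyclicAInf R n) {d : ℕ} (T : Fin (d + 1) → Obj × Fin N)
    (v : Fin d → TwMor R n N) : TwMor R n N := fun c =>
  ∑ a : Fin d → Gen n, (∏ j, v j (a j)) * algebraMap (PS R N) (Coef R N) (twistedOp m T a c)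

/-- The triple Massey product of the composable morphisms `T₀ → T₁ → T₂ → T₃` given by
`a₁, a₂, a₃` of degrees `p₁, p₂, p₃`: the set of all
`μ₃(a₃, a₂, a₁) - μ₂(h₂, a₁) - μ₂(a₃, h₁)` modulo the image of `μ₁`, where
`μ₁(h₁) = μ₂(a₂, a₁)` and `μ₁(h₂) = μ₂(a₃, a₂)`. -/
def masseyProduct (m : CyclicAInf R n) (T₃ T₂ T₁ T₀ : Obj × Fin N) (p₃ p₂ p₁ : ℤ)
    (a₃ a₂ a₁ : TwMor R n N) : Set (TwMor R n N) :=
  {v | (twistedMul m ![T₁, T₀] ![a₁] = 0 ∧ twistedMul m ![T₂, T₁] ![a₂] = 0 ∧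
        twistedMul m ![T₃, T₂] ![a₃] = 0) ∧
    ∃ h₁ h₂ w : TwMor R n N,
      InHom (p₁ + p₂ - 1) T₀ T₂ h₁ ∧ InHom (p₂ + p₃ - 1) T₁ T₃ h₂ ∧
      InHom (p₁ + p₂ + p₃ - 2) T₀ T₃ w ∧
      twistedMul m ![T₂, T₀] ![h₁] = twistedMul m ![T₂, T₁, T₀] ![a₂, a₁] ∧
      twistedMul m ![T₃, T₁] ![h₂] = twistedMul m ![T₃, T₂, T₁] ![a₃, a₂] ∧
      v = twistedMul m ![T₃, T₂, T₁, T₀] ![a₃, a₂, a₁]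
          - twistedMul m ![T₃, T₁, T₀] ![h₂, a₁]
          - twistedMul m ![T₃, T₂, T₀] ![a₃, h₁]
          + twistedMul m ![T₃, T₀] ![w]}

/-- The Massey product `MP(θ_{α'}, η_β, θ_α)` of the morphisms
`X_1 → Y_1 → X_2 → Y_2` of twisted objects. -/
def masseyTheta (m : CyclicAInf R n) (α' β α : Fin n) : Set (TwMor R n 2) :=
  masseyProduct m (.Y, 1) (.X, 1) (.Y, 0) (.X, 0) 0 1 0
    (basisMor (.theta α')) (basisMor (.eta β)) (basisMor (.theta α))

/-- `r` is obtained by dualization from the (well-defined and univalued) Massey products: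
`r = ∑ ⟨MP(θ_{α'}, η_β, θ_α), η_{β'}⟩ e_{β'α'} ⊗ e_{βα}`. -/
def IsMasseyTensor (m : CyclicAInf R n)
    (r : Matrix (Fin n × Fin n) (Fin n × Fin n) (Coef R 2)) : Prop :=
  ∀ α' β α : Fin n, ∃ v : TwMor R n 2, masseyTheta m α' β α = {v} ∧
    ∀ β' : Fin n, r (β', β) (α', α) = ∑ c, v c * pairing (Coef R 2) c (.eta β')

end Massey

end AYBE

end

/-! A family of operations is read dually: for each output letter `c`, the coefficients `F · c` form
a noncommutative power series in the basis letters. In this language an A∞-structure is an odd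
derivation `derive op` of square zero, a functor is a substitution `blockSubst F` intertwining two
such derivations, and cyclicity says that the constant two-form `twoForm` is killed by the
derivation and preserved by the substitution.

Degrees and the form leave little freedom. The letters ξ have reduced degree 0, and in a path
without identities the letters θ and η alternate. Up to rotation of cyclic words, all higher
products are therefore given by the coefficients of θ_g in μ(ξ^*, θ, ξ^*, η, ξ^*, θ, ξ^*). Counting
the ξ's in the four runs by x_2, y_1, x_1, y_2 turns them into a power series `quad`, which is minus
the regular part of r. Rotation by two letters is the skew-symmetry (`quad_skew`). The same
rotation, applied to the defect of an equation (`eq_zero_of_rotation`), shows that the A∞-relations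
need testing only on words of type θηθηθ, and the functor equations only on words of type θηθ, both
with output θ.

The products μ₂(η, θ) and μ₂(θ, η) put one more ξ between two runs of ξ's, and the generating series
of words with such an additional ξ is a divided difference (`sub_mul_genSeries_xi`). So the terms of
the quintic relation which contain μ₂ are differences of `quad`'s divided by x_i - x_j or y_i - y_j.
These are the cross terms that appear in products of r's once the polar part is added to -`quad`,
while the products of two polar terms cancel by partial fractions. Hence the quintic relation is the
Yang–Baxter equation (`entry_quintic`). In the Massey product the same polar part comes from the
homotopies, because the twisted differential of an identity is a difference of variables times ξ
(`masseyTheta_eq`). Conversely, the regular part of a skew solution is a cyclic potential, whose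
operations satisfy the A∞-relations because the solution satisfies the Yang–Baxter equation
(`solution_surjective`).

For a functor, the components θ ↦ θ form a matrix φ(x, y). Preservation of the form makes the
components η ↦ η its inverse and gives the components (η, θ) ↦ id and (θ, η) ↦ id as divided
differences; every invertible φ occurs (`exists_isFunctorData`). On words θηθ the functor equation
becomes the gauge formula for φ (`IsFunctorData.gauge_iff`), and f^1 = id corresponds to constant
term 1. Both bijections, and the fact that all four relations are equivalences, follow from this
dictionary. -/

open scoped Kronecker

noncomputable section

namespace AYBE

open MvPowerSeries

section

/-! ### Sums over the splittings of a word -/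

section SplitSum

variable {α M : Type*} [AddCommMonoid M]

/-- The sum of `φ u v` over all the ways to write `w = u ++ v`. -/
def splitSum : (List α → List α → M) → List α → M
  | φ, [] => φ [] []
  | φ, a :: w => φ [] (a :: w) + splitSum (fun u v => φ (a :: u) v) w

@[simp] theorem splitSum_nil (φ : List α → List α → M) : splitSum φ [] = φ [] [] := rfl

@[simp] theorem splitSum_cons (φ : List α → List α → M) (a : α) (w : List α) :
    splitSum φ (a :: w) = φ [] (a :: w) + splitSum (fun u v => φ (a :: u) v) w := rfl

theorem splitSum_eq_sum_range (φ : List α → List α → M) (w : List α) :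
    splitSum φ w = ∑ p ∈ Finset.range (w.length + 1), φ (w.take p) (w.drop p) := by
  induction w generalizing φ with
  | nil => simp
  | cons a w ih =>
    rw [splitSum_cons, ih, List.length_cons, Finset.sum_range_succ' _ (w.length + 1), add_comm]
    simp

theorem splitSum_congr {φ ψ : List α → List α → M} {w : List α}
    (h : ∀ u v, u ++ v = w → φ u v = ψ u v) : splitSum φ w = splitSum ψ w := by
  rw [splitSum_eq_sum_range, splitSum_eq_sum_range]
  exact Finset.sum_congr rfl fun p _ => h _ _ (List.take_append_drop p w)

theorem splitSum_eq_zero {φ : List α → List α → M} {w : List α}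
    (h : ∀ u v, u ++ v = w → φ u v = 0) : splitSum φ w = 0 := by
  rw [splitSum_eq_sum_range]
  exact Finset.sum_eq_zero fun p _ => h _ _ (List.take_append_drop p w)

theorem exists_of_splitSum_ne_zero {φ : List α → List α → M} {w : List α} (h : splitSum φ w ≠ 0) :
    ∃ u v, u ++ v = w ∧ φ u v ≠ 0 := by
  by_contra! h'
  exact h (splitSum_eq_zero h')

theorem splitSum_add (φ ψ : List α → List α → M) (w : List α) :
    splitSum (fun u v => φ u v + ψ u v) w = splitSum φ w + splitSum ψ w := by
  simp only [splitSum_eq_sum_range, Finset.sum_add_distrib]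

theorem splitSum_sum {ι : Type*} (s : Finset ι) (φ : ι → List α → List α → M) (w : List α) :
    splitSum (fun u v => ∑ i ∈ s, φ i u v) w = ∑ i ∈ s, splitSum (φ i) w := by
  simp only [splitSum_eq_sum_range]
  exact Finset.sum_comm

theorem map_splitSum {M' : Type*} [AddCommMonoid M'] (f : M →+ M') (φ : List α → List α → M)
    (w : List α) : f (splitSum φ w) = splitSum (fun u v => f (φ u v)) w := by
  simp only [splitSum_eq_sum_range, map_sum]

theorem mul_splitSum {K : Type*} [CommRing K] (r : K) (φ : List α → List α → K) (w : List α) :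
    r * splitSum φ w = splitSum (fun u v => r * φ u v) w :=
  map_splitSum (AddMonoidHom.mulLeft r) φ w

theorem splitSum_mul {K : Type*} [CommRing K] (r : K) (φ : List α → List α → K) (w : List α) :
    splitSum φ w * r = splitSum (fun u v => φ u v * r) w :=
  map_splitSum (AddMonoidHom.mulRight r) φ w

theorem splitSum_append_cons (φ : List α → List α → M) (u : List α) (b : α) (z : List α) :
    splitSum φ (u ++ b :: z) = splitSum (fun u₁ u₂ => φ u₁ (u₂ ++ b :: z)) u +
      splitSum (fun z₁ z₂ => φ (u ++ b :: z₁) z₂) z := by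
  induction u generalizing φ with
  | nil => simp
  | cons a u ih => simp [ih, add_assoc]

theorem splitSum_append_singleton (φ : List α → List α → M) (u : List α) (b : α) :
    splitSum φ (u ++ [b]) = splitSum (fun u₁ u₂ => φ u₁ (u₂ ++ [b])) u + φ (u ++ [b]) [] := by
  rw [splitSum_append_cons]; simp

/-- Both sides run over the ways to cut `w` into three consecutive pieces. -/
theorem splitSum_assoc (K : List α → List α → List α → M) (w : List α) :
    splitSum (fun u m => splitSum (fun v z => K u v z) m) w =
      splitSum (fun m z => splitSum (fun u v => K u v z) m) w := by
  induction w generalizing K with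
  | nil => rfl
  | cons a w ih =>
    simp only [splitSum_cons, splitSum_nil, ih, splitSum_add]
    rw [add_assoc]

theorem splitSum_comm {β : Type*} (K : List α → List α → List β → List β → M) (w : List α)
    (w' : List β) :
    splitSum (fun u v => splitSum (fun u' v' => K u v u' v') w') w =
      splitSum (fun u' v' => splitSum (fun u v => K u v u' v') w) w' := by
  simp only [splitSum_eq_sum_range]
  exact Finset.sum_comm

/-- A cut either divides the run of `x` (at its ends included) or comes after the letter `a`. -/
theorem splitSum_replicate_append_cons (φ : List α → List α → M) (x : α) (k : ℕ) (a : α)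
    (w : List α) :
    splitSum φ (List.replicate k x ++ a :: w) =
      ∑ p ∈ Finset.HasAntidiagonal.antidiagonal k, φ (List.replicate p.1 x) (List.replicate p.2 x ++ a :: w) +
        splitSum (fun u v => φ (List.replicate k x ++ a :: u) v) w := by
  induction k generalizing φ with
  | zero => simp
  | succ k ih =>
    rw [List.replicate_succ, List.cons_append, splitSum_cons, ih,
      Finset.Nat.sum_antidiagonal_succ, add_assoc]
    simp [List.replicate_succ]

theorem splitSum_replicate (φ : List α → List α → M) (x : α) (k : ℕ) :
    splitSum φ (List.replicate k x) =
      ∑ p ∈ Finset.HasAntidiagonal.antidiagonal k, φ (List.replicate p.1 x) (List.replicate p.2 x) := by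
  induction k generalizing φ with
  | zero => simp
  | succ k ih =>
    rw [List.replicate_succ, splitSum_cons, ih, Finset.Nat.sum_antidiagonal_succ]
    simp [List.replicate_succ]

end SplitSum

/-! ### Noncommutative power series -/

section Convolution

variable {α R : Type*} [CommRing R]

/-- The product of noncommutative power series, given by their coefficients. -/
def conv (g h : List α → R) (w : List α) : R := splitSum (fun u v => g u * h v) w

theorem conv_assoc (f g h : List α → R) : conv (conv f g) h = conv f (conv g h) := by
  funext w
  simp only [conv, mul_splitSum, splitSum_mul]
  rw [splitSum_assoc (fun u v z => f u * (g v * h z))]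
  simp only [mul_assoc]

theorem conv_add (f g h : List α → R) (w : List α) :
    conv f (fun u => g u + h u) w = conv f g w + conv f h w := by
  simp only [conv, mul_add, splitSum_add]

theorem add_conv (f g h : List α → R) (w : List α) :
    conv (fun u => f u + g u) h w = conv f h w + conv g h w := by
  simp only [conv, add_mul, splitSum_add]

theorem sum_conv {ι : Type*} (s : Finset ι) (f : ι → List α → R) (g : List α → R) (w : List α) :
    conv (fun u => ∑ i ∈ s, f i u) g w = ∑ i ∈ s, conv (f i) g w := by
  simp only [conv, Finset.sum_mul, splitSum_sum]

theorem smul_conv (r : R) (f g : List α → R) (w : List α) :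
    conv (fun u => r * f u) g w = r * conv f g w := by
  simp only [conv, mul_splitSum, mul_assoc]

theorem conv_smul (r : R) (f g : List α → R) (w : List α) :
    conv f (fun u => r * g u) w = r * conv f g w := by
  simp only [conv, mul_splitSum, mul_left_comm]

theorem conv_cons (f g : List α → R) (a : α) (w : List α) :
    conv f g (a :: w) = f [] * g (a :: w) + conv (fun u => f (a :: u)) g w := rfl

/-- The noncommutative variable of a letter. -/
def letter [DecidableEq α] (a : α) (w : List α) : R := if w = [a] then 1 else 0

theorem conv_letter_cons [DecidableEq α] (a b : α) (g : List α → R) (w : List α) :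
    conv (letter a) g (b :: w) = if b = a then g w else 0 := by
  rw [conv_cons]
  have : (letter a [] : R) = 0 := by simp [letter]
  rw [this, zero_mul, zero_add]
  cases w with
  | nil => simp [conv, letter]
  | cons c w =>
    rw [conv_cons]
    by_cases h : b = a <;> simp [letter, h, conv, splitSum_eq_zero]

theorem conv_letter_nil [DecidableEq α] (a : α) (g : List α → R) : conv (letter a) g [] = 0 := by
  simp [conv, letter]

theorem conv_append_letter [DecidableEq α] (a b : α) (g : List α → R) (w : List α) :
    conv g (letter a) (w ++ [b]) = if b = a then g w else 0 := by
  induction w generalizing g with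
  | nil => simp [conv, letter]
  | cons c w ih => rw [List.cons_append, conv_cons, ih]; simp [letter]

end Convolution

/-! ### Paths, degrees and the insertion derivation -/

section Insertion

variable {R : Type*} [CommRing R] {n : ℕ}

theorem sgn_add (a b : ℤ) : sgn R (a + b) = sgn R a * sgn R b := by
  simp [sgn, Int.negOnePow_add]

@[simp] theorem sgn_zero : sgn R 0 = 1 := by simp [sgn]

@[simp] theorem sgn_one : sgn R 1 = -1 := by simp [sgn]

@[simp] theorem sgn_neg (a : ℤ) : sgn R (-a) = sgn R a := by simp [sgn, Int.negOnePow_neg]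

@[simp] theorem sgn_mul_self (a : ℤ) : sgn R a * sgn R a = 1 := by
  rw [← sgn_add, sgn, Int.negOnePow_even _ (by simp)]; simp

theorem sgn_add_one (a : ℤ) : sgn R (a + 1) = -sgn R a := by simp [sgn_add]

@[simp] theorem redDeg_nil : redDeg ([] : List (Gen n)) = 0 := rfl

@[simp] theorem redDeg_cons (a : Gen n) (w : List (Gen n)) :
    redDeg (a :: w) = a.deg - 1 + redDeg w := by simp [redDeg]

@[simp] theorem redDeg_append (u v : List (Gen n)) : redDeg (u ++ v) = redDeg u + redDeg v := by
  simp [redDeg]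

/-- `w` is a path from `o'` to `o`, the last letter being applied first. -/
def IsPath : Obj → Obj → List (Gen n) → Prop
  | o, o', [] => o = o'
  | o, o', a :: w => a.tgt = o ∧ IsPath a.src o' w

theorem isPath_append {o o' : Obj} {u v : List (Gen n)} :
    IsPath o o' (u ++ v) ↔ ∃ p, IsPath o p u ∧ IsPath p o' v := by
  induction u generalizing o with
  | nil => simp [IsPath]
  | cons a u ih => simp only [List.cons_append, IsPath, ih]; grind

theorem IsPath.insert {o o' : Obj} {u v z : List (Gen n)} {b : Gen n}
    (h : IsPath o o' (u ++ b :: z)) (hv : IsPath b.tgt b.src v) : IsPath o o' (u ++ (v ++ z)) := by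
  obtain ⟨p, hp, hb, hz⟩ := isPath_append.1 h
  exact isPath_append.2 ⟨p, hp, isPath_append.2 ⟨b.src, hb ▸ hv, hz⟩⟩

theorem isPath_iff_composable {o o' : Obj} {w : List (Gen n)} (hw : w ≠ []) :
    IsPath o o' w ↔ Composable w ∧ w.head?.map Gen.tgt = some o ∧
      w.getLast?.map Gen.src = some o' := by
  induction w generalizing o with
  | nil => exact absurd rfl hw
  | cons a w ih =>
    cases w with
    | nil => simp [IsPath, Composable]
    | cons b w =>
      have := @ih a.src (by simp)
      simp only [IsPath, Composable, List.isChain_cons_cons, List.getLast?_cons_cons,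
        List.head?_cons, Option.map_some, Option.some.injEq] at this ⊢
      grind

/-- The coefficients of `F` are supported on paths parallel to the output, and `F` raises the
reduced degree by `p`. -/
def Graded (p : ℤ) (F : Ops R n) : Prop :=
  ∀ w c, F w c ≠ 0 → w ≠ [] ∧ IsPath c.tgt c.src w ∧ c.deg - 1 = redDeg w + p

theorem redDeg_eq (w : List (Gen n)) : redDeg w = (w.map Gen.deg).sum - w.length := by
  induction w with
  | nil => simp
  | cons a w ih => simp [ih]; ring

/-- With degrees shifted by one, an operation of degree 1 + p - k on k inputs raises the degree by p
for every k. Thus A∞-products are the case p = 1 and functors the case p = 0. -/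
theorem homogeneous_iff_graded (p : ℤ) (F : Ops R n) :
    Homogeneous (fun k => 1 + p - (k : ℤ)) F ↔ Graded p F := by
  refine forall₃_congr fun w c _ => ?_
  rw [redDeg_eq]
  refine and_congr_right fun hw => ?_
  rw [isPath_iff_composable hw]
  constructor
  · rintro ⟨h₁, h₂, h₃, h₄⟩; exact ⟨⟨h₁, h₂, h₃⟩, by rw [h₄]; ring⟩
  · rintro ⟨⟨h₁, h₂, h₃⟩, h₄⟩; exact ⟨h₁, h₂, h₃, by linarith⟩

theorem Graded.nil {p : ℤ} {F : Ops R n} (hF : Graded p F) (c : Gen n) : F [] c = 0 := by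
  by_contra h; exact (hF _ _ h).1 rfl

/-- The action of a family of operations on noncommutative power series: the signed sum over all
ways to apply `G` to a block of consecutive letters. -/
def derive (G : Ops R n) (g : List (Gen n) → R) (w : List (Gen n)) : R :=
  splitSum (fun m z => splitSum (fun u v =>
    sgn R (redDeg z) * ∑ b : Gen n, G v b * g (u ++ b :: z)) m) w

theorem insertion_eq_derive (F G : Ops R n) (w : List (Gen n)) (c : Gen n) :
    insertion F G w c = derive G (fun v => F v c) w := by
  rw [insertion, derive, splitSum_eq_sum_range]
  refine Finset.sum_congr rfl fun q hq => ?_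
  have hq' : q ≤ w.length := by simpa [Nat.lt_succ_iff] using hq
  rw [splitSum_eq_sum_range, List.length_take, min_eq_left hq']
  refine Finset.sum_congr rfl fun p hp => ?_
  have hp' : p ≤ q := by simpa [Nat.lt_succ_iff] using hp
  rw [List.take_take, min_eq_left hp', List.drop_take]

/-- The sign involution of noncommutative power series. -/
def twist (g : List (Gen n) → R) (w : List (Gen n)) : R := sgn R (redDeg w) * g w

theorem twist_twist (g : List (Gen n) → R) : twist (twist g) = g := by
  funext w; simp [twist, ← mul_assoc]

/-- The letter that is expanded into a block lies in one of the two factors. The sign counts what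
stands to the right of the block, so a block in the left factor also picks up the sign of the whole
right factor: this is the Leibniz rule of an odd derivation acting from the right. -/
theorem derive_conv (G : Ops R n) (g h : List (Gen n) → R) (w : List (Gen n)) :
    derive G (conv g h) w = conv (derive G g) (twist h) w + conv g (derive G h) w := by
  have key : ∀ u v z : List (Gen n),
      sgn R (redDeg z) * ∑ b : Gen n, G v b * conv g h (u ++ b :: z) =
        splitSum (fun z₁ z₂ => (sgn R (redDeg z₁) * ∑ b : Gen n, G v b * g (u ++ b :: z₁)) *
            twist h z₂) z +
          splitSum (fun u₁ u₂ => g u₁ *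
            (sgn R (redDeg z) * ∑ b : Gen n, G v b * h (u₂ ++ b :: z))) u := by
    intro u v z
    have h1 : ∀ b, conv g h (u ++ b :: z) = splitSum (fun u₁ u₂ => g u₁ * h (u₂ ++ b :: z)) u +
        splitSum (fun z₁ z₂ => g (u ++ b :: z₁) * h z₂) z := fun b => splitSum_append_cons _ _ _ _
    simp only [h1, mul_add, Finset.sum_add_distrib, Finset.mul_sum, mul_splitSum, Finset.sum_mul,
      splitSum_sum]
    rw [add_comm]
    congr 1
    · refine Finset.sum_congr rfl fun b _ => splitSum_congr fun z₁ z₂ hz => ?_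
      rw [← hz, redDeg_append, sgn_add, twist]; ring
    · refine Finset.sum_congr rfl fun b _ => splitSum_congr fun z₁ z₂ hz => ?_
      ring
  simp only [derive, key]
  simp only [splitSum_add, conv, derive, splitSum_mul, mul_splitSum]
  congr 1
  · simp only [splitSum_comm (K := fun u v z₁ z₂ => (sgn R (redDeg z₁) *
      ∑ b : Gen n, G v b * g (u ++ b :: z₁)) * twist h z₂)]
    exact splitSum_assoc (fun m z₁ z₂ => splitSum (fun u v => (sgn R (redDeg z₁) *
      ∑ b : Gen n, G v b * g (u ++ b :: z₁)) * twist h z₂) m) w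
  · rw [splitSum_assoc (fun u₁ m z => splitSum (fun u₂ v => g u₁ * (sgn R (redDeg z) *
      ∑ b : Gen n, G v b * h (u₂ ++ b :: z))) m)]
    refine splitSum_congr fun m z _ => ?_
    exact (splitSum_assoc (fun u₁ u₂ v => g u₁ * (sgn R (redDeg z) *
      ∑ b : Gen n, G v b * h (u₂ ++ b :: z))) m).symm

end Insertion

end

section

/-! ### The derivation of a family of operations: linearity, square, values on letters. -/

section Derive

variable {R : Type*} [CommRing R] {n : ℕ}

theorem derive_sum {ι : Type*} (s : Finset ι) (G : Ops R n) (g : ι → List (Gen n) → R)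
    (w : List (Gen n)) : derive G (fun u => ∑ i ∈ s, g i u) w = ∑ i ∈ s, derive G (g i) w := by
  simp only [derive, ← splitSum_sum]
  refine splitSum_congr fun m z _ => splitSum_congr fun u v _ => ?_
  rw [← Finset.mul_sum, Finset.sum_comm]
  simp only [Finset.mul_sum]

theorem derive_smul (G : Ops R n) (r : R) (g : List (Gen n) → R) (w : List (Gen n)) :
    derive G (fun u => r * g u) w = r * derive G g w := by
  simp only [derive, mul_splitSum, Finset.mul_sum]
  simp only [mul_left_comm]

theorem derive_add (G : Ops R n) (g h : List (Gen n) → R) (w : List (Gen n)) :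
    derive G (fun u => g u + h u) w = derive G g w + derive G h w := by
  simp only [derive, ← splitSum_add]
  refine splitSum_congr fun m z _ => splitSum_congr fun u v _ => ?_
  simp only [mul_add, Finset.sum_add_distrib]

theorem derive_zero (G : Ops R n) (w : List (Gen n)) : derive G (fun _ => 0) w = 0 := by
  simpa using derive_smul G 0 (fun _ => 0) w

theorem exists_of_derive_ne_zero {G : Ops R n} {g : List (Gen n) → R} {w : List (Gen n)}
    (h : derive G g w ≠ 0) :
    ∃ u v z b, w = u ++ (v ++ z) ∧ G v b ≠ 0 ∧ g (u ++ b :: z) ≠ 0 := by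
  obtain ⟨m, z, rfl, h₁⟩ := exists_of_splitSum_ne_zero h
  obtain ⟨u, v, rfl, h₂⟩ := exists_of_splitSum_ne_zero h₁
  obtain ⟨b, -, hb⟩ := Finset.exists_ne_zero_of_sum_ne_zero (right_ne_zero_of_mul h₂)
  exact ⟨u, v, z, b, List.append_assoc _ _ _, left_ne_zero_of_mul hb, right_ne_zero_of_mul hb⟩

theorem Graded.insertion {p q : ℤ} {F G : Ops R n} (hF : Graded p F) (hG : Graded q G) :
    Graded (p + q) (insertion F G) := by
  intro w c h
  rw [insertion_eq_derive] at h
  obtain ⟨u, v, z, b, rfl, hv, hu⟩ := exists_of_derive_ne_zero h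
  obtain ⟨h₁, h₂, h₃⟩ := hG _ _ hv
  obtain ⟨-, h₄, h₅⟩ := hF _ _ hu
  refine ⟨by simp [h₁], h₄.insert h₂, ?_⟩
  rw [h₅]
  simp only [redDeg_append, redDeg_cons, h₃]
  ring

/-- An operation with p = 1 changes the parity of the reduced degree. -/
theorem derive_twist {G : Ops R n} (hG : Graded 1 G) (h : List (Gen n) → R) (w : List (Gen n)) :
    derive G (twist h) w = -twist (derive G h) w := by
  rw [twist, derive, derive, mul_splitSum, ← neg_one_mul, mul_splitSum]
  refine splitSum_congr fun m z hm => ?_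
  rw [mul_splitSum, mul_splitSum]
  refine splitSum_congr fun u v hu => ?_
  simp only [Finset.mul_sum]
  refine Finset.sum_congr rfl fun b _ => ?_
  by_cases hv : G v b = 0
  · simp [hv]
  · obtain ⟨-, -, hb⟩ := hG _ _ hv
    subst hm hu
    rw [twist]
    simp only [redDeg_append, redDeg_cons, hb]
    rw [show redDeg u + (redDeg v + 1 + redDeg z) = redDeg u + redDeg v + redDeg z + 1 by ring,
      sgn_add_one]
    ring

/-- The square of an odd derivation is an ordinary derivation: the two mixed terms cancel by
`derive_twist`. -/
theorem derive_derive_conv {G : Ops R n} (hG : Graded 1 G) (g h : List (Gen n) → R)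
    (w : List (Gen n)) :
    derive G (derive G (conv g h)) w =
      conv (derive G (derive G g)) h w + conv g (derive G (derive G h)) w := by
  have h₁ : derive G (conv g h) = fun u => conv (derive G g) (twist h) u + conv g (derive G h) u :=
    funext fun u => derive_conv G g h u
  rw [h₁, derive_add, derive_conv, derive_conv, twist_twist]
  have h₂ : derive G (twist h) = fun u => (-1) * twist (derive G h) u :=
    funext fun u => by rw [derive_twist hG, neg_one_mul]
  rw [h₂, conv_smul]
  ring

/-- A one-letter word results only when the block is the whole word. So `derive G` is the derivation
with prescribed values on the letters, and the A∞-relations say that its square kills them. -/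
theorem derive_letter (G : Ops R n) (c : Gen n) (w : List (Gen n)) :
    derive G (letter c) w = G w c := by
  rw [derive]
  have h : ∀ m z : List (Gen n), z ≠ [] → splitSum (fun u v => sgn R (redDeg z) * ∑ b : Gen n,
      G v b * (letter c (u ++ b :: z) : R)) m = 0 := by
    intro m z hz
    refine splitSum_eq_zero fun u v _ => ?_
    rw [Finset.sum_eq_zero, mul_zero]
    intro b _
    rw [letter, if_neg, mul_zero]
    intro h
    have := congrArg List.length h
    have := List.length_pos_of_ne_nil hz
    simp at *; omega
  rcases List.eq_nil_or_concat w with rfl | ⟨w, a, rfl⟩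
  · simp [letter]
  · rw [List.concat_eq_append, splitSum_append_singleton, splitSum_eq_zero, zero_add]
    · generalize w ++ [a] = m
      cases m with
      | nil => simp [letter]
      | cons a m =>
        rw [splitSum_cons, splitSum_eq_zero]
        · simp [letter]
        · intro u v _
          simp [letter]
    · intro u v _
      exact h _ _ (by simp)

/-- The block either starts at the beginning of the word or leaves the first letter untouched. -/
theorem derive_cons (G : Ops R n) (g : List (Gen n) → R) (a : Gen n) (w : List (Gen n)) :
    derive G g (a :: w) = (∑ b, conv (fun v => G v b) (twist fun z => g (b :: z)) (a :: w)) +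
      derive G (fun v => g (a :: v)) w := by
  have h : ∀ g : List (Gen n) → R, ∀ w, derive G g w = splitSum (fun u m => ∑ b,
      conv (fun v => G v b) (twist fun z => g (u ++ b :: z)) m) w := by
    intro g w
    rw [derive, ← splitSum_assoc (fun u v z => sgn R (redDeg z) * ∑ b : Gen n,
      G v b * g (u ++ b :: z))]
    refine splitSum_congr fun u m _ => ?_
    simp only [conv, twist, Finset.mul_sum, splitSum_sum]
    simp only [mul_left_comm]
  rw [h, h, splitSum_cons]
  simp

end Derive

/-! ### Substitution of a family of operations into a noncommutative power series -/

section BlockSubst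

variable {R : Type*} [CommRing R] {n : ℕ}

/-- The substitution of `F` into a noncommutative power series `g`: the sum over all ways to cut
the word into nonempty blocks. -/
def blockSubst (F : Ops R n) (g : List (Gen n) → R) (w : List (Gen n)) : R :=
  ∑ κ : Composition w.length, ∑ b : Fin κ.length → Gen n,
    (∏ i : Fin κ.length, F ((w.splitWrtComposition κ).getD i []) (b i)) * g (List.ofFn b)

theorem blockSum_eq_blockSubst (G F : Ops R n) (w : List (Gen n)) (c : Gen n) :
    blockSum G F w c = blockSubst F (fun v => G v c) w := rfl

/-- The contribution to `blockSubst` of the cutting into blocks of given lengths. -/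
def cutSubst (F : Ops R n) : (List (Gen n) → R) → List ℕ → List (Gen n) → R
  | g, [], _ => g []
  | g, k :: ks, w => ∑ b, F (w.take k) b * cutSubst F (fun v => g (b :: v)) ks (w.drop k)

theorem sum_splitWrtCompositionAux (F : Ops R n) (g : List (Gen n) → R) (ks : List ℕ)
    (w : List (Gen n)) :
    ∑ b : Fin ks.length → Gen n, (∏ i : Fin ks.length,
      F ((w.splitWrtCompositionAux ks).getD i []) (b i)) * g (List.ofFn b) =
      cutSubst F g ks w := by
  induction ks generalizing g w with
  | nil => simp [cutSubst]
  | cons k ks ih =>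
    rw [cutSubst]
    simp only [← ih, Finset.mul_sum]
    rw [← Fintype.sum_prod_type']
    refine (Fintype.sum_equiv (Fin.consEquiv fun _ : Fin (ks.length + 1) => Gen n) _ _
      fun b => ?_).symm
    refine Eq.trans ?_ (congrArg (· * _) (Fin.prod_univ_succ (n := ks.length) _).symm)
    simp [Fin.consEquiv, List.splitWrtCompositionAux_cons, List.ofFn_succ, mul_assoc]

theorem blockSubst_eq_sum_cutSubst (F : Ops R n) (g : List (Gen n) → R) (w : List (Gen n)) :
    blockSubst F g w = ∑ κ : Composition w.length, cutSubst F g κ.blocks w :=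
  Finset.sum_congr rfl fun κ _ => sum_splitWrtCompositionAux F g κ.blocks w

/-- A composition with the first block split off. -/
def consComposition {N : ℕ} (k : ℕ) (hk : 0 < k) (hkN : k ≤ N) (κ : Composition (N - k)) :
    Composition N where
  blocks := k :: κ.blocks
  blocks_pos := by
    intro i hi
    rcases List.mem_cons.1 hi with rfl | hi
    · exact hk
    · exact κ.blocks_pos hi
  blocks_sum := by rw [List.sum_cons, κ.blocks_sum]; omega

/-- Compositions of `N + 1` are sorted by their first part `k + 1`. -/
theorem sum_composition_succ {M : Type*} [AddCommMonoid M] (N : ℕ) (h : List ℕ → M) :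
    ∑ κ : Composition (N + 1), h κ.blocks =
      ∑ k ∈ Finset.range (N + 1), ∑ κ : Composition (N - k), h ((k + 1) :: κ.blocks) := by
  rw [Finset.sum_sigma']
  symm
  refine Finset.sum_bij (fun x hx => consComposition (N := N + 1) (x.1 + 1) (by omega)
    (by simp at hx; omega) (x.2.cast (by omega))) ?_ ?_ ?_ ?_
  · intros; simp
  · rintro ⟨k, κ⟩ hx ⟨k', κ'⟩ hx' heq
    have := congrArg Composition.blocks heq
    simp only [consComposition, List.cons.injEq, Nat.add_right_cancel_iff] at this
    obtain ⟨rfl, h⟩ := this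
    congr
    ext1
    simpa using h
  · rintro κ -
    rcases hb : κ.blocks with _ | ⟨k, ks⟩
    · have := κ.blocks_sum; simp [hb] at this
    · have hk : 0 < k := κ.blocks_pos (by simp [hb])
      have hs : k + ks.sum = N + 1 := by rw [← κ.blocks_sum, hb, List.sum_cons]
      refine ⟨⟨k - 1, ⟨ks, fun hi => κ.blocks_pos (by simp [hb, hi]), by omega⟩⟩, by simp; omega, ?_⟩
      ext1
      simp only [consComposition, hb, Composition.cast]
      congr 1
      omega
  · rintro ⟨k, κ⟩ hx
    simp [consComposition]

@[simp] theorem blockSubst_nil (F : Ops R n) (g : List (Gen n) → R) : blockSubst F g [] = g [] := by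
  rw [blockSubst_eq_sum_cutSubst]
  have : ∀ κ : Composition ([] : List (Gen n)).length, κ.blocks = [] := by
    intro κ
    rcases hb : κ.blocks with _ | ⟨k, ks⟩
    · rfl
    · have hk : 0 < k := κ.blocks_pos (by simp [hb])
      have hs : k + ks.sum = 0 := by rw [← List.sum_cons, ← hb, κ.blocks_sum]; rfl
      omega
  simp only [this, cutSubst, Finset.sum_const, Finset.card_univ]
  simp [composition_card]

theorem blockSubst_cons (F : Ops R n) (g : List (Gen n) → R) (a : Gen n) (w : List (Gen n)) :
    blockSubst F g (a :: w) =
      splitSum (fun u v => ∑ b, F (a :: u) b * blockSubst F (fun z => g (b :: z)) v) w := by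
  rw [blockSubst_eq_sum_cutSubst, splitSum_eq_sum_range]
  rw [show (a :: w).length = w.length + 1 from rfl,
    sum_composition_succ w.length (fun ks => cutSubst F g ks (a :: w))]
  refine Finset.sum_congr rfl fun k _ => ?_
  simp only [cutSubst, List.take_succ_cons, List.drop_succ_cons, blockSubst_eq_sum_cutSubst,
    Finset.mul_sum]
  rw [Finset.sum_comm, List.length_drop]

/-- Splitting off the first block. Since `F` vanishes on the empty word, the empty first block may
be admitted, which makes the sum a full convolution. -/
theorem blockSubst_eq_conv {F : Ops R n} (hF : ∀ c, F [] c = 0) (g : List (Gen n) → R)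
    {w : List (Gen n)} (hw : w ≠ []) :
    blockSubst F g w =
      ∑ b, conv (fun v => F v b) (blockSubst F fun z => g (b :: z)) w := by
  obtain ⟨a, w, rfl⟩ := List.exists_cons_of_ne_nil hw
  rw [blockSubst_cons, splitSum_sum]
  simp only [conv_cons, hF, zero_mul, zero_add]
  rfl

theorem blockSubst_add (F : Ops R n) (g h : List (Gen n) → R) (w : List (Gen n)) :
    blockSubst F (fun u => g u + h u) w = blockSubst F g w + blockSubst F h w := by
  simp only [blockSubst, mul_add, Finset.sum_add_distrib]

theorem blockSubst_smul (F : Ops R n) (r : R) (g : List (Gen n) → R) (w : List (Gen n)) :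
    blockSubst F (fun u => r * g u) w = r * blockSubst F g w := by
  simp only [blockSubst, Finset.mul_sum]
  simp only [mul_left_comm]

theorem blockSubst_zero (F : Ops R n) (w : List (Gen n)) : blockSubst F (fun _ => 0) w = 0 := by
  simp [blockSubst]

theorem blockSubst_sum {ι : Type*} (s : Finset ι) (F : Ops R n) (g : ι → List (Gen n) → R)
    (w : List (Gen n)) :
    blockSubst F (fun u => ∑ i ∈ s, g i u) w = ∑ i ∈ s, blockSubst F (g i) w := by
  classical
  induction s using Finset.induction_on with
  | empty => simp [blockSubst_zero]
  | insert i s hi ih => simp only [Finset.sum_insert hi, blockSubst_add, ih]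

/-- Substitution is a ring homomorphism: cutting the word of outputs in two amounts to cutting the
input word at the corresponding end of a block. -/
theorem blockSubst_conv (F : Ops R n) (g h : List (Gen n) → R)
    (w : List (Gen n)) :
    blockSubst F (conv g h) w = conv (blockSubst F g) (blockSubst F h) w := by
  induction hN : w.length using Nat.strong_induction_on generalizing w g with
  | _ N ih =>
  cases w with
  | nil => simp [conv]
  | cons a w =>
    have h1 : ∀ b, (fun z => conv g h (b :: z)) =
        fun z => g [] * h (b :: z) + conv (fun u => g (b :: u)) h z := fun b => rfl
    rw [conv_cons, blockSubst_nil, blockSubst_cons, blockSubst_cons]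
    have h2 : (fun u => blockSubst F g (a :: u)) = fun u =>
        ∑ b, conv (fun v => F (a :: v) b) (blockSubst F fun z => g (b :: z)) u := by
      funext u
      rw [blockSubst_cons, splitSum_sum]
      rfl
    rw [h2, sum_conv]
    simp only [conv_assoc]
    rw [mul_splitSum, splitSum_sum, ← Finset.sum_congr rfl fun b _ => rfl]
    simp only [Finset.mul_sum, splitSum_sum]
    rw [← Finset.sum_add_distrib]
    refine Finset.sum_congr rfl fun b _ => ?_
    rw [conv, ← splitSum_add]
    refine splitSum_congr fun u v huv => ?_
    rw [h1, blockSubst_add, blockSubst_smul, ih v.length _ (fun u => g (b :: u)) v rfl]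
    · ring
    · rw [← hN, ← huv]; simp

theorem blockSubst_letter {F : Ops R n} (hF : ∀ c, F [] c = 0) (c : Gen n) (w : List (Gen n)) :
    blockSubst F (letter c) w = F w c := by
  cases w with
  | nil => simp [letter, hF]
  | cons a w =>
    rw [blockSubst_cons]
    have h : ∀ (b : Gen n) (v : List (Gen n)),
        blockSubst F (fun z => (letter c (b :: z) : R)) v = if v = [] ∧ b = c then 1 else 0 := by
      intro b v
      cases v with
      | nil => simp [letter]
      | cons d v =>
        rw [blockSubst_cons]
        simp [letter, blockSubst_zero, splitSum_eq_zero]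
    simp only [h]
    rcases List.eq_nil_or_concat w with rfl | ⟨w, d, rfl⟩
    · simp
    · rw [List.concat_eq_append, splitSum_append_singleton, splitSum_eq_zero]
      · simp
      · simp

theorem blockSubst_support {F : Ops R n} (hF : Graded 0 F) {g : List (Gen n) → R}
    {o o' : Obj} {p : ℤ} (hg : ∀ w, g w ≠ 0 → IsPath o o' w ∧ redDeg w = p)
    {w : List (Gen n)} (h : blockSubst F g w ≠ 0) : IsPath o o' w ∧ redDeg w = p := by
  induction hN : w.length using Nat.strong_induction_on generalizing w g o p with
  | _ N ih =>
  cases w with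
  | nil => rw [blockSubst_nil] at h; exact hg _ h
  | cons a w =>
    rw [blockSubst_cons] at h
    obtain ⟨u, v, rfl, h'⟩ := exists_of_splitSum_ne_zero h
    obtain ⟨b, -, hb⟩ := Finset.exists_ne_zero_of_sum_ne_zero h'
    obtain ⟨-, h₁, h₂⟩ := hF _ _ (left_ne_zero_of_mul hb)
    by_cases hbo : b.tgt = o
    · obtain ⟨h₃, h₄⟩ := ih v.length (by rw [← hN]; simp)
        (g := fun z => g (b :: z)) (o := b.src) (p := p - (b.deg - 1))
        (fun z hz => ⟨(hg _ hz).1.2, by rw [← (hg _ hz).2, redDeg_cons]; ring⟩)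
        (right_ne_zero_of_mul hb) rfl
      refine ⟨?_, ?_⟩
      · rw [← List.cons_append]
        exact isPath_append.2 ⟨b.src, hbo ▸ h₁, h₃⟩
      · rw [← List.cons_append, redDeg_append, h₄]; linarith
    · exfalso
      apply right_ne_zero_of_mul hb
      have : (fun z => g (b :: z)) = fun _ => 0 := by
        funext z
        by_contra hz
        exact hbo (hg _ hz).1.1
      rw [this, blockSubst_zero]

theorem Graded.blockSum {q : ℤ} {F G : Ops R n} (hF : Graded 0 F) (hG : Graded q G) :
    Graded q (blockSum G F) := by
  intro w c h
  rw [blockSum_eq_blockSubst] at h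
  have := blockSubst_support hF (o := c.tgt) (o' := c.src) (p := c.deg - 1 - q)
    (fun w hw => ⟨(hG _ _ hw).2.1, by rw [(hG _ _ hw).2.2]; ring⟩) h
  refine ⟨?_, this.1, by rw [this.2]; ring⟩
  rintro rfl
  rw [blockSubst_nil] at h
  exact h (hG.nil c)

/-- A family with p = 0 preserves reduced degrees, hence all signs. -/
theorem blockSubst_twist {F : Ops R n} (hF : Graded 0 F) (g : List (Gen n) → R)
    (w : List (Gen n)) : blockSubst F (twist g) w = twist (blockSubst F g) w := by
  induction hN : w.length using Nat.strong_induction_on generalizing w g with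
  | _ N ih =>
  cases w with
  | nil => simp [twist]
  | cons a w =>
    rw [blockSubst_cons, twist, blockSubst_cons, mul_splitSum]
    refine splitSum_congr fun u v huv => ?_
    rw [Finset.mul_sum]
    refine Finset.sum_congr rfl fun b _ => ?_
    by_cases hb : F (a :: u) b = 0
    · simp [hb]
    · obtain ⟨-, -, h₂⟩ := hF _ _ hb
      have h₃ : (fun z => twist g (b :: z)) =
          fun z => sgn R (b.deg - 1) * twist (fun z => g (b :: z)) z := by
        funext z; rw [twist, twist, redDeg_cons, sgn_add, mul_assoc]
      rw [h₃, blockSubst_smul, ih v.length (by rw [← hN, ← huv]; simp) _ v rfl, twist,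
        ← huv, ← List.cons_append, redDeg_append, sgn_add, h₂, add_zero]
      ring

end BlockSubst

end

section

/-! ### The pairing and its Gram matrix. -/

section Pairing

variable {R : Type*} [CommRing R] {n : ℕ}

/-- The dual basis element with respect to the pairing, up to sign. -/
def Gen.dual : Gen n → Gen n
  | one o => xi o
  | xi o => one o
  | theta i => eta i
  | eta i => theta i

@[simp] theorem Gen.dual_dual (a : Gen n) : a.dual.dual = a := by cases a <;> rfl
@[simp] theorem Gen.dual_src (a : Gen n) : a.dual.src = a.tgt := by cases a <;> rfl
@[simp] theorem Gen.dual_tgt (a : Gen n) : a.dual.tgt = a.src := by cases a <;> rfl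
@[simp] theorem Gen.dual_deg (a : Gen n) : a.dual.deg = 1 - a.deg := by cases a <;> rfl

theorem Gen.deg_eq (a : Gen n) : a.deg = 0 ∨ a.deg = 1 := by cases a <;> simp [Gen.deg]

theorem Gen.sum_eq {M : Type*} [AddCommMonoid M] (f : Gen n → M) :
    ∑ a, f a = (∑ o, f (one o) + ∑ o, f (xi o)) + (∑ i, f (theta i) + ∑ i, f (eta i)) := by
  classical
  have : (Finset.univ : Finset (Gen n)) =
      ((Finset.univ.image one) ∪ (Finset.univ.image xi)) ∪
        ((Finset.univ.image theta) ∪ (Finset.univ.image eta)) := by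
    ext a; cases a <;> simp
  rw [this, Finset.sum_union, Finset.sum_union, Finset.sum_union, Finset.sum_image,
    Finset.sum_image, Finset.sum_image, Finset.sum_image]
  all_goals try (intro a _ b _ h; cases h; rfl)
  all_goals rw [Finset.disjoint_left]; intro a; simp; try grind

/-- The sign of the pairing of `a` with its dual. -/
def psign (R : Type*) [CommRing R] (a : Gen n) : R := -sgn R a.deg

theorem pairing_eq (a c : Gen n) : pairing R a c = if c = a.dual then psign R a else 0 := by
  cases a <;> cases c <;> simp [pairing, Gen.dual, psign, Gen.deg, eq_comm]

theorem sum_pairing (a : Gen n) (f : Gen n → R) :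
    ∑ c, pairing R a c * f c = psign R a * f a.dual := by
  simp [pairing_eq]

@[simp] theorem psign_mul_self (a : Gen n) : psign R a * psign R a = 1 := by simp [psign]

theorem psign_dual (a : Gen n) : psign R a.dual = -psign R a := by
  cases a <;> simp [psign, Gen.dual, Gen.deg]

theorem pairing_symm (a c : Gen n) : pairing R a c = -pairing R c a := by
  rw [pairing_eq, pairing_eq]
  by_cases h : c = a.dual
  · subst h; simp [psign_dual]
  · rw [if_neg h, if_neg (fun h' => h (by simp [h'])), neg_zero]

variable (R n) in
/-- The Gram matrix of the pairing. -/
def gram : Matrix (Gen n) (Gen n) R := Matrix.of (pairing R)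

theorem gram_mul_gram : gram R n * gram R n = -1 := by
  ext a b
  simp only [Matrix.mul_apply, gram, Matrix.of_apply, sum_pairing, pairing_eq a.dual,
    Gen.dual_dual, psign_dual, Matrix.neg_apply, Matrix.one_apply, eq_comm (a := a)]
  split_ifs <;> simp

end Pairing

/-! ### Vanishing of a defect by rotation of cyclic words. -/

section Rotation

variable {R : Type*} [CommRing R] {n : ℕ}

/-- The pairing of `F(a)` and `E(w)`. -/
def pairAt (F E : Ops R n) (a : Gen n) (w : List (Gen n)) : R :=
  ∑ c, ∑ d, pairing R c d * (F [a] c * E w d)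

/-- The vanishing of `pairAt` for the cyclic word `L`. -/
def CycVanish (F E : Ops R n) : List (Gen n) → Prop
  | [] => True
  | a :: w => pairAt F E a w = 0

theorem conv_eq_init {g h : List (Gen n) → R} (hh : h [] = 0) {w : List (Gen n)} (b : Gen n)
    (hg : ∀ u, u.length < w.length → g u = 0) : conv g h (w ++ [b]) = g w * h [b] := by
  induction w generalizing g with
  | nil => simp [conv, hh]
  | cons a w ih =>
    rw [List.cons_append, conv_cons, hg [] (by simp), zero_mul, zero_add, ih]
    intro u hu
    exact hg _ (by simpa using hu)

theorem conv_eq_tail {g h : List (Gen n) → R} (hg : g [] = 0) {w : List (Gen n)} (a : Gen n)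
    (hh : ∀ u, u.length < w.length → h u = 0) : conv g h (a :: w) = g [a] * h w := by
  rw [conv_cons, hg, zero_mul, zero_add]
  cases w with
  | nil => rfl
  | cons b w =>
    rw [conv_cons, conv, splitSum_eq_zero, add_zero]
    intro u v huv
    rw [hh v, mul_zero]
    rw [← huv]; simp

variable {E F : Ops R n} {ζ : List (Gen n) → R}

/-- If `E` vanishes on all shorter words, the hypothesis on the word `a, w, b` retains only the two
terms in which `F` receives a single letter, namely `b` or `a`. They are the pairings of `F` and `E`
attached to two rotations of the same cyclic word, so one vanishes when the other does. -/
theorem cycVanish_rotate_one (hF : ∀ c, F [] c = 0)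
    (h : ∀ w, ∑ c, ∑ d, pairing R c d * (conv (fun v => E v c) (fun v => ζ v * F v d) w +
      conv (fun v => F v c) (fun v => E v d) w) = 0) {L : List (Gen n)}
    (hE : ∀ u, u.length + 1 < L.length → ∀ c, E u c = 0) (hL : CycVanish F E L) :
    CycVanish F E (L.rotate 1) := by
  rcases L with _ | ⟨b, _ | ⟨a, w⟩⟩
  · trivial
  · simpa using hL
  · have h' := h (a :: (w ++ [b]))
    have h₁ : ∀ c d, conv (fun v => E v c) (fun v => ζ v * F v d) (a :: (w ++ [b])) =
        E (a :: w) c * (ζ [b] * F [b] d) := by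
      intro c d
      exact conv_eq_init (w := a :: w) (by simp [hF]) b fun u hu => hE u (by simpa using hu) c
    have h₂ : ∀ c d, conv (fun v => F v c) (fun v => E v d) (a :: (w ++ [b])) =
        F [a] c * E (w ++ [b]) d := by
      intro c d
      exact conv_eq_tail (hF c) a fun u hu => hE u (by simpa using hu) d
    simp only [h₁, h₂, mul_add, Finset.sum_add_distrib] at h'
    have h₃ : ∑ c, ∑ d, pairing R c d * (E (a :: w) c * (ζ [b] * F [b] d)) =
        -ζ [b] * pairAt F E b (a :: w) := by
      rw [pairAt, Finset.sum_comm]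
      simp only [Finset.mul_sum]
      refine Finset.sum_congr rfl fun c _ => Finset.sum_congr rfl fun d _ => ?_
      rw [pairing_symm d c]; ring
    rw [h₃, show pairAt F E b (a :: w) = 0 from hL, mul_zero, zero_add] at h'
    simpa [CycVanish, pairAt] using h'

theorem cycVanish_rotate (hF : ∀ c, F [] c = 0)
    (h : ∀ w, ∑ c, ∑ d, pairing R c d * (conv (fun v => E v c) (fun v => ζ v * F v d) w +
      conv (fun v => F v c) (fun v => E v d) w) = 0) {L L' : List (Gen n)}
    (hE : ∀ u, u.length + 1 < L.length → ∀ c, E u c = 0) (hL : CycVanish F E L)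
    (hr : L ~r L') : CycVanish F E L' := by
  obtain ⟨k, rfl⟩ := hr
  induction k with
  | zero => simpa using hL
  | succ k ih =>
    rw [← List.rotate_rotate]
    exact cycVanish_rotate_one hF h (by simpa using hE) ih

/-- Without η there is no way back from `Y` to `X`, so a path that stays at one object consists of
ξ's. -/
theorem isPath_no_eta {o o' : Obj} {w : List (Gen n)} (h : IsPath o o' w)
    (hone : ∀ p, Gen.one p ∉ w) (heta : ∀ i, Gen.eta i ∉ w) :
    (o = o' ∧ redDeg w = 0) ∨ (o = .Y ∧ o' = .X) := by
  induction w generalizing o with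
  | nil => exact Or.inl ⟨h, rfl⟩
  | cons a w ih =>
    have ih' := ih h.2 (fun p hp => hone p (by simp [hp])) (fun p hp => heta p (by simp [hp]))
    obtain ⟨h₁, -⟩ := h
    cases a with
    | one p => exact absurd List.mem_cons_self (hone p)
    | eta i => exact absurd List.mem_cons_self (heta i)
    | xi p => simpa [Gen.src, Gen.tgt, Gen.deg, ← h₁] using ih'
    | theta i =>
      simp only [Gen.src, Gen.tgt] at ih' h₁
      grind

/-- Induction on length. By nondegeneracy it suffices to pair `E w` with every `F [a]`, and this
pairing may be computed after any rotation of the cyclic word `a, w`. One rotates to a position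
where vanishing is known: an identity at the head of the argument of `E`, or an η as the letter
paired with `E`. A cyclic word with neither is excluded by degree. -/
theorem eq_zero_of_rotation {p : ℤ} (hp : 0 ≤ p) (hF : Graded 0 F) (hE : Graded p E)
    (h : ∀ w, ∑ c, ∑ d, pairing R c d * (conv (fun v => E v c) (fun v => ζ v * F v d) w +
      conv (fun v => F v c) (fun v => E v d) w) = 0)
    (hnd : ∀ w, (∀ a, pairAt F E a w = 0) → ∀ c, E w c = 0)
    (hone : ∀ o v c, E (Gen.one o :: v) c = 0)
    (htheta : ∀ w, (∀ o, Gen.one o ∉ w) → ∀ i, E w (.theta i) = 0) (w : List (Gen n)) :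
    ∀ c, E w c = 0 := by
  induction hN : w.length using Nat.strong_induction_on generalizing w with
  | _ N ih =>
  refine hnd w fun a => ?_
  have hlen : ∀ u : List (Gen n), u.length + 1 < (a :: w).length → ∀ c, E u c = 0 :=
    fun u hu => ih u.length (by simpa [← hN] using hu) u rfl
  by_cases h₁ : ∃ o, Gen.one o ∈ a :: w
  · obtain ⟨o, ho⟩ := h₁
    obtain ⟨x, y, hxy⟩ := List.append_of_mem ho
    rcases List.eq_nil_or_concat (y ++ x) with hnil | ⟨t, b, hyx⟩
    · have : w = [] := by
        simp only [List.append_eq_nil_iff] at hnil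
        obtain ⟨rfl, rfl⟩ := hnil
        simp_all
      subst this
      simp [pairAt, hE.nil]
    · rw [List.concat_eq_append] at hyx
      -- The rotation puts an identity directly after the letter that is paired, so that `E` is
      -- evaluated on a word starting with an identity.
      have hr : b :: Gen.one o :: t ~r a :: w := by
        rw [hxy]
        refine List.IsRotated.trans (l' := Gen.one o :: t ++ [b]) ⟨1, by simp⟩ ?_
        rw [List.cons_append, ← hyx, ← List.cons_append]
        exact List.isRotated_append
      refine cycVanish_rotate (L := b :: Gen.one o :: t) hF.nil h ?_ ?_ hr
      · rw [hr.perm.length_eq]; exact hlen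
      · simp [CycVanish, pairAt, hone]
  · push Not at h₁
    by_cases h₂ : ∃ i, Gen.eta i ∈ a :: w
    · obtain ⟨i, hi⟩ := h₂
      obtain ⟨x, y, hxy⟩ := List.append_of_mem hi
      have hr : Gen.eta i :: (y ++ x) ~r a :: w := by
        rw [hxy, ← List.cons_append]
        exact List.isRotated_append
      refine cycVanish_rotate (L := Gen.eta i :: (y ++ x)) hF.nil h ?_ ?_ hr
      · rw [hr.perm.length_eq]; exact hlen
      -- `F` sends a single η to a combination of η's, and these pair only with θ-coefficients of
      -- `E`.
      · refine Finset.sum_eq_zero fun c _ => Finset.sum_eq_zero fun d _ => ?_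
        by_cases hc : F [.eta i] c = 0
        · simp [hc]
        obtain ⟨-, ⟨h₃, h₄⟩, h₅⟩ := hF _ _ hc
        cases c with
        | one o => simp [Gen.deg] at h₅
        | xi o => simp [Gen.tgt, Gen.src, IsPath] at h₃ h₄; rw [← h₃] at h₄; cases h₄
        | theta j => simp [Gen.deg] at h₅
        | eta j =>
          by_cases hd : d = .theta j
          · rw [hd, htheta, mul_zero, mul_zero]
            intro o ho
            refine h₁ o (hr.perm.mem_iff.1 ?_)
            simp [ho]
          · rw [pairing_eq, if_neg (show ¬d = (Gen.eta j).dual from hd), zero_mul]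
    · push Not at h₂
      -- A closed path without identities and η's consists of ξ's only. A nonzero pairing would then
      -- force p = -1.
      refine Finset.sum_eq_zero fun c _ => Finset.sum_eq_zero fun d _ => ?_
      by_contra hcd
      have hpair : pairing R c d ≠ 0 := left_ne_zero_of_mul hcd
      have hd : d = c.dual := by
        by_contra hd
        exact hpair (by rw [pairing_eq, if_neg hd])
      obtain ⟨-, ⟨h₃, h₄⟩, h₅⟩ := hF _ _ (left_ne_zero_of_mul (right_ne_zero_of_mul hcd))
      obtain ⟨-, h₆, h₇⟩ := hE _ _ (right_ne_zero_of_mul (right_ne_zero_of_mul hcd))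
      rw [hd] at h₆ h₇
      have := isPath_no_eta h₆ (fun o ho => h₁ o (by simp [ho])) (fun o ho => h₂ o (by simp [ho]))
      simp only [Gen.dual_src, Gen.dual_tgt, Gen.dual_deg, redDeg_cons, redDeg_nil] at this h₇ h₅
      simp only [IsPath] at h₄
      rw [← h₃, ← h₄] at this
      cases a with
      | one o => exact h₁ o (by simp)
      | eta i => exact h₂ i (by simp)
      | xi o =>
        rw [show (Gen.xi o : Gen n).deg = 1 from rfl] at h₅
        simp only [Gen.src, Gen.tgt] at this
        rcases this with ⟨-, h⟩ | ⟨h, h'⟩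
        · rw [h] at h₇; linarith
        · rw [h] at h'; cases h'
      | theta i => simp [Gen.src, Gen.tgt] at this

end Rotation

end

/-! ### Cyclic operations and functors: reduction of their equations to outputs θ. -/

section

variable {R : Type*} [CommRing R] {n : ℕ}

/-- The properties of the operations of a cyclic `A_∞`-structure, except for the
`A_∞`-relations. -/
structure IsCyclicOp (op : Ops R n) : Prop where
  graded : Graded 1 op
  minimal : ∀ a c, op [a] c = 0
  op_two : ∀ a b c, op [a, b] c = mu2 R a b c
  strictly_unital : ∀ (w : List (Gen n)) (o : Obj) (c : Gen n),
    3 ≤ w.length → Gen.one o ∈ w → op w c = 0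
  cyclic : ∀ (a b : Gen n) (w : List (Gen n)),
    ∑ c, pairing R a c * op (b :: w) c =
      sgn R ((a.deg - 1) * redDeg (b :: w)) * ∑ c, pairing R b c * op (w ++ [a]) c

theorem CyclicAInf.isCyclicOp (m : CyclicAInf R n) : IsCyclicOp m.op where
  graded := (homogeneous_iff_graded 1 m.op).1 (by simpa using m.homogeneous)
  minimal := m.minimal
  op_two := m.op_two
  strictly_unital := m.strictly_unital
  cyclic := m.cyclic

theorem mu2_one_left (o : Obj) (b c : Gen n) :
    mu2 R (.one o) b c = if b.tgt = o ∧ c = b then sgn R b.deg else 0 := by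
  cases b with
  | one o' =>
    by_cases h : o = o'
    · subst h; simp [mu2, Gen.tgt, Gen.src, Gen.deg]
    · simp [mu2, Gen.tgt, Gen.src, h, Ne.symm h]
  | _ => rfl

namespace IsCyclicOp

variable {op : Ops R n} (h : IsCyclicOp op)

include h

theorem rotate (a b : Gen n) (w : List (Gen n)) :
    psign R a * op (b :: w) a.dual =
      sgn R ((a.deg - 1) * redDeg (b :: w)) * (psign R b * op (w ++ [a]) b.dual) := by
  simpa only [sum_pairing] using h.cyclic a b w

/-- A coefficient of ξ is a pairing with an identity. Rotation moves this identity among the inputs,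
where strict unitality applies. -/
theorem op_xi {w : List (Gen n)} (hw : 3 ≤ w.length) (o : Obj) : op w (.xi o) = 0 := by
  obtain ⟨b, w, rfl⟩ := List.exists_cons_of_ne_nil (l := w) (by rintro rfl; simp at hw)
  have := h.rotate (.one o) b w
  rw [h.strictly_unital (w ++ [Gen.one o]) o b.dual (by simpa using hw) (by simp), mul_zero,
    mul_zero] at this
  have h' := congrArg (psign R (Gen.one o : Gen n) * ·) this
  simpa [← mul_assoc, Gen.dual] using h'

theorem op_one_cons (o : Obj) (c : Gen n) : (fun v => op (Gen.one o :: v) c) =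
    fun v => (if c.tgt = o then sgn R c.deg else 0) * letter c v := by
  funext v
  rcases v with _ | ⟨b, _ | ⟨b', v⟩⟩
  · simp [h.minimal, letter]
  · rw [h.op_two, letter, mu2_one_left]
    by_cases hb : c = b
    · subst hb; simp
    · rw [if_neg (fun h => hb h.2), if_neg (c := [b] = [c]) (by simpa [eq_comm] using hb), mul_zero]
  · rw [h.strictly_unital _ o _ (by simp) (by simp)]
    simp [letter]

/-- Among the blocks that start with the identity, only the one of length two survives. -/
theorem conv_one_cons (o : Obj) (a b : Gen n) (g : List (Gen n) → R) (v : List (Gen n)) :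
    conv (fun v => op v b) g (Gen.one o :: a :: v) = mu2 R (.one o) a b * g v := by
  rw [conv_cons, conv_cons, h.graded.nil, h.minimal, zero_mul, zero_mul, zero_add, zero_add]
  cases v with
  | nil => simp [conv, h.op_two]
  | cons a' v =>
    rw [conv_cons, h.op_two, conv, splitSum_eq_zero, add_zero]
    intro u v' _
    rw [h.strictly_unital _ o _ (by simp) (by simp), zero_mul]

end IsCyclicOp

variable (R n) in
/-- The noncommutative two-form of the pairing. -/
def twoForm (w : List (Gen n)) : R := ∑ c, ∑ d, pairing R c d * conv (letter c) (letter d) w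

theorem derive_pairing (op : Ops R n) (f g : Gen n → List (Gen n) → R) (w : List (Gen n)) :
    derive op (fun u => ∑ c, ∑ d, pairing R c d * conv (f c) (g d) u) w =
      ∑ c, ∑ d, pairing R c d *
        (conv (derive op (f c)) (twist (g d)) w + conv (f c) (derive op (g d)) w) := by
  simp only [derive_sum, derive_smul, derive_conv]

/-- The coefficient of this identity at the word `a, w, b` is the cyclicity relation for the letters
`b` and `a`. All that has to be checked is the sign. -/
theorem IsCyclicOp.derive_twoForm {op : Ops R n} (h : IsCyclicOp op) :
    derive op (twoForm R n) = fun _ => 0 := by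
  funext w
  have hl : ∀ c, derive op (letter c) = fun v => op v c := fun c => funext fun v => derive_letter ..
  have := derive_pairing op (fun c => letter c) (fun c => letter c) w
  simp only [hl] at this
  refine this.trans ?_
  rcases List.eq_nil_or_concat w with rfl | ⟨w, b, rfl⟩
  · simp [conv, twist, letter]
  rw [List.concat_eq_append]
  have h₁ : ∀ c d, conv (fun v => op v c) (twist (letter d)) (w ++ [b]) =
      if b = d then sgn R (b.deg - 1) * op w c else 0 := by
    intro c d
    have : (twist (letter d) : List (Gen n) → R) = fun v => sgn R (d.deg - 1) * letter d v := by
      funext v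
      rw [twist, letter]
      split_ifs with hv
      · simp [hv]
      · simp
    rw [this, conv_smul, conv_append_letter]
    split_ifs with hbd
    · rw [hbd]
    · simp
  simp only [h₁]
  cases w with
  | nil => simp [h.graded.nil, conv_letter_cons]
  | cons a w =>
    simp only [List.cons_append, conv_letter_cons, mul_add, Finset.sum_add_distrib, mul_ite,
      mul_zero, Finset.sum_ite_eq, Finset.mem_univ, if_true]
    rw [Finset.sum_comm (f := fun c d => if a = c then _ else _)]
    simp only [Finset.sum_ite_eq, Finset.mem_univ, if_true]
    have h₂ := h.cyclic b a w
    have h₃ : ∑ c, pairing R c b * (sgn R (b.deg - 1) * op (a :: w) c) =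
        -sgn R (b.deg - 1) * ∑ c, pairing R b c * op (a :: w) c := by
      rw [Finset.mul_sum]
      refine Finset.sum_congr rfl fun c _ => ?_
      rw [pairing_symm c b]; ring
    rw [h₃]
    -- For `b` of degree 1 the Koszul sign is trivial. For `b` of degree 0 the output dual to `b`
    -- has degree 1, which forces reduced degree -1 on the inputs and fixes the sign.
    rcases b.deg_eq with hb | hb
    · by_cases h0 : op (a :: w) b.dual = 0
      · have h₄ : ∑ c, pairing R b c * op (a :: w) c = 0 := by rw [sum_pairing, h0, mul_zero]
        rw [h₄] at h₂ ⊢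
        have h₅ := congrArg (sgn R ((b.deg - 1) * redDeg (a :: w)) * ·) h₂
        simp only [← mul_assoc, sgn_mul_self, one_mul, mul_zero] at h₅ ⊢
        rw [← h₅, zero_add]
      · obtain ⟨-, -, hd⟩ := h.graded _ _ h0
        have hr : redDeg (a :: w) = -1 := by rw [Gen.dual_deg, hb] at hd; linarith
        rw [h₂, hr, hb]; simp
    · rw [h₂, hb]; simp

/-- The `A_∞`-relations follow from those with output `θ_i` for words without identities. -/
theorem IsCyclicOp.insertion_eq_zero {op : Ops R n} (h : IsCyclicOp op)
    (htheta : ∀ w, (∀ o, Gen.one o ∉ w) → ∀ i, insertion op op w (.theta i) = 0)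
    (w : List (Gen n)) (c : Gen n) : insertion op op w c = 0 := by
  have hl : ∀ c, derive op (letter c) = fun v => op v c := fun c => funext fun v => derive_letter ..
  have hll : ∀ c, derive op (derive op (letter c)) = fun v => insertion op op v c := fun c => by
    funext v; rw [hl, insertion_eq_derive]
  -- In the rotation argument the functor is the identity, whose components are the letters
  -- themselves.
  have hF : Graded 0 (fun v c => letter c v : Ops R n) := by
    intro w c hw
    simp only [letter, ite_ne_right_iff] at hw
    simp [hw.1, IsPath]
  refine eq_zero_of_rotation (F := fun v c => letter c v) (ζ := fun _ => 1) (p := 1 + 1) (by simp)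
    hF (h.graded.insertion h.graded) ?_ ?_ ?_ htheta w c
  · intro w
    -- The square of the derivation kills the two-form and obeys the untwisted Leibniz rule; this is
    -- the rotation hypothesis with `ζ = 1`.
    have h₁ : derive op (derive op (twoForm R n)) w = 0 := by
      rw [h.derive_twoForm, derive_zero]
    have h₂ : derive op (twoForm R n) = fun w => ∑ c, ∑ d, pairing R c d *
        derive op (conv (letter c) (letter d)) w := by
      funext w
      change derive op (fun u => ∑ c, ∑ d, pairing R c d * conv (letter c) (letter d) u) w = _
      simp only [derive_sum, derive_smul]
    rw [h₂] at h₁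
    simp only [derive_sum, derive_smul, derive_derive_conv h.graded, hll] at h₁
    simpa only [one_mul] using h₁
  · intro w hw c
    have := hw c.dual
    simp only [pairAt, sum_pairing, letter] at this
    have h₂ : ∀ x, (psign R x * ((if [c.dual] = [x] then 1 else 0) * insertion op op w x.dual)) =
        if c.dual = x then psign R x * insertion op op w x.dual else 0 := by
      intro x; split_ifs <;> simp_all
    simp only [h₂, Finset.sum_ite_eq, Finset.mem_univ, if_true, Gen.dual_dual] at this
    have h' := congrArg (psign R c.dual * ·) this
    simpa [← mul_assoc] using h'
  · intro o v c
    by_contra hne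
    have hpath := ((h.graded.insertion h.graded) _ _ hne).2.1
    apply hne
    -- On a word starting with an identity two terms survive: μ₂(id, a) inserted into the outer
    -- operation, and the outer μ₂(id, ·) applied to the operation on the rest. Their signs are
    -- opposite because the operation raises the reduced degree by one.
    rw [insertion_eq_derive, derive_cons]
    rw [h.op_one_cons, derive_smul, derive_letter]
    cases v with
    | nil => simp [conv, h.graded.nil, h.minimal]
    | cons a v =>
      simp only [h.conv_one_cons, twist]
      have hao : a.tgt = o := by
        obtain ⟨h₁, h₂, -⟩ := hpath; rw [h₂]; rfl
      simp only [mu2_one_left, hao, true_and, ite_mul, zero_mul, Finset.sum_ite_eq', Finset.mem_univ, if_true]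
      by_cases hav : op (a :: v) c = 0
      · simp [hav]
      · obtain ⟨-, ⟨h₄, -⟩, h₅⟩ := h.graded _ _ hav
        rw [if_pos (by rw [← hao, h₄])]
        have : c.deg = a.deg + redDeg v + 1 := by rw [redDeg_cons] at h₅; linarith
        rw [this, sgn_add_one, sgn_add]
        ring

/-- The properties of the components of a cyclic functor, except for the functor equations. -/
structure IsFunctorData (F : Ops R n) : Prop where
  graded : Graded 0 F
  map_one : ∀ o c, F [Gen.one o] c = if c = Gen.one o then 1 else 0
  strictly_unital : ∀ (w : List (Gen n)) (o : Obj) (c : Gen n),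
    2 ≤ w.length → Gen.one o ∈ w → F w c = 0
  form : ∀ w, ∑ c, ∑ d, pairing R c d * conv (fun v => F v c) (fun v => F v d) w = twoForm R n w

theorem twoForm_pair (a b : Gen n) : twoForm R n [a, b] = pairing R a b := by
  have : ∀ c d, conv (letter c) (letter d) [a, b] =
      if a = c then (if b = d then (1 : R) else 0) else 0 := by
    intro c d
    rw [conv_letter_cons, letter]
    simp
  simp [twoForm, this]

theorem twoForm_of_length_ne {w : List (Gen n)} (hw : w.length ≠ 2) : twoForm R n w = 0 := by
  refine Finset.sum_eq_zero fun c _ => Finset.sum_eq_zero fun d _ => ?_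
  cases w with
  | nil => simp [conv_letter_nil]
  | cons a w =>
    rw [conv_letter_cons, letter, if_neg (c := w = [d]), ite_self, mul_zero]
    rintro rfl
    simp at hw

theorem IsFunctorData.linear_form {F : Ops R n} (hF : IsFunctorData F) (a b : Gen n) :
    ∑ c, ∑ d, pairing R c d * (F [a] c * F [b] d) = pairing R a b := by
  rw [← twoForm_pair, ← hF.form]
  refine Finset.sum_congr rfl fun c _ => Finset.sum_congr rfl fun d _ => ?_
  rw [conv_cons, conv_cons, hF.graded.nil]
  simp [conv, hF.graded.nil]

theorem gram_form {F : Ops R n}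
    (hF : ∀ a b, ∑ c, ∑ d, pairing R c d * (F [a] c * F [b] d) = pairing R a b) :
    (Matrix.of fun a c => F [a] c) * gram R n * (Matrix.of fun c a => F [a] c) = gram R n := by
  ext a b
  rw [gram, Matrix.of_apply, ← hF a b, Finset.sum_comm]
  simp only [Matrix.mul_apply, Matrix.of_apply, Finset.sum_mul]
  refine Finset.sum_congr rfl fun c _ => Finset.sum_congr rfl fun d _ => ?_
  ring

/-- A linear map preserving a nondegenerate form is injective, and here an explicit left inverse
comes from A^T G A = G and G² = -1. Consequently invertibility of f^1 is automatic for cyclic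
functors. -/
theorem isUnit_linear {F : Ops R n}
    (hF : ∀ a b, ∑ c, ∑ d, pairing R c d * (F [a] c * F [b] d) = pairing R a b) :
    IsUnit (Matrix.of fun c a => F [a] c : Matrix (Gen n) (Gen n) R) := by
  have h := gram_form hF
  have h₂ : (-gram R n * ((Matrix.of fun a c => F [a] c) * gram R n)) *
      (Matrix.of fun c a => F [a] c) = 1 := by
    rw [mul_assoc, h, neg_mul, gram_mul_gram, neg_neg]
  exact IsUnit.of_mul_eq_one _ (mul_eq_one_comm.1 h₂)

/-- The functor equations follow from those with output `θ_i` for words without identities. -/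
theorem IsFunctorData.functor_eq {F op op' : Ops R n} (hF : IsFunctorData F) (h : IsCyclicOp op)
    (h' : IsCyclicOp op')
    (htheta : ∀ w, (∀ o, Gen.one o ∉ w) → ∀ i,
      blockSum op' F w (.theta i) = insertion F op w (.theta i))
    (w : List (Gen n)) (c : Gen n) : blockSum op' F w c = insertion F op w c := by
  rw [← sub_eq_zero]
  have hg : Graded 1 (fun w c => blockSum op' F w c - insertion F op w c) := by
    intro w c hne
    by_cases h0 : blockSum op' F w c = 0
    · have := hF.graded.insertion h.graded w c (by
        rintro h1; simp [h0, h1] at hne)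
      simpa using this
    · exact hF.graded.blockSum h'.graded w c h0
  refine eq_zero_of_rotation (E := fun w c => blockSum op' F w c - insertion F op w c) (F := F)
    (ζ := fun v => sgn R (redDeg v)) (p := 1) (by simp)
    hF.graded hg ?_ ?_ ?_ (fun w hw i => sub_eq_zero.2 (htheta w hw i)) w c
  · intro w
    have hl : ∀ c, derive op' (letter c) = fun v => op' v c :=
      fun c => funext fun v => derive_letter ..
    -- Let ω be the two-form and D, D' the two derivations. Since Fω = ω, both F(D'ω) and D(Fω)
    -- vanish; in their difference the defect of the functor equation stands in one factor and `F`
    -- in the other.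
    have h₁ : blockSubst F (derive op' (twoForm R n)) w = 0 := by
      rw [h'.derive_twoForm, blockSubst_zero]
    have h₂ : derive op' (twoForm R n) = fun w => ∑ c, ∑ d, pairing R c d *
        (conv (fun v => op' v c) (twist (letter d)) w + conv (letter c) (fun v => op' v d) w) := by
      funext w
      have := derive_pairing op' (fun c => letter c) (fun c => letter c) w
      simp only [hl] at this
      exact this
    have hb : ∀ c, blockSubst F (letter c) = fun v => F v c :=
      fun c => funext fun v => blockSubst_letter hF.graded.nil c v
    have hbt : ∀ c, blockSubst F (twist (letter c)) = twist fun v => F v c := fun c => by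
      funext v; rw [blockSubst_twist hF.graded, hb]
    rw [h₂] at h₁
    simp only [blockSubst_sum, blockSubst_smul, blockSubst_add, blockSubst_conv, hb, hbt] at h₁
    have h₃ : derive op (twoForm R n) w = 0 := by rw [h.derive_twoForm]
    have h₄ : twoForm R n = fun w => ∑ c, ∑ d, pairing R c d *
        conv (fun v => F v c) (fun v => F v d) w := funext fun w => (hF.form w).symm
    rw [h₄, derive_pairing] at h₃
    rw [← sub_eq_zero.2 (h₁.trans h₃.symm), ← Finset.sum_sub_distrib]
    refine Finset.sum_congr rfl fun c _ => ?_
    rw [← Finset.sum_sub_distrib]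
    refine Finset.sum_congr rfl fun d _ => ?_
    have h₅ : ∀ c, (fun v => blockSum op' F v c - insertion F op v c) = fun v =>
        blockSubst F (fun u => op' u c) v + (-1) * derive op (fun u => F u c) v := by
      intro c; funext v; rw [blockSum_eq_blockSubst, insertion_eq_derive]; ring
    rw [h₅, h₅, add_conv, conv_add, smul_conv, conv_smul]
    have h₆ : (fun v => sgn R (redDeg v) * F v d) = twist fun v => F v d := rfl
    rw [h₆]
    ring
  · intro w hw
    obtain ⟨M, hM⟩ := isUnit_linear hF.linear_form
    -- The vanishing pairings say that the vector of defects is killed by the matrix A^T G, with A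
    -- the linear part of `F`; this matrix is invertible.
    have hz : Matrix.mulVec ((Matrix.of fun a c => F [a] c) * gram R n)
        (fun c => blockSum op' F w c - insertion F op w c) = 0 := by
      funext a
      refine Eq.trans ?_ (hw a)
      rw [pairAt, Finset.sum_comm]
      simp only [Matrix.mulVec, dotProduct, Matrix.mul_apply, Matrix.of_apply, gram,
        Finset.sum_mul]
      refine Finset.sum_congr rfl fun c _ => Finset.sum_congr rfl fun d _ => ?_
      ring
    have hinv : (Matrix.of (fun c a => F [a] c) * (-gram R n)) *
        ((Matrix.of fun a c => F [a] c) * gram R n) = 1 := by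
      rw [mul_eq_one_comm, ← mul_assoc, gram_form hF.linear_form, mul_neg, gram_mul_gram, neg_neg]
    have := congrArg (Matrix.mulVec (Matrix.of (fun c a => F [a] c) * (-gram R n))) hz
    rw [Matrix.mulVec_mulVec, hinv, Matrix.one_mulVec, Matrix.mulVec_zero] at this
    exact fun c => congrFun this c
  · intro o v c
    by_contra hne
    have hpath := (hg _ _ hne).2.1
    apply hne
    rw [blockSum_eq_blockSubst, insertion_eq_derive, derive_cons, blockSubst_cons]
    have h₂ : derive op (fun v => F (Gen.one o :: v) c) v = 0 := by
      by_contra h0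
      obtain ⟨u, v, z, b, -, -, h3⟩ := exists_of_derive_ne_zero h0
      exact h3 (hF.strictly_unital _ o _ (by simp; omega) (by simp))
    have h₄ : splitSum (fun u v => ∑ b, F (Gen.one o :: u) b *
        blockSubst F (fun z => op' (b :: z) c) v) v =
        (if c.tgt = o then sgn R c.deg else 0) * F v c := by
      rw [← blockSubst_letter hF.graded.nil, ← blockSubst_smul, ← h'.op_one_cons]
      cases v with
      | nil => simp [hF.map_one]
      | cons a v =>
        rw [splitSum_cons, splitSum_eq_zero, add_zero]
        · simp [hF.map_one]
        · intro u v' _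
          refine Finset.sum_eq_zero fun b _ => ?_
          rw [hF.strictly_unital _ o _ (by simp) (by simp), zero_mul]
    rw [h₄, h₂, add_zero]
    cases v with
    | nil => simp [conv, h.graded.nil, h.minimal, hF.graded.nil]
    | cons a v =>
      simp only [h.conv_one_cons, twist]
      have hao : a.tgt = o := by
        obtain ⟨h₁, h₂, -⟩ := hpath; rw [h₂]; rfl
      simp only [mu2_one_left, hao, true_and, ite_mul, zero_mul, Finset.sum_ite_eq', Finset.mem_univ, if_true]
      by_cases hav : F (a :: v) c = 0
      · simp [hav]
      · obtain ⟨-, ⟨h₄, -⟩, h₅⟩ := hF.graded _ _ hav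
        rw [if_pos (by rw [← hao, h₄])]
        have : c.deg = a.deg + redDeg v := by rw [redDeg_cons] at h₅; linarith
        rw [this, sgn_add]
        ring

end

section

/-! ### Power series in one variable with power series coefficients -/

section SlotSum

variable {σ R : Type*} [CommRing R]

/-- The power series `∑ (X s)^k G_k`. -/
def slotSum (s : σ) (G : ℕ → MvPowerSeries σ R) : MvPowerSeries σ R :=
  fun e => ∑ k ∈ Finset.range (e s + 1), coeff e (X s ^ k * G k)

/-- Terms with `k` larger than the exponent of `s` are divisible by too high a power of the
variable. So the formal infinite sum may be truncated anywhere beyond that exponent, even if the `G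
k` involve `X s` themselves. -/
theorem coeff_slotSum {s : σ} (G : ℕ → MvPowerSeries σ R) {e : σ →₀ ℕ} {M : ℕ} (h : e s < M) :
    coeff e (slotSum s G) = coeff e (∑ k ∈ Finset.range M, X s ^ k * G k) := by
  rw [map_sum, ← Finset.sum_subset (Finset.range_mono h)]
  · rfl
  · intro k _ hk
    rw [Finset.mem_range, not_lt] at hk
    exact X_pow_dvd_iff.1 (dvd_mul_right (X s ^ k) (G k)) e (by omega)

theorem X_pow_dvd_slotSum_sub (s : σ) (G : ℕ → MvPowerSeries σ R) (M : ℕ) :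
    X s ^ M ∣ slotSum s G - ∑ k ∈ Finset.range M, X s ^ k * G k := by
  rw [X_pow_dvd_iff]
  intro e he
  rw [map_sub, coeff_slotSum G he, sub_self]

theorem eq_slotSum {s : σ} {G : ℕ → MvPowerSeries σ R} {A : MvPowerSeries σ R}
    (h : ∀ M, X s ^ M ∣ A - ∑ k ∈ Finset.range M, X s ^ k * G k) : A = slotSum s G := by
  ext e
  rw [coeff_slotSum G (Nat.lt_succ_self _), ← sub_eq_zero, ← map_sub]
  exact X_pow_dvd_iff.1 (h _) e (Nat.lt_succ_self _)

/-- Iterating the recursion `M` times leaves a remainder divisible by the `M`-th power of the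
variable. -/
theorem eq_slotSum_of_succ {s : σ} {G A : ℕ → MvPowerSeries σ R}
    (h : ∀ k, A k = G k + X s * A (k + 1)) : A 0 = slotSum s G := by
  refine eq_slotSum fun M => ⟨A M, ?_⟩
  induction M with
  | zero => simp
  | succ M ih =>
    rw [Finset.sum_range_succ, ← sub_sub, ih, h M]
    ring

theorem mul_slotSum (P : MvPowerSeries σ R) (s : σ) (G : ℕ → MvPowerSeries σ R) :
    P * slotSum s G = slotSum s (fun k => P * G k) := by
  refine eq_slotSum fun M => ?_
  have := (X_pow_dvd_slotSum_sub s G M).mul_left P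
  rw [mul_sub, Finset.mul_sum] at this
  convert this using 3
  ring

theorem slotSum_add (s : σ) (G H : ℕ → MvPowerSeries σ R) :
    slotSum s (fun k => G k + H k) = slotSum s G + slotSum s H := by
  symm
  refine eq_slotSum fun M => ?_
  have := (X_pow_dvd_slotSum_sub s G M).add (X_pow_dvd_slotSum_sub s H M)
  convert this using 1
  simp only [mul_add, Finset.sum_add_distrib]
  ring

theorem slotSum_zero (s : σ) : slotSum s (fun _ => (0 : MvPowerSeries σ R)) = 0 := by
  simpa using (mul_slotSum (0 : MvPowerSeries σ R) s fun _ => 0).symm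

theorem slotSum_sum {ι : Type*} (S : Finset ι) (s : σ) (G : ι → ℕ → MvPowerSeries σ R) :
    slotSum s (fun k => ∑ i ∈ S, G i k) = ∑ i ∈ S, slotSum s (G i) := by
  classical
  induction S using Finset.induction_on with
  | empty => simp [slotSum_zero]
  | insert i S hi ih => simp only [Finset.sum_insert hi, slotSum_add, ih]

theorem slotSum_eq_add (s : σ) (G : ℕ → MvPowerSeries σ R) :
    slotSum s G = G 0 + X s * slotSum s (fun k => G (k + 1)) := by
  symm
  refine eq_slotSum fun M => ?_
  cases M with
  | zero => simp
  | succ M =>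
    have := mul_dvd_mul_left (X s) (X_pow_dvd_slotSum_sub s (fun k => G (k + 1)) M)
    rw [pow_succ']
    convert this using 1
    rw [Finset.sum_range_succ', mul_sub, Finset.mul_sum]
    simp only [pow_succ', mul_assoc, pow_zero, one_mul]
    ring

/-- When a run of length i + j is cut into runs of lengths i and j, both halves are recorded by the
same variable, since the power i + j factors. -/
theorem slotSum_antidiagonal (s : σ) (H : ℕ → ℕ → MvPowerSeries σ R) :
    slotSum s (fun k => ∑ p ∈ Finset.HasAntidiagonal.antidiagonal k, H p.1 p.2) =
      slotSum s (fun i => slotSum s (H i)) := by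
  symm
  refine eq_slotSum fun M => ?_
  have h₁ : ∑ k ∈ Finset.range M, X s ^ k * ∑ p ∈ Finset.HasAntidiagonal.antidiagonal k,
      H p.1 p.2 = ∑ i ∈ Finset.range M, X s ^ i *
        ∑ j ∈ Finset.range (M - i), X s ^ j * H i j := by
    have := Finset.sum_range_diag_flip M (fun i j => X s ^ i * (X s ^ j * H i j))
    simp only [Finset.mul_sum]
    rw [← this]
    refine Finset.sum_congr rfl fun k _ => ?_
    rw [Finset.Nat.sum_antidiagonal_eq_sum_range_succ (fun i j => X s ^ k * H i j)]
    refine Finset.sum_congr rfl fun i hi => ?_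
    rw [← mul_assoc, ← pow_add, Nat.add_sub_cancel' (by simpa [Nat.lt_succ_iff] using hi)]
  rw [h₁]
  have h₂ := X_pow_dvd_slotSum_sub s (fun i => slotSum s (H i)) M
  have h₃ : X s ^ M ∣ ∑ i ∈ Finset.range M, X s ^ i * slotSum s (H i) -
      ∑ i ∈ Finset.range M, X s ^ i * ∑ j ∈ Finset.range (M - i), X s ^ j * H i j := by
    rw [← Finset.sum_sub_distrib]
    refine Finset.dvd_sum fun i hi => ?_
    rw [← mul_sub]
    have : X s ^ M = X s ^ i * (X s : MvPowerSeries σ R) ^ (M - i) := by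
      rw [← pow_add, Nat.add_sub_cancel' (Finset.mem_range.1 hi).le]
    rw [this]
    exact mul_dvd_mul_left _ (X_pow_dvd_slotSum_sub s (H i) _)
  simpa using h₂.add h₃

theorem slotSum_comm (s t : σ) (H : ℕ → ℕ → MvPowerSeries σ R) :
    slotSum s (fun i => slotSum t (fun j => H i j)) =
      slotSum t (fun j => slotSum s (fun i => H i j)) := by
  ext e
  rw [coeff_slotSum _ (Nat.lt_succ_self _), coeff_slotSum _ (Nat.lt_succ_self _), map_sum, map_sum]
  simp only [mul_slotSum]
  have h₁ : ∀ i, coeff e (slotSum t (fun j => X s ^ i * H i j)) =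
      ∑ j ∈ Finset.range (e t + 1), coeff e (X t ^ j * (X s ^ i * H i j)) := fun i => rfl
  have h₂ : ∀ j, coeff e (slotSum s (fun i => X t ^ j * H i j)) =
      ∑ i ∈ Finset.range (e s + 1), coeff e (X s ^ i * (X t ^ j * H i j)) := fun i => rfl
  simp only [h₁, h₂]
  rw [Finset.sum_comm]
  simp only [mul_left_comm]

/-- The telescoping identity (s - t) ∑_{i+j=k} s^i t^j = s^{k+1} - t^{k+1}. This is the source of
all divided differences, and so of the poles of r. -/
theorem sub_mul_slotSum (s t : σ) (z : ℕ → MvPowerSeries σ R) :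
    (X s - X t) * slotSum s (fun i => slotSum t (fun j => z (i + 1 + j))) =
      slotSum s z - slotSum t z := by
  have h₁ : ∀ i, slotSum t (fun j => z (i + j)) =
      z i + X t * slotSum t (fun j => z (i + 1 + j)) := by
    intro i
    rw [slotSum_eq_add]
    congr 3
    funext j
    congr 1
    omega
  have h₂ := slotSum_eq_add s (fun i => slotSum t (fun j => z (i + j)))
  have h₃ : slotSum s (fun i => slotSum t (fun j => z (i + j))) =
      slotSum s z + X t * slotSum s (fun i => slotSum t (fun j => z (i + 1 + j))) := by
    rw [mul_slotSum, ← slotSum_add]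
    exact congrArg _ (funext h₁)
  rw [h₃] at h₂
  simp only [zero_add] at h₂
  rw [sub_mul]
  linear_combination -h₂

theorem coeff_rename_eq_of_coeff {σ' : Type*} (τ : σ → σ') [Filter.TendstoCofinite τ]
    {P P' : MvPowerSeries σ R} {e : σ' →₀ ℕ}
    (h : ∀ d : σ →₀ ℕ, d.mapDomain τ = e → coeff d P = coeff d P') :
    coeff e (rename τ P) = coeff e (rename τ P') := by
  rw [coeff_rename, coeff_rename]
  refine Finset.sum_congr rfl fun d hd => h d ?_
  simpa using hd

/-- Only exponents `d` that map to `e` contribute, and they satisfy d s ≤ e (τ s); hence a finite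
truncation computes both sides, also when `τ` identifies variables. -/
theorem rename_slotSum {σ' : Type*} (τ : σ → σ') [Filter.TendstoCofinite τ] (s : σ)
    (G : ℕ → MvPowerSeries σ R) :
    rename τ (slotSum s G) = slotSum (τ s) (fun k => rename τ (G k)) := by
  classical
  ext e
  rw [coeff_slotSum _ (Nat.lt_succ_self _),
    coeff_rename_eq_of_coeff τ (P' := ∑ k ∈ Finset.range (e (τ s) + 1), X s ^ k * G k)]
  · simp
  · intro d hd
    refine coeff_slotSum _ (Nat.lt_succ_of_le ?_)
    rw [← hd, Finsupp.mapDomain, Finsupp.sum_apply, Finsupp.sum]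
    by_cases hs : d s = 0
    · simp [hs]
    · refine le_trans ?_ (Finset.single_le_sum (fun _ _ => Nat.zero_le _)
        (Finsupp.mem_support_iff.2 hs))
      simp

theorem coeff_slotSum_of_indep {s : σ} {G : ℕ → MvPowerSeries σ R}
    (h : ∀ k (e : σ →₀ ℕ), e s ≠ 0 → coeff e (G k) = 0) (e : σ →₀ ℕ) :
    coeff e (slotSum s G) = coeff (e.erase s) (G (e s)) := by
  classical
  have hle : ∀ k, k ≤ e s → Finsupp.single s k ≤ e := by
    intro k hk
    rwa [Finsupp.single_le_iff]
  have hc : ∀ k ∈ Finset.range (e s + 1), coeff e (X s ^ k * G k) =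
      coeff (e - Finsupp.single s k) (G k) := by
    intro k hk
    rw [X_pow_eq, coeff_monomial_mul, if_pos (hle k (by simpa [Nat.lt_succ_iff] using hk)), one_mul]
  rw [coeff_slotSum G (Nat.lt_succ_self _), map_sum, Finset.sum_congr rfl hc,
    Finset.sum_eq_single (e s)]
  · congr 2
    ext t
    by_cases ht : s = t
    · subst ht; simp
    · simp [Finsupp.single_eq_of_ne (Ne.symm ht), Finsupp.erase_ne (Ne.symm ht)]
  · intro k hk hne
    refine h _ _ ?_
    have : k < e s := lt_of_le_of_ne (by simpa [Nat.lt_succ_iff] using hk) hne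
    simp; omega
  · simp

end SlotSum

end

section

/-! ### Generating series over the insertions of `ξ` -/

section Eval

variable {σ R : Type*} [CommRing R] {n : ℕ} (ob : σ → Obj)

/-- The generating series of `g` over the words `ξ^{k_0} a_1 ξ^{k_1} ⋯ a_d ξ^{k_d}`, where
`l = [(a_1, s_1), …, (a_d, s_d)]`; the exponent `k_i` is recorded by the variable `s_i`, with
`s_0 = s`. -/
def slotEval : σ → List (Gen n × σ) → (List (Gen n) → MvPowerSeries σ R) → MvPowerSeries σ R
  | s, [], g => slotSum s fun k => g (List.replicate k (.xi (ob s)))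
  | s, (a, t) :: l, g => slotSum s fun k =>
      slotEval t l fun w => g (List.replicate k (.xi (ob s)) ++ a :: w)

/-- The words which contribute to `slotEval`. -/
def Fits : σ → List (Gen n × σ) → List (Gen n) → Prop
  | s, [], w => ∃ k, w = List.replicate k (.xi (ob s))
  | s, (a, t) :: l, w => ∃ k w', w = List.replicate k (.xi (ob s)) ++ a :: w' ∧ Fits t l w'

/-- The last slot. -/
def endSlot : σ → List (Gen n × σ) → σ
  | s, [] => s
  | _, (_, t) :: l => endSlot t l

@[simp] theorem endSlot_nil (s : σ) : endSlot s ([] : List (Gen n × σ)) = s := rfl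

@[simp] theorem endSlot_cons (s : σ) (a : Gen n × σ) (l : List (Gen n × σ)) :
    endSlot s (a :: l) = endSlot a.2 l := rfl

variable {ob}

theorem slotEval_congr {s : σ} {l : List (Gen n × σ)} {g h : List (Gen n) → MvPowerSeries σ R}
    (hgh : ∀ w, Fits ob s l w → g w = h w) : slotEval ob s l g = slotEval ob s l h := by
  induction l generalizing s g h with
  | nil => exact congrArg (slotSum s) (funext fun k => hgh _ ⟨k, rfl⟩)
  | cons a l ih => exact congrArg (slotSum s) (funext fun k => ih fun w hw => hgh _ ⟨k, w, rfl, hw⟩)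

theorem slotEval_add (s : σ) (l : List (Gen n × σ)) (g h : List (Gen n) → MvPowerSeries σ R) :
    slotEval ob s l (fun w => g w + h w) = slotEval ob s l g + slotEval ob s l h := by
  induction l generalizing s g h with
  | nil => exact slotSum_add _ _ _
  | cons a l ih => simp only [slotEval, ih, slotSum_add]

theorem mul_slotEval (P : MvPowerSeries σ R) (s : σ) (l : List (Gen n × σ))
    (g : List (Gen n) → MvPowerSeries σ R) :
    P * slotEval ob s l g = slotEval ob s l fun w => P * g w := by
  induction l generalizing s g with
  | nil => exact mul_slotSum _ _ _
  | cons a l ih => simp only [slotEval, ← ih, mul_slotSum]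

theorem slotEval_zero (s : σ) (l : List (Gen n × σ)) :
    slotEval ob s l (fun _ => (0 : MvPowerSeries σ R)) = 0 := by
  simpa using (mul_slotEval (ob := ob) (0 : MvPowerSeries σ R) s l fun _ => 0).symm

variable (ob) in
/-- `slotEval` as an additive map. -/
def slotEvalHom (s : σ) (l : List (Gen n × σ)) :
    (List (Gen n) → MvPowerSeries σ R) →+ MvPowerSeries σ R where
  toFun := slotEval ob s l
  map_zero' := slotEval_zero s l
  map_add' := slotEval_add s l

theorem slotEval_sum {ι : Type*} (S : Finset ι) (s : σ) (l : List (Gen n × σ))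
    (g : ι → List (Gen n) → MvPowerSeries σ R) :
    slotEval ob s l (fun w => ∑ i ∈ S, g i w) = ∑ i ∈ S, slotEval ob s l (g i) := by
  rw [show (fun w => ∑ i ∈ S, g i w) = ∑ i ∈ S, g i from (Finset.sum_fn S g).symm]
  exact map_sum (slotEvalHom ob s l) g S

theorem slotSum_slotEval_comm (s t : σ) (l : List (Gen n × σ))
    (K : ℕ → List (Gen n) → MvPowerSeries σ R) :
    slotSum s (fun k => slotEval ob t l (K k)) =
      slotEval ob t l fun v => slotSum s fun k => K k v := by
  induction l generalizing t K with
  | nil => exact slotSum_comm _ _ _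
  | cons a l ih => simp only [slotEval, ← ih]; exact slotSum_comm _ _ _

theorem slotEval_splitSum_const {β : Type*} (s : σ) (l : List (Gen n × σ)) (x : List β)
    (K : List (Gen n) → List β → List β → MvPowerSeries σ R) :
    slotEval ob s l (fun w => splitSum (K w) x) =
      splitSum (fun u v => slotEval ob s l fun w => K w u v) x := by
  simp only [splitSum_eq_sum_range, slotEval_sum]

/-- A cut of the word falls in some run of ξ's. It cuts the list of slots there, and the slot of
that run ends the first half and begins the second. -/
theorem slotEval_splitSum (s : σ) (l : List (Gen n × σ))
    (K : List (Gen n) → List (Gen n) → MvPowerSeries σ R) :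
    slotEval ob s l (fun w => splitSum K w) =
      splitSum (fun l₁ l₂ => slotEval ob s l₁ fun u => slotEval ob (endSlot s l₁) l₂ (K u)) l := by
  induction l generalizing s K with
  | nil =>
    simp only [slotEval, splitSum_replicate, splitSum_nil, endSlot_nil]
    exact slotSum_antidiagonal s fun i j => K (List.replicate i (.xi (ob s)))
      (List.replicate j (.xi (ob s)))
  | cons a l ih =>
    obtain ⟨a, t⟩ := a
    simp only [slotEval, splitSum_replicate_append_cons, splitSum_cons, endSlot_cons, endSlot_nil,
      slotEval_add, slotEval_sum, slotSum_add, ih]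
    congr 1
    · have := slotSum_antidiagonal s fun i j => slotEval ob t l fun w =>
        K (List.replicate i (.xi (ob s))) (List.replicate j (.xi (ob s)) ++ a :: w)
      exact this
    · simp only [splitSum_eq_sum_range, slotSum_sum]

theorem slotEval_append (s : σ) (l₁ : List (Gen n × σ)) (b : Gen n) (t : σ)
    (l₃ : List (Gen n × σ)) (g : List (Gen n) → MvPowerSeries σ R) :
    slotEval ob s (l₁ ++ (b, t) :: l₃) g =
      slotEval ob s l₁ fun u => slotEval ob t l₃ fun z => g (u ++ b :: z) := by
  induction l₁ generalizing s g with
  | nil => rfl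
  | cons a l ih => simp only [List.cons_append, slotEval, ih, List.append_assoc]

/-- A ξ between two runs of ξ's merges with them into one run of total length i + 1 + j, so
`sub_mul_slotSum` applies. -/
theorem sub_mul_slotEval_xi {s t : σ} (h : ob s = ob t) (l : List (Gen n × σ))
    (g : List (Gen n) → MvPowerSeries σ R) :
    (X s - X t) * slotEval ob s ((.xi (ob s), t) :: l) g =
      slotEval ob s l g - slotEval ob t l g := by
  have hr : ∀ (k j : ℕ) (x : Gen n) (w : List (Gen n)),
      List.replicate k x ++ x :: (List.replicate j x ++ w) =
        List.replicate (k + 1 + j) x ++ w := by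
    intro k j x w
    rw [List.replicate_add, List.replicate_succ', List.append_assoc, List.append_assoc]
    rfl
  cases l with
  | nil =>
    have hr' : ∀ (k j : ℕ) (x : Gen n), List.replicate k x ++ x :: (List.replicate j x) =
        List.replicate (k + 1 + j) x := fun k j x => by simpa using hr k j x []
    simp only [slotEval, h, hr']
    exact sub_mul_slotSum s t fun k => g (List.replicate k (.xi (ob t)))
  | cons a l =>
    obtain ⟨a, t'⟩ := a
    simp only [slotEval, h, hr]
    have := sub_mul_slotSum s t fun k =>
      slotEval ob t' l fun w => g (List.replicate k (.xi (ob t)) ++ a :: w)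
    exact this

theorem rename_slotEval {σ' : Type*} {ob' : σ' → Obj} (τ : σ → σ') [Filter.TendstoCofinite τ]
    (hτ : ∀ s, ob' (τ s) = ob s) (s : σ) (l : List (Gen n × σ))
    (g : List (Gen n) → MvPowerSeries σ R) :
    rename τ (slotEval ob s l g) =
      slotEval ob' (τ s) (l.map fun a => (a.1, τ a.2)) fun w => rename τ (g w) := by
  induction l generalizing s g with
  | nil => simp only [slotEval, rename_slotSum, List.map_nil, hτ]
  | cons a l ih => simp only [slotEval, rename_slotSum, List.map_cons, hτ, ih]

variable (ob) in
/-- The generating series of a noncommutative power series over `R`. -/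
def genSeries (s : σ) (l : List (Gen n × σ)) (g : List (Gen n) → R) : MvPowerSeries σ R :=
  slotEval ob s l fun w => C (g w)

theorem genSeries_congr {s : σ} {l : List (Gen n × σ)} {g h : List (Gen n) → R}
    (hgh : ∀ w, Fits ob s l w → g w = h w) : genSeries ob s l g = genSeries ob s l h :=
  slotEval_congr fun w hw => by rw [hgh w hw]

theorem genSeries_eq_zero {s : σ} {l : List (Gen n × σ)} {g : List (Gen n) → R}
    (hg : ∀ w, Fits ob s l w → g w = 0) : genSeries ob s l g = 0 := by
  rw [genSeries_congr (h := fun _ => 0) hg, genSeries]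
  simpa using slotEval_zero s l

theorem genSeries_add (s : σ) (l : List (Gen n × σ)) (g h : List (Gen n) → R) :
    genSeries ob s l (fun w => g w + h w) = genSeries ob s l g + genSeries ob s l h := by
  simp only [genSeries, map_add, slotEval_add]

theorem genSeries_smul (r : R) (s : σ) (l : List (Gen n × σ)) (g : List (Gen n) → R) :
    genSeries ob s l (fun w => r * g w) = C r * genSeries ob s l g := by
  simp only [genSeries, map_mul, mul_slotEval]

theorem genSeries_sum {ι : Type*} (S : Finset ι) (s : σ) (l : List (Gen n × σ))
    (g : ι → List (Gen n) → R) :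
    genSeries ob s l (fun w => ∑ i ∈ S, g i w) = ∑ i ∈ S, genSeries ob s l (g i) := by
  simp only [genSeries, map_sum, slotEval_sum]

theorem rename_genSeries {σ' : Type*} {ob' : σ' → Obj} (τ : σ → σ') [Filter.TendstoCofinite τ]
    (hτ : ∀ s, ob' (τ s) = ob s) (s : σ) (l : List (Gen n × σ)) (g : List (Gen n) → R) :
    rename τ (genSeries ob s l g) = genSeries ob' (τ s) (l.map fun a => (a.1, τ a.2)) g := by
  simp only [genSeries, rename_slotEval (ob' := ob') τ hτ, rename_C]

theorem genSeries_conv (s : σ) (l : List (Gen n × σ)) (g h : List (Gen n) → R) :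
    genSeries ob s l (conv g h) =
      splitSum (fun l₁ l₂ => genSeries ob s l₁ g * genSeries ob (endSlot s l₁) l₂ h) l := by
  have : ∀ w, C (σ := σ) (conv g h w) = splitSum (fun u v => C (σ := σ) (g u) * C (h v)) w := by
    intro w
    simp only [conv, splitSum_eq_sum_range, map_sum, map_mul]
  simp only [genSeries, this, slotEval_splitSum, ← mul_slotEval]
  refine splitSum_congr fun l₁ l₂ _ => ?_
  simp only [mul_comm (C (g _)), ← mul_slotEval]
  rw [mul_comm]

theorem Fits.redDeg {s : σ} {l : List (Gen n × σ)} {w : List (Gen n)} (h : Fits ob s l w) :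
    redDeg w = AYBE.redDeg (l.map Prod.fst) := by
  have hr : ∀ k o, AYBE.redDeg (List.replicate k (Gen.xi o : Gen n)) = 0 := by
    intro k o; induction k with
    | zero => rfl
    | succ k ih => rw [List.replicate_succ, redDeg_cons, ih]; simp [Gen.deg]
  induction l generalizing s w with
  | nil => obtain ⟨k, rfl⟩ := h; simp [hr]
  | cons a l ih =>
    obtain ⟨k, w', rfl, h⟩ := h
    simp [hr, ih h]

theorem Fits.length_le {s : σ} {l : List (Gen n × σ)} {w : List (Gen n)} (h : Fits ob s l w) :
    l.length ≤ w.length := by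
  induction l generalizing s w with
  | nil => simp
  | cons a l ih =>
    obtain ⟨k, w', rfl, h⟩ := h
    have := ih h
    simp; omega

theorem Fits.sublist {s : σ} {l : List (Gen n × σ)} {w : List (Gen n)} (h : Fits ob s l w) :
    (l.map Prod.fst).Sublist w := by
  induction l generalizing s w with
  | nil => simp
  | cons a l ih =>
    obtain ⟨k, w', rfl, h⟩ := h
    exact ((ih h).cons_cons a.1).trans (List.sublist_append_right _ _)

/-- The block consumes the letters of `l₂` with adjoining parts of the runs next to them. The output
letter `b` stands between the remainders of these runs, which keep their variables. The sign depends
only on `l₃` because ξ has reduced degree 0. -/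
theorem genSeries_derive (s : σ) (l : List (Gen n × σ)) (G : Ops R n) (g : List (Gen n) → R) :
    genSeries ob s l (derive G g) =
      splitSum (fun m l₃ => splitSum (fun l₁ l₂ => C (sgn R (redDeg (l₃.map Prod.fst))) *
        ∑ b, genSeries ob (endSlot s l₁) l₂ (fun v => G v b) *
          genSeries ob s (l₁ ++ (b, endSlot s m) :: l₃) g) m) l := by
  have h₁ : ∀ w, C (σ := σ) (derive G g w) = splitSum (fun m z => splitSum (fun u v =>
      ∑ b : Gen n, C (sgn R (redDeg z)) * (C (G v b) * C (g (u ++ b :: z)))) m) w := by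
    intro w
    simp only [derive, splitSum_eq_sum_range, map_sum, map_mul, Finset.mul_sum]
  simp only [genSeries, h₁, slotEval_splitSum]
  refine splitSum_congr fun m l₃ _ => ?_
  simp only [slotEval_splitSum_const, slotEval_splitSum]
  refine splitSum_congr fun l₁ l₂ _ => ?_
  simp only [slotEval_sum, Finset.mul_sum]
  refine Finset.sum_congr rfl fun b _ => ?_
  have h₂ : ∀ u v, (slotEval ob (endSlot s m) l₃ fun z =>
      C (sgn R (redDeg z)) * (C (G v b) * C (g (u ++ b :: z)))) =
      C (G v b) * (C (sgn R (redDeg (l₃.map Prod.fst))) *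
        slotEval ob (endSlot s m) l₃ fun z => C (g (u ++ b :: z))) := by
    intro u v
    rw [mul_slotEval, mul_slotEval]
    refine slotEval_congr fun z hz => ?_
    rw [hz.redDeg]
    ring
  simp only [h₂, slotEval_append]
  have h₃ : ∀ (A : List (Gen n) → MvPowerSeries σ R),
      (slotEval ob s l₁ fun u => slotEval ob (endSlot s l₁) l₂ fun v => C (G v b) * A u) =
        (slotEval ob (endSlot s l₁) l₂ fun v => C (G v b)) * slotEval ob s l₁ A := by
    intro A
    rw [mul_slotEval]
    congr 1
    funext u
    rw [mul_comm, mul_slotEval]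
    simp only [mul_comm (A u)]
  rw [h₃, ← mul_slotEval]
  ring

/-- On runs of ξ's the functor is the identity: a block of ξ's contributes only when it is a single
ξ. Peeling off first blocks gives the recursion of `eq_slotSum_of_succ`. -/
theorem genSeries_nil_blockSubst {F : Ops R n}
    (hF : ∀ s : σ, ∀ b, genSeries ob s [] (fun v => F v b) = if b = .xi (ob s) then X s else 0)
    (hF0 : ∀ c, F [] c = 0) (s : σ) (g : List (Gen n) → R) :
    genSeries ob s [] (blockSubst F g) = genSeries ob s [] g := by
  have key : ∀ g : List (Gen n) → R, genSeries ob s [] (blockSubst F g) = C (g []) +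
      X s * genSeries ob s [] (blockSubst F fun z => g (.xi (ob s) :: z)) := by
    intro g
    have h₁ : ∀ w, blockSubst F g w = (if w = [] then 1 else 0) * g [] +
        ∑ b, conv (fun v => F v b) (blockSubst F fun z => g (b :: z)) w := by
      intro w
      by_cases hw : w = []
      · subst hw; simp [conv, hF0]
      · rw [if_neg hw, blockSubst_eq_conv hF0 g hw]; simp
    have h₂ : genSeries ob s [] (fun w : List (Gen n) => (if w = [] then 1 else 0) * g []) =
        C (g []) := by
      rw [genSeries, slotEval, slotSum_eq_add]
      simp [slotSum_zero]
    rw [genSeries_congr fun w _ => h₁ w, genSeries_add, genSeries_sum, h₂]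
    simp [genSeries_conv, hF]
  have := eq_slotSum_of_succ (s := s) (G := fun k => C (g (List.replicate k (.xi (ob s)))))
    (A := fun k => genSeries ob s [] (blockSubst F fun z =>
      g (List.replicate k (.xi (ob s)) ++ z))) (fun k => by
        rw [key]; simp [List.replicate_succ'])
  simpa [genSeries, slotEval] using this

/-- Before the block that contains the letter `a` there are `k` blocks consisting of single ξ's,
each reproduced by `F`; they are counted by the slot `s`. -/
theorem genSeries_cons_blockSubst {F : Ops R n}
    (hF : ∀ s : σ, ∀ b, genSeries ob s [] (fun v => F v b) = if b = .xi (ob s) then X s else 0)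
    (hF0 : ∀ c, F [] c = 0) (s : σ) (a : Gen n × σ) (l : List (Gen n × σ))
    (g : List (Gen n) → R) :
    genSeries ob s (a :: l) (blockSubst F g) = slotSum s fun k => ∑ b, splitSum (fun l₁ l₂ =>
      genSeries ob s (a :: l₁) (fun v => F v b) * genSeries ob (endSlot a.2 l₁) l₂
        (blockSubst F fun z => g (List.replicate k (.xi (ob s)) ++ b :: z))) l := by
  have key : ∀ g : List (Gen n) → R, genSeries ob s (a :: l) (blockSubst F g) =
      ∑ b, splitSum (fun l₁ l₂ => genSeries ob s (a :: l₁) (fun v => F v b) *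
        genSeries ob (endSlot a.2 l₁) l₂ (blockSubst F fun z => g (b :: z))) l +
      X s * genSeries ob s (a :: l) (blockSubst F fun z => g (.xi (ob s) :: z)) := by
    intro g
    have h₁ : ∀ w, Fits ob s (a :: l) w → blockSubst F g w =
        ∑ b, conv (fun v => F v b) (blockSubst F fun z => g (b :: z)) w := by
      rintro w hw
      refine blockSubst_eq_conv hF0 g ?_
      have := hw.length_le
      rintro rfl
      simp at this
    rw [genSeries_congr h₁, genSeries_sum]
    simp [genSeries_conv, hF, Finset.sum_add_distrib, add_comm]
  have := eq_slotSum_of_succ (s := s) (G := fun k => ∑ b, splitSum (fun l₁ l₂ =>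
      genSeries ob s (a :: l₁) (fun v => F v b) * genSeries ob (endSlot a.2 l₁) l₂
        (blockSubst F fun z => g (List.replicate k (.xi (ob s)) ++ b :: z))) l)
    (A := fun k => genSeries ob s (a :: l) (blockSubst F fun z =>
      g (List.replicate k (.xi (ob s)) ++ z))) (fun k => by
        rw [key]; simp [List.replicate_succ'])
  simpa using this

variable (ob) in
/-- The word with the numbers of inserted `ξ`'s given by an exponent. -/
def slotWord : σ → List (Gen n × σ) → (σ → ℕ) → List (Gen n)
  | s, [], e => List.replicate (e s) (.xi (ob s))
  | s, (a, t) :: l, e => List.replicate (e s) (.xi (ob s)) ++ a :: slotWord t l e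

theorem slotWord_congr {s : σ} {l : List (Gen n × σ)} {e e' : σ → ℕ}
    (h : ∀ t ∈ s :: l.map Prod.snd, e t = e' t) : slotWord ob s l e = slotWord ob s l e' := by
  induction l generalizing s with
  | nil => simp [slotWord, h s (by simp)]
  | cons a l ih =>
    rw [slotWord, slotWord, h s (by simp), ih fun t ht => h t (List.mem_cons_of_mem _ ht)]

-- For pairwise distinct slots, an exponent determines the lengths of all runs. Hence equalities of
-- generating series may be tested word by word.
open Classical in
theorem coeff_genSeries {s : σ} {l : List (Gen n × σ)} (hs : (s :: l.map Prod.snd).Nodup)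
    (g : List (Gen n) → R) (e : σ →₀ ℕ) :
    coeff e (genSeries ob s l g) =
      if ∀ t, e t ≠ 0 → t ∈ s :: l.map Prod.snd then g (slotWord ob s l e) else 0 := by
  induction l generalizing s g e with
  | nil =>
    have hz : ∀ (r : R) (e : σ →₀ ℕ), coeff e (C r) = if ∀ t, e t = 0 then r else 0 := by
      intro r e
      rw [coeff_C]
      have : (e = 0) ↔ ∀ t, e t = 0 := DFunLike.ext_iff
      simp only [this]
    rw [genSeries, slotEval, coeff_slotSum_of_indep]
    · rw [hz]
      have : (∀ t, (e.erase s) t = 0) ↔ ∀ t, e t ≠ 0 → t ∈ [s] := by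
        refine forall_congr' fun t => ?_
        by_cases ht : t = s <;> simp [ht, Finsupp.erase_ne]
      simp only [this, List.map_nil, slotWord]
    · intro k e he
      rw [hz, if_neg]
      exact fun h => he (h s)
  | cons a l ih =>
    have hs' := List.nodup_cons.1 hs
    rw [genSeries, slotEval, coeff_slotSum_of_indep]
    · have := ih hs'.2 (fun w => g (List.replicate (e s) (.xi (ob s)) ++ a.1 :: w)) (e.erase s)
      rw [genSeries] at this
      rw [this]
      have hiff : (∀ t, (e.erase s) t ≠ 0 → t ∈ a.2 :: l.map Prod.snd) ↔
          ∀ t, e t ≠ 0 → t ∈ s :: (a :: l).map Prod.snd := by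
        refine forall_congr' fun t => ?_
        by_cases ht : t = s <;> simp [ht, Finsupp.erase_ne]
      simp only [hiff, slotWord]
      rw [slotWord_congr (e' := e)]
      intro t ht
      rw [Finsupp.erase_ne]
      rintro rfl
      exact hs'.1 (by simpa using ht)
    · intro k e he
      have := ih hs'.2 (fun w => g (List.replicate k (.xi (ob s)) ++ a.1 :: w)) e
      rw [genSeries] at this
      rw [this, if_neg]
      intro h
      exact hs'.1 (by simpa using h s he)

theorem coeff_genSeries_of_cover {s : σ} {l : List (Gen n × σ)} (hs : (s :: l.map Prod.snd).Nodup)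
    (hc : ∀ t, t ∈ s :: l.map Prod.snd) (g : List (Gen n) → R) (e : σ →₀ ℕ) :
    coeff e (genSeries ob s l g) = g (slotWord ob s l e) := by
  classical
  rw [coeff_genSeries hs, if_pos fun t _ => hc t]

end Eval

end

section

/-! ### Vanishing and divided differences of generating series. -/

section Series

variable {σ R : Type*} [CommRing R] {n : ℕ} {ob : σ → Obj}

/-- The letters of `l` are composable morphisms between the objects of the slots. -/
def SlotPath (ob : σ → Obj) : σ → List (Gen n × σ) → Prop
  | _, [] => True
  | s, (a, t) :: l => a.tgt = ob s ∧ a.src = ob t ∧ SlotPath ob t l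

theorem isPath_replicate_append {o o' : Obj} (k : ℕ) {w : List (Gen n)} (h : IsPath o o' w) :
    IsPath o o' (List.replicate k (.xi o) ++ w) := by
  induction k with
  | zero => exact h
  | succ k ih => exact ⟨rfl, ih⟩

theorem Fits.isPath {s : σ} {l : List (Gen n × σ)} {w : List (Gen n)} (h : Fits ob s l w)
    (hl : SlotPath ob s l) : IsPath (ob s) (ob (endSlot s l)) w := by
  induction l generalizing s w with
  | nil =>
    obtain ⟨k, rfl⟩ := h
    simpa using isPath_replicate_append (n := n) k (show IsPath (ob s) (ob s) [] from rfl)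
  | cons a l ih =>
    obtain ⟨k, w', rfl, h⟩ := h
    exact isPath_replicate_append k ⟨hl.1, hl.2.1 ▸ ih h hl.2.2⟩

theorem IsPath.unique {o o' p p' : Obj} {w : List (Gen n)} (h : IsPath o o' w)
    (h' : IsPath p p' w) (hw : w ≠ []) : o = p ∧ o' = p' := by
  induction w generalizing o p with
  | nil => exact absurd rfl hw
  | cons a w ih =>
    refine ⟨h.1.symm.trans h'.1, ?_⟩
    cases w with
    | nil => exact (Eq.symm h.2).trans h'.2
    | cons b w => exact (ih h.2 h'.2 (by simp)).2

/-- All words of the series are parallel and have the same reduced degree, so a single degree count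
eliminates the whole series. -/
theorem Graded.genSeries_eq_zero {p : ℤ} {F : Ops R n} (hF : Graded p F) {s : σ}
    {l : List (Gen n × σ)} (hl : SlotPath ob s l) {c : Gen n}
    (h : ob s = c.tgt → ob (endSlot s l) = c.src → c.deg - 1 ≠ redDeg (l.map Prod.fst) + p) :
    genSeries ob s l (fun w => F w c) = 0 := by
  refine AYBE.genSeries_eq_zero fun w hw => ?_
  by_contra hne
  obtain ⟨h₁, h₂, h₃⟩ := hF _ _ hne
  obtain ⟨h₄, h₅⟩ := (hw.isPath hl).unique h₂ h₁
  exact h h₄ h₅ (by rw [h₃, hw.redDeg])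

theorem slotSum_eq_first {s : σ} {G : ℕ → MvPowerSeries σ R} (h : ∀ k, G (k + 1) = 0) :
    slotSum s G = G 0 := by
  rw [slotSum_eq_add]
  simp [h, slotSum_zero]

/-- If every word with an additional ξ contributes zero, the series is its constant term. -/
theorem genSeries_of_minimal {s : σ} {l : List (Gen n × σ)} {g : List (Gen n) → R}
    (h : ∀ w, Fits ob s l w → l.length < w.length → g w = 0) :
    genSeries ob s l g = C (g (l.map Prod.fst)) := by
  induction l generalizing s g with
  | nil =>
    rw [genSeries, slotEval, slotSum_eq_first]
    · simp
    · intro k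
      rw [h _ ⟨_, rfl⟩ (by simp), map_zero]
  | cons a l ih =>
    rw [genSeries, slotEval, slotSum_eq_first]
    · exact ih fun w hw hlen => h _ ⟨0, w, rfl, hw⟩ (by simpa using hlen)
    · intro k
      refine AYBE.genSeries_eq_zero (g := fun w =>
        g (List.replicate (k + 1) (.xi (ob s)) ++ a.1 :: w)) fun w hw => ?_
      refine h _ ⟨_, w, rfl, hw⟩ ?_
      have := hw.length_le
      simp; omega

theorem sub_mul_genSeries_xi_head {s t : σ} (h : ob s = ob t) (l : List (Gen n × σ))
    (g : List (Gen n) → R) :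
    (X s - X t) * genSeries ob s ((.xi (ob s), t) :: l) g =
      genSeries ob s l g - genSeries ob t l g :=
  sub_mul_slotEval_xi h l _

theorem sub_mul_genSeries_xi {t t' : σ} (h : ob t = ob t') (s : σ) (l₁ : List (Gen n × σ))
    (b : Gen n) (l₃ : List (Gen n × σ)) (g : List (Gen n) → R) :
    (X t - X t') * genSeries ob s (l₁ ++ (b, t) :: (.xi (ob t), t') :: l₃) g =
      genSeries ob s (l₁ ++ (b, t) :: l₃) g - genSeries ob s (l₁ ++ (b, t') :: l₃) g := by
  simp only [genSeries, slotEval_append s l₁ b]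
  rw [mul_slotEval, eq_sub_iff_add_eq, ← slotEval_add]
  congr 1
  funext u
  rw [sub_mul_slotEval_xi h]
  ring

theorem sum_gen_theta {M : Type*} [AddCommMonoid M] {f : Gen n → M} (h₁ : ∀ o, f (.one o) = 0)
    (h₂ : ∀ o, f (.xi o) = 0) (h₃ : ∀ i, f (.eta i) = 0) : ∑ b, f b = ∑ i, f (.theta i) := by
  rw [Gen.sum_eq]; simp [h₁, h₂, h₃]

theorem sum_gen_eta {M : Type*} [AddCommMonoid M] {f : Gen n → M} (h₁ : ∀ o, f (.one o) = 0)
    (h₂ : ∀ o, f (.xi o) = 0) (h₃ : ∀ i, f (.theta i) = 0) : ∑ b, f b = ∑ i, f (.eta i) := by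
  rw [Gen.sum_eq]; simp [h₁, h₂, h₃]

end Series

/-! ### Generating series of a cyclic operation on short words. -/

namespace IsCyclicOp

variable {σ R : Type*} [CommRing R] {n : ℕ} {ob : σ → Obj} {op : Ops R n}

theorem redDeg_replicate_xi (k : ℕ) (o : Obj) :
    redDeg (List.replicate k (Gen.xi o : Gen n)) = 0 := by
  induction k with
  | zero => rfl
  | succ k ih => rw [List.replicate_succ, redDeg_cons, ih]; simp [Gen.deg]

theorem rotate_replicate (h : IsCyclicOp op) (k : ℕ) (o : Obj) (a b : Gen n) (w : List (Gen n)) :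
    psign R b * op (List.replicate k (.xi o) ++ a :: w) b.dual =
      sgn R ((b.deg - 1) * redDeg (a :: w)) *
        (psign R a * op (w ++ b :: List.replicate k (.xi o)) a.dual) := by
  induction k generalizing b w with
  | zero => exact h.rotate b a w
  | succ k ih =>
    have hr := redDeg_replicate_xi (n := n) k o
    have := ih (.xi o) (w ++ [b])
    rw [List.replicate_succ, List.cons_append, h.rotate, List.append_assoc, List.cons_append, this]
    simp [Gen.deg, hr, ← List.replicate_succ]

/-- Rotating through the initial run of ξ's costs no sign, so the rotation lemma holds for entire
generating series; the initial run reappears at the end with its variable. -/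
theorem genSeries_rotate (h : IsCyclicOp op) (s₀ s₁ : σ) (a b : Gen n) (l : List (Gen n × σ)) :
    C (psign R b) * genSeries ob s₀ ((a, s₁) :: l) (fun w => op w b.dual) =
      C (sgn R ((b.deg - 1) * redDeg (a :: l.map Prod.fst)) * psign R a) *
        genSeries ob s₁ (l ++ [(b, s₀)]) (fun w => op w a.dual) := by
  rw [← genSeries_smul, ← genSeries_smul, genSeries, genSeries, slotEval, slotEval_append]
  simp only [slotEval]
  rw [← slotSum_slotEval_comm]
  congr 1
  funext k
  refine slotEval_congr fun w hw => ?_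
  rw [h.rotate_replicate, mul_assoc, redDeg_cons, redDeg_cons, hw.redDeg]

section Values

variable (h : IsCyclicOp op) {x x' x'' x''' y y' y'' y''' : σ}

variable (ob op) in
/-- The generating series of the coefficient of `θ_g` in
`μ(ξ_Y^*, θ_{a'}, ξ_X^*, η_b, ξ_Y^*, θ_a, ξ_X^*)`. -/
def quad (y' x' y x : σ) (a' b a g : Fin n) : MvPowerSeries σ R :=
  genSeries ob y' [(.theta a', x'), (.eta b, y), (.theta a, x)] (fun w => op w (.theta g))

include h

theorem genSeries_nil (s : σ) (b : Gen n) : genSeries ob s [] (fun w => op w b) = 0 := by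
  refine h.graded.genSeries_eq_zero (by trivial) fun _ _ => ?_
  rcases b.deg_eq with hb | hb <;> simp [hb]

theorem genSeries_theta (hy : ob y = .Y) (hx : ob x = .X) (i : Fin n) (b : Gen n) :
    genSeries ob y [(.theta i, x)] (fun w => op w b) = 0 := by
  have hp : SlotPath ob y [(.theta i, x)] := ⟨hy.symm, hx.symm, trivial⟩
  refine h.graded.genSeries_eq_zero hp ?_
  cases b <;> simp [Gen.tgt, Gen.src, Gen.deg, hy, hx] <;> grind

theorem genSeries_eta (hy : ob y = .Y) (hx : ob x = .X) (i : Fin n) (b : Gen n) :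
    genSeries ob x [(.eta i, y)] (fun w => op w b) = 0 := by
  have hp : SlotPath ob x [(.eta i, y)] := ⟨hx.symm, hy.symm, trivial⟩
  refine h.graded.genSeries_eq_zero hp ?_
  cases b <;> simp [Gen.tgt, Gen.src, Gen.deg, hy, hx]

theorem genSeries_xi {l : List (Gen n × σ)} (hl : l.length = 2) (s : σ) (o : Obj) :
    genSeries ob s l (fun w => op w (.xi o)) = C (op (l.map Prod.fst) (.xi o)) := by
  refine genSeries_of_minimal fun w _ hw => h.op_xi ?_ o
  omega

theorem genSeries_eta_theta (hx : ob x = .X) (hy : ob y = .Y) (hx' : ob x' = .X) (j i : Fin n)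
    (b : Gen n) : genSeries ob x' [(.eta j, y), (.theta i, x)] (fun w => op w b) =
      if b = .xi .X then (if j = i then 1 else 0) else 0 := by
  have hp : SlotPath ob x' [(.eta j, y), (.theta i, x)] := ⟨hx'.symm, hy.symm, hy.symm, hx.symm, trivial⟩
  split_ifs with hb hij
  · subst hb; rw [h.genSeries_xi rfl]; simp [h.op_two, mu2, hij]
  · subst hb; rw [h.genSeries_xi rfl]; simp [h.op_two, mu2, hij]
  · refine h.graded.genSeries_eq_zero hp ?_
    cases b <;> simp_all [Gen.tgt, Gen.src, Gen.deg] <;> grind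

theorem genSeries_theta_eta (hy : ob y = .Y) (hx : ob x = .X) (hy' : ob y' = .Y) (i j : Fin n)
    (b : Gen n) : genSeries ob y' [(.theta i, x), (.eta j, y)] (fun w => op w b) =
      if b = .xi .Y then (if i = j then -1 else 0) else 0 := by
  have hp : SlotPath ob y' [(.theta i, x), (.eta j, y)] :=
    ⟨hy'.symm, hx.symm, hx.symm, hy.symm, trivial⟩
  split_ifs with hb hij
  · subst hb; rw [h.genSeries_xi rfl]; simp [h.op_two, mu2, hij]
  · subst hb; rw [h.genSeries_xi rfl]; simp [h.op_two, mu2, hij]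
  · refine h.graded.genSeries_eq_zero hp ?_
    cases b <;> simp_all [Gen.tgt, Gen.src, Gen.deg] <;> grind

theorem genSeries_one {l : List (Gen n × σ)} (hl : l.length = 2) {o : Obj}
    (ho : Gen.one o ∈ l.map Prod.fst) (s : σ) (c : Gen n) :
    genSeries ob s l (fun w => op w c) = C (op (l.map Prod.fst) c) :=
  genSeries_of_minimal fun w hw hlen =>
    h.strictly_unital w o c (by omega) (hw.sublist.subset ho)

theorem sum_theta_eta_theta (hx : ob x = .X) (hy : ob y = .Y) (hx' : ob x' = .X)
    (hy' : ob y' = .Y) (i j k : Fin n) (f : Gen n → MvPowerSeries σ R) :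
    ∑ b, genSeries ob y' [(.theta i, x'), (.eta j, y), (.theta k, x)] (fun w => op w b) * f b =
      ∑ g, quad ob op y' x' y x i j k g * f (.theta g) := by
  have hp : SlotPath ob y' [(.theta i, x'), (.eta j, y), (.theta k, x)] :=
    ⟨hy'.symm, hx'.symm, hx'.symm, hy.symm, hy.symm, hx.symm, trivial⟩
  refine sum_gen_theta (fun o => ?_) (fun o => ?_) (fun o => ?_) <;>
  · rw [h.graded.genSeries_eq_zero hp, zero_mul]
    simp [Gen.tgt, Gen.src, Gen.deg, hy', hx]
    try rintro rfl; simp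

/-- Rotation expresses the operations with output η through those with output θ. -/
theorem genSeries_eta_theta_eta (x' y x y' : σ) (i j k g : Fin n) :
    genSeries ob x' [(.eta i, y), (.theta j, x), (.eta k, y')] (fun w => op w (.eta g)) =
      quad ob op y x y' x' j k g i := by
  have := h.genSeries_rotate (ob := ob) x' y (.eta i) (.theta g) [(.theta j, x), (.eta k, y')]
  simpa [psign, Gen.deg, Gen.dual, quad] using this

theorem sum_eta_theta_eta (hx : ob x = .X) (hy : ob y = .Y) (hx' : ob x' = .X)
    (hy' : ob y' = .Y) (i j k : Fin n) (f : Gen n → MvPowerSeries σ R) :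
    ∑ b, genSeries ob x' [(.eta i, y), (.theta j, x), (.eta k, y')] (fun w => op w b) * f b =
      ∑ g, quad ob op y x y' x' j k g i * f (.eta g) := by
  have hp : SlotPath ob x' [(.eta i, y), (.theta j, x), (.eta k, y')] :=
    ⟨hx'.symm, hy.symm, hy.symm, hx.symm, hx.symm, hy'.symm, trivial⟩
  simp only [← h.genSeries_eta_theta_eta]
  refine sum_gen_eta (fun o => ?_) (fun o => ?_) (fun o => ?_) <;>
  · rw [h.graded.genSeries_eq_zero hp, zero_mul]
    simp [Gen.tgt, Gen.src, Gen.deg, hy', hx']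
    try rintro rfl; simp

/-- Rotation of the cyclic word θηθη by two letters returns a word of the same type, with sign -1.
This is the skew-symmetry of the solution. -/
theorem quad_skew (y' x' y x : σ) (a' b a g : Fin n) :
    quad ob op y' x' y x a' b a g = -quad ob op y x y' x' a g a' b := by
  have := h.genSeries_rotate (ob := ob) y' x' (.theta a') (.eta g) [(.eta b, y), (.theta a, x)]
  rw [← h.genSeries_eta_theta_eta x' y x y', quad]
  simpa [psign, Gen.deg, Gen.dual] using this

/-- By degree only the output id_X is possible. Rotating its dual letter ξ_X into the inputs gives a
θηθ series with an additional ξ, hence later a divided difference of `quad`. -/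
theorem genSeries_eta_theta_eta_theta (hx : ob x = .X) (hy : ob y = .Y) (hx' : ob x' = .X)
    (hy' : ob y' = .Y) (hx'' : ob x'' = .X) (i j k m : Fin n) (b : Gen n) :
    genSeries ob x'' [(.eta i, y'), (.theta j, x'), (.eta k, y), (.theta m, x)]
      (fun w => op w b) = if b = .one .X then
        genSeries ob y' [(.theta j, x'), (.eta k, y), (.theta m, x), (.xi .X, x'')]
          (fun w => op w (.theta i)) else 0 := by
  have hp : SlotPath ob x'' [(.eta i, y'), (.theta j, x'), (.eta k, y), (.theta m, x)] :=
    ⟨hx''.symm, hy'.symm, hy'.symm, hx'.symm, hx'.symm, hy.symm, hy.symm, hx.symm, trivial⟩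
  split_ifs with hb
  · subst hb
    have := h.genSeries_rotate (ob := ob) x'' y' (.eta i) (.xi .X)
      [(.theta j, x'), (.eta k, y), (.theta m, x)]
    simpa [psign, Gen.deg, Gen.dual] using this
  · refine h.graded.genSeries_eq_zero hp ?_
    cases b <;> simp_all [Gen.tgt, Gen.src, Gen.deg] <;> grind

/-- As in the preceding case with id_Y, but two rotations are needed to reach a word with output θ.
-/
theorem genSeries_theta_eta_theta_eta (hx : ob x = .X) (hy : ob y = .Y) (hx' : ob x' = .X)
    (hy' : ob y' = .Y) (hy'' : ob y'' = .Y) (i j k m : Fin n) (b : Gen n) :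
    genSeries ob y'' [(.theta i, x'), (.eta j, y'), (.theta k, x), (.eta m, y)]
      (fun w => op w b) = if b = .one .Y then
        -genSeries ob y' [(.theta k, x), (.eta m, y), (.xi .Y, y''), (.theta i, x')]
          (fun w => op w (.theta j)) else 0 := by
  have hp : SlotPath ob y'' [(.theta i, x'), (.eta j, y'), (.theta k, x), (.eta m, y)] :=
    ⟨hy''.symm, hx'.symm, hx'.symm, hy'.symm, hy'.symm, hx.symm, hx.symm, hy.symm, trivial⟩
  split_ifs with hb
  · subst hb
    have h₁ := h.genSeries_rotate (ob := ob) y'' x' (.theta i) (.xi .Y)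
      [(.eta j, y'), (.theta k, x), (.eta m, y)]
    have h₂ := h.genSeries_rotate (ob := ob) x' y' (.eta j) (.theta i)
      [(.theta k, x), (.eta m, y), (.xi .Y, y'')]
    simp [psign, Gen.deg, Gen.dual] at h₁ h₂
    rw [h₁, h₂]
  · refine h.graded.genSeries_eq_zero hp ?_
    cases b <;> simp_all [Gen.tgt, Gen.src, Gen.deg] <;> grind

theorem genSeries_theta_one (i g : Fin n) :
    genSeries ob y [(.theta i, x), (.one .X, x')] (fun w => op w (.theta g)) =
      if i = g then 1 else 0 := by
  rw [h.genSeries_one (o := .X) rfl (by simp)]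
  by_cases hig : i = g <;> simp [h.op_two, mu2, Gen.src, hig, eq_comm]

theorem genSeries_one_theta (i g : Fin n) :
    genSeries ob y [(.one .Y, y'), (.theta i, x)] (fun w => op w (.theta g)) =
      if i = g then 1 else 0 := by
  rw [h.genSeries_one (o := .Y) rfl (by simp)]
  by_cases hig : i = g <;> simp [h.op_two, mu2, Gen.tgt, Gen.deg, hig, eq_comm]

end Values

end IsCyclicOp

end

section

/-! ### The quintic A∞-relation and the Yang–Baxter equation. -/

namespace IsCyclicOp

variable {σ R : Type*} [CommRing R] {n : ℕ} {ob : σ → Obj} {op : Ops R n}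

/-- The three sums are the compositions of two higher products, in which the inner one has three
non-ξ inputs. The other terms contain one μ₂: the last four come from an inner μ₂(η, θ) or μ₂(θ, η)
with value ±ξ, and the first two from an inner operation with value id_X or id_Y followed by a
product with an identity. Each contains exactly one additional ξ. -/
theorem genSeries_quintic (h : IsCyclicOp op) {x₁ x₂ x₃ y₁ y₂ y₃ : σ}
    (hx₁ : ob x₁ = .X) (hx₂ : ob x₂ = .X) (hx₃ : ob x₃ = .X)
    (hy₁ : ob y₁ = .Y) (hy₂ : ob y₂ = .Y) (hy₃ : ob y₃ = .Y) (a₃ b₂ a₂ b₁ a₁ g : Fin n) :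
    genSeries ob y₃ [(.theta a₃, x₃), (.eta b₂, y₂), (.theta a₂, x₂), (.eta b₁, y₁),
      (.theta a₁, x₁)] (derive op (fun w => op w (.theta g))) =
    ∑ k, quad ob op y₂ x₂ y₁ x₁ a₂ b₁ a₁ k * quad ob op y₃ x₃ y₂ x₁ a₃ b₂ k g
    - ∑ k, quad ob op y₂ x₂ y₁ x₃ a₂ b₁ k b₂ * quad ob op y₃ x₃ y₁ x₁ a₃ k a₁ g
    - ∑ k, quad ob op y₃ x₃ y₂ x₂ a₃ b₂ a₂ k * quad ob op y₃ x₂ y₁ x₁ k b₁ a₁ g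
    + (if a₃ = g then genSeries ob y₂ [(.theta a₂, x₂), (.eta b₁, y₁), (.theta a₁, x₁),
        (.xi .X, x₃)] (fun w => op w (.theta b₂)) else 0)
    + (if a₁ = g then genSeries ob y₂ [(.theta a₂, x₂), (.eta b₁, y₁), (.xi .Y, y₃),
        (.theta a₃, x₃)] (fun w => op w (.theta b₂)) else 0)
    + (if b₁ = a₁ then genSeries ob y₃ [(.theta a₃, x₃), (.eta b₂, y₂), (.theta a₂, x₂),
        (.xi .X, x₁)] (fun w => op w (.theta g)) else 0)
    + (if a₂ = b₁ then genSeries ob y₃ [(.theta a₃, x₃), (.eta b₂, y₂), (.xi .Y, y₁),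
        (.theta a₁, x₁)] (fun w => op w (.theta g)) else 0)
    - (if b₂ = a₂ then genSeries ob y₃ [(.theta a₃, x₃), (.xi .X, x₂), (.eta b₁, y₁),
        (.theta a₁, x₁)] (fun w => op w (.theta g)) else 0)
    - (if a₃ = b₂ then genSeries ob y₃ [(.xi .Y, y₂), (.theta a₂, x₂), (.eta b₁, y₁),
        (.theta a₁, x₁)] (fun w => op w (.theta g)) else 0) := by
  have hp : SlotPath ob y₃ [(.theta a₃, x₃), (.eta b₂, y₂), (.theta a₂, x₂), (.eta b₁, y₁),
      (.theta a₁, x₁)] := ⟨hy₃.symm, hx₃.symm, hx₃.symm, hy₂.symm, hy₂.symm, hx₂.symm, hx₂.symm,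
        hy₁.symm, hy₁.symm, hx₁.symm, trivial⟩
  have h₅ : ∀ b, genSeries ob y₃ [(.theta a₃, x₃), (.eta b₂, y₂), (.theta a₂, x₂), (.eta b₁, y₁),
      (.theta a₁, x₁)] (fun w => op w b) = 0 := by
    intro b
    refine h.graded.genSeries_eq_zero hp fun _ _ => ?_
    rcases b.deg_eq with hb | hb <;> rw [hb] <;> simp [Gen.deg]
  rw [genSeries_derive]
  simp only [splitSum_cons, splitSum_nil, endSlot_cons, endSlot_nil, h.genSeries_nil,
    h.genSeries_theta hy₃ hx₃, h.genSeries_eta hy₂ hx₃, h.genSeries_theta hy₂ hx₂,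
    h.genSeries_eta hy₁ hx₂, h.genSeries_theta hy₁ hx₁, h₅, zero_mul, Finset.sum_const_zero,
    mul_zero, add_zero, zero_add, h.genSeries_eta_theta hx₁ hy₁ hx₂,
    h.genSeries_eta_theta hx₂ hy₂ hx₃, h.genSeries_theta_eta hy₁ hx₂ hy₂,
    h.genSeries_theta_eta hy₂ hx₃ hy₃, h.sum_theta_eta_theta hx₁ hy₁ hx₂ hy₂,
    h.sum_theta_eta_theta hx₂ hy₂ hx₃ hy₃, h.sum_eta_theta_eta hx₂ hy₂ hx₃ hy₁,
    h.genSeries_eta_theta_eta_theta hx₁ hy₁ hx₂ hy₂ hx₃,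
    h.genSeries_theta_eta_theta_eta hx₂ hy₁ hx₃ hy₂ hy₃, ite_mul, Finset.sum_ite_eq',
    Finset.mem_univ, if_true, List.cons_append, List.nil_append, h.genSeries_theta_one,
    h.genSeries_one_theta]
  have hs : sgn R 2 = 1 := by simp [sgn, Int.negOnePow]
  simp only [List.map_cons, List.map_nil, redDeg_cons, redDeg_nil, Gen.deg]
  have hs₁ : sgn R (-1) = -1 := by simp [sgn, Int.negOnePow]
  have hneg : ∀ (p : Prop) [Decidable p] (u : MvPowerSeries σ R),
      (if p then -u else 0) = -if p then u else 0 := by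
    intro p _ u; split_ifs <;> simp
  norm_num [hs, hs₁, quad, hneg]
  ring

section Entries

variable {K : Type*} [CommRing K]

/-- The Kronecker symbol. -/
def kd (K : Type*) [CommRing K] (a b : Fin n) : K := if a = b then 1 else 0

theorem kd_comm (a b : Fin n) : kd K a b = kd K b a := by simp [kd, eq_comm]

theorem sum_kd_mul (a : Fin n) (f : Fin n → K) : ∑ k, kd K a k * f k = f a := by simp [kd]

theorem sum_mul_kd (a : Fin n) (f : Fin n → K) : ∑ k, f k * kd K k a = f a := by simp [kd]

/-- The contraction of two tensors, each the sum of a regular part and two multiples of Kronecker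
symbols. -/
theorem sum_mul_polar (p q : Fin n → K) (i i' j j' : Fin n) (A B A' B' : K) :
    ∑ k, (-p k + kd K i k * A + kd K i' k * B) * (-q k + kd K k j * A' + kd K k j' * B') =
      ∑ k, p k * q k - A' * p j - B' * p j' - A * q i - B * q i' + A * A' * kd K i j
        + A * B' * kd K i j' + B * A' * kd K i' j + B * B' * kd K i' j' := by
  rw [← sum_mul_kd j p, ← sum_mul_kd j' p, ← sum_kd_mul i q, ← sum_kd_mul i' q,
    ← sum_kd_mul i (kd K · j), ← sum_kd_mul i (kd K · j'), ← sum_kd_mul i' (kd K · j),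
    ← sum_kd_mul i' (kd K · j')]
  simp only [Finset.mul_sum, ← Finset.sum_add_distrib, ← Finset.sum_sub_distrib]
  exact Finset.sum_congr rfl fun k _ => by ring

variable (ob op) in
/-- An entry of the tensor attached to `op`, in a ring where the differences of the variables are
invertible. -/
def entry (ι : MvPowerSeries σ R →+* K) (y' x' y x : σ) (a' b a g : Fin n) : K :=
  -ι (quad ob op y' x' y x a' b a g) + kd K g a' * (kd K b a * Ring.inverse (ι (X x' - X x)))
    + kd K g a * (kd K b a' * Ring.inverse (ι (X y - X y')))

theorem inverse_map_sub_comm (ι : MvPowerSeries σ R →+* K) (s t : σ) :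
    Ring.inverse (ι (X s - X t)) = -Ring.inverse (ι (X t - X s)) := by
  rw [← neg_sub, map_neg]
  by_cases hu : IsUnit (ι (X t - X s))
  · obtain ⟨u, hu⟩ := hu
    rw [← hu, ← Units.val_neg, Ring.inverse_unit, Ring.inverse_unit, inv_neg, Units.val_neg]
  · rw [Ring.inverse_non_unit _ hu, Ring.inverse_non_unit _ (by rwa [IsUnit.neg_iff]), neg_zero]

theorem entry_skew (h : IsCyclicOp op) (ι : MvPowerSeries σ R →+* K) (y' x' y x : σ)
    (a' b a g : Fin n) : entry ob op ι y' x' y x a' b a g = -entry ob op ι y x y' x' a g a' b := by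
  rw [entry, entry, h.quad_skew, inverse_map_sub_comm ι x, inverse_map_sub_comm ι y, map_neg]
  ring

/-- After division by differences of variables, the six terms with an additional ξ are the cross
terms of regular and polar parts in the products of entries, and the three sums are the products of
regular parts. What remains are the products of two polar parts, which cancel. -/
theorem entry_quintic (h : IsCyclicOp op) (ι : MvPowerSeries σ R →+* K) {x₁ x₂ x₃ y₁ y₂ y₃ : σ}
    (hx₁ : ob x₁ = .X) (hx₂ : ob x₂ = .X) (hx₃ : ob x₃ = .X)
    (hy₁ : ob y₁ = .Y) (hy₂ : ob y₂ = .Y) (hy₃ : ob y₃ = .Y)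
    (ux₁₂ : IsUnit (ι (X x₁ - X x₂))) (ux₂₃ : IsUnit (ι (X x₂ - X x₃)))
    (ux₁₃ : IsUnit (ι (X x₁ - X x₃))) (uy₁₂ : IsUnit (ι (X y₁ - X y₂)))
    (uy₂₃ : IsUnit (ι (X y₂ - X y₃))) (uy₁₃ : IsUnit (ι (X y₁ - X y₃)))
    (a₃ b₂ a₂ b₁ a₁ g : Fin n) :
    ∑ k, entry ob op ι y₃ x₃ y₂ x₁ a₃ b₂ k g * entry ob op ι y₂ x₂ y₁ x₁ a₂ b₁ a₁ k
    - ∑ k, entry ob op ι y₃ x₂ y₁ x₁ k b₁ a₁ g * entry ob op ι y₃ x₃ y₂ x₂ a₃ b₂ a₂ k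
    - ∑ k, entry ob op ι y₂ x₂ y₁ x₃ a₂ b₁ k b₂ * entry ob op ι y₃ x₃ y₁ x₁ a₃ k a₁ g =
    ι (genSeries ob y₃ [(.theta a₃, x₃), (.eta b₂, y₂), (.theta a₂, x₂), (.eta b₁, y₁),
      (.theta a₁, x₁)] (derive op (fun w => op w (.theta g)))) := by
  -- The differences of variables become invertible under `ι`, so the divided difference identities
  -- can be solved.
  have dd : ∀ {d s t u : MvPowerSeries σ R}, d * u = s - t → IsUnit (ι d) →
      ι u = Ring.inverse (ι d) * (ι s - ι t) := by
    intro d s t u hd hu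
    rw [← map_sub, ← hd, map_mul, ← mul_assoc, Ring.inverse_mul_cancel _ hu, one_mul]
  have ex₁₃ : ob x₁ = ob x₃ := hx₁.trans hx₃.symm
  have ex₂₁ : ob x₂ = ob x₁ := hx₂.trans hx₁.symm
  have ex₃₂ : ob x₃ = ob x₂ := hx₃.trans hx₂.symm
  have ey₁₃ : ob y₁ = ob y₃ := hy₁.trans hy₃.symm
  have ey₂₁ : ob y₂ = ob y₁ := hy₂.trans hy₁.symm
  have ey₃₂ : ob y₃ = ob y₂ := hy₃.trans hy₂.symm
  have nu : ∀ {s t : σ}, IsUnit (ι (X s - X t)) → IsUnit (ι (X t - X s)) := by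
    intro s t hu
    rw [← neg_sub, map_neg]
    exact hu.neg
  have d₁ := dd (sub_mul_genSeries_xi ex₁₃ y₂ [(.theta a₂, x₂), (.eta b₁, y₁)] (.theta a₁) []
    (fun w => op w (.theta b₂))) ux₁₃
  have d₂ := dd (sub_mul_genSeries_xi ey₁₃ y₂ [(.theta a₂, x₂)] (.eta b₁) [(.theta a₃, x₃)]
    (fun w => op w (.theta b₂))) uy₁₃
  have d₃ := dd (sub_mul_genSeries_xi ex₂₁ y₃ [(.theta a₃, x₃), (.eta b₂, y₂)] (.theta a₂) []
    (fun w => op w (.theta g))) (nu ux₁₂)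
  have d₄ := dd (sub_mul_genSeries_xi ey₂₁ y₃ [(.theta a₃, x₃)] (.eta b₂) [(.theta a₁, x₁)]
    (fun w => op w (.theta g))) (nu uy₁₂)
  have d₅ := dd (sub_mul_genSeries_xi ex₃₂ y₃ [] (.theta a₃) [(.eta b₁, y₁), (.theta a₁, x₁)]
    (fun w => op w (.theta g))) (nu ux₂₃)
  have d₆ := dd (sub_mul_genSeries_xi_head ey₃₂ [(.theta a₂, x₂), (.eta b₁, y₁), (.theta a₁, x₁)]
    (fun w => op w (.theta g))) (nu uy₂₃)
  simp only [List.cons_append, List.nil_append, hx₁, hx₂, hx₃, hy₁, hy₂, hy₃] at d₁ d₂ d₃ d₄ d₅ d₆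
  -- One term of the second divided difference appears rotated by two letters relative to the `quad`
  -- in the claim.
  have hsk := h.quad_skew (ob := ob) y₂ x₂ y₃ x₃ a₂ b₁ a₃ b₂
  rw [quad, quad] at hsk
  rw [hsk, map_neg] at d₂
  rw [h.genSeries_quintic hx₁ hx₂ hx₃ hy₁ hy₂ hy₃]
  have hite : ∀ (a b : Fin n) (u : MvPowerSeries σ R), ι (if a = b then u else 0) =
      kd K a b * ι u := by
    intro a b u; by_cases hab : a = b <;> simp [hab, kd]
  simp only [map_add, map_sub, hite, d₁, d₂, d₃, d₄, d₅, d₆, map_sum, map_mul]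
  have e₁ : ∀ k, entry ob op ι y₃ x₃ y₂ x₁ a₃ b₂ k g =
      -ι (quad ob op y₃ x₃ y₂ x₁ a₃ b₂ k g) +
        kd K b₂ k * (kd K g a₃ * Ring.inverse (ι (X x₃ - X x₁)))
        + kd K g k * (kd K b₂ a₃ * Ring.inverse (ι (X y₂ - X y₃))) := fun k => by
    rw [entry]; ring
  have e₂ : ∀ k, entry ob op ι y₂ x₂ y₁ x₃ a₂ b₁ k b₂ =
      -ι (quad ob op y₂ x₂ y₁ x₃ a₂ b₁ k b₂) +
        kd K b₁ k * (kd K b₂ a₂ * Ring.inverse (ι (X x₂ - X x₃)))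
        + kd K b₂ k * (kd K b₁ a₂ * Ring.inverse (ι (X y₁ - X y₂))) := fun k => by
    rw [entry]; ring
  have e₃ : ∀ k, entry ob op ι y₃ x₂ y₁ x₁ k b₁ a₁ g =
      -ι (quad ob op y₃ x₂ y₁ x₁ k b₁ a₁ g) +
        kd K g k * (kd K b₁ a₁ * Ring.inverse (ι (X x₂ - X x₁)))
        + kd K b₁ k * (kd K g a₁ * Ring.inverse (ι (X y₁ - X y₃))) := fun k => by
    rw [entry]; ring
  have e₄ : ∀ k, entry ob op ι y₃ x₃ y₁ x₁ a₃ k a₁ g =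
      -ι (quad ob op y₃ x₃ y₁ x₁ a₃ k a₁ g) +
        kd K k a₁ * (kd K g a₃ * Ring.inverse (ι (X x₃ - X x₁)))
        + kd K k a₃ * (kd K g a₁ * Ring.inverse (ι (X y₁ - X y₃))) := fun k => by
    rw [entry]; ring
  have e₅ : ∀ k, entry ob op ι y₂ x₂ y₁ x₁ a₂ b₁ a₁ k =
      -ι (quad ob op y₂ x₂ y₁ x₁ a₂ b₁ a₁ k) +
        kd K k a₂ * (kd K b₁ a₁ * Ring.inverse (ι (X x₂ - X x₁)))
        + kd K k a₁ * (kd K b₁ a₂ * Ring.inverse (ι (X y₁ - X y₂))) := fun k => by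
    rw [entry]
  have e₆ : ∀ k, entry ob op ι y₃ x₃ y₂ x₂ a₃ b₂ a₂ k =
      -ι (quad ob op y₃ x₃ y₂ x₂ a₃ b₂ a₂ k) +
        kd K k a₃ * (kd K b₂ a₂ * Ring.inverse (ι (X x₃ - X x₂)))
        + kd K k a₂ * (kd K b₂ a₃ * Ring.inverse (ι (X y₂ - X y₃))) := fun k => by
    rw [entry]
  simp only [e₁, e₂, e₃, e₄, e₅, e₆, sum_mul_polar]
  -- The partial fraction identity for three variables, needed once for the x's and once for the
  -- y's.
  have pf : ∀ {s t u : σ}, IsUnit (ι (X s - X t)) → IsUnit (ι (X t - X u)) →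
      IsUnit (ι (X s - X u)) → Ring.inverse (ι (X s - X t)) * Ring.inverse (ι (X t - X u)) =
        Ring.inverse (ι (X s - X u)) * (Ring.inverse (ι (X s - X t)) +
          Ring.inverse (ι (X t - X u))) := by
    intro s t u h₁ h₂ h₃
    have c₁ := Ring.mul_inverse_cancel _ h₁
    have c₂ := Ring.mul_inverse_cancel _ h₂
    have c₃ := Ring.inverse_mul_cancel _ h₃
    have : ι (X s - X u) = ι (X s - X t) + ι (X t - X u) := by rw [← map_add]; congr 1; ring
    rw [this] at c₃ ⊢
    linear_combination (-Ring.inverse (ι (X s - X t)) * Ring.inverse (ι (X t - X u))) * c₃ +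
      Ring.inverse (ι (X s - X t) + ι (X t - X u)) * Ring.inverse (ι (X t - X u)) * c₁ +
      Ring.inverse (ι (X s - X t) + ι (X t - X u)) * Ring.inverse (ι (X s - X t)) * c₂
  have px := pf ux₁₂ ux₂₃ ux₁₃
  have py := pf uy₁₂ uy₂₃ uy₁₃
  have hinv : ∀ s t : σ, Ring.inverse (ι (X s) - ι (X t)) = -Ring.inverse (ι (X t) - ι (X s)) :=
    fun s t => by simpa only [map_sub] using inverse_map_sub_comm ι s t
  simp only [map_sub] at px py ⊢
  simp only [hinv x₃, hinv x₂ x₁, hinv y₃, hinv y₂ y₁, kd_comm a₃, kd_comm a₁, kd_comm a₂, quad]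
  generalize Ring.inverse (ι (X x₁) - ι (X x₂)) = u₁₂ at *
  generalize Ring.inverse (ι (X x₂) - ι (X x₃)) = u₂₃ at *
  generalize Ring.inverse (ι (X x₁) - ι (X x₃)) = u₁₃ at *
  generalize Ring.inverse (ι (X y₁) - ι (X y₂)) = v₁₂ at *
  generalize Ring.inverse (ι (X y₂) - ι (X y₃)) = v₂₃ at *
  generalize Ring.inverse (ι (X y₁) - ι (X y₃)) = v₁₃ at *
  simp only [mul_comm (ι _) (ι _)]
  -- Among the products of two poles, the mixed ones in x and y cancel directly; the pure ones carry
  -- these two products of Kronecker symbols.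
  linear_combination (-kd K g a₃ * kd K b₂ a₂ * kd K b₁ a₁) * px +
    (kd K g a₁ * kd K b₂ a₃ * kd K b₁ a₂) * py

end Entries

end IsCyclicOp

end

section

/-! ### Rings of formal functions and the tensor of a cyclic operation -/

section Rings

variable {σ R : Type*} [CommRing R]

/-- The coefficients may have zero divisors. Comparing coefficients, the one of `f` at an exponent
`e` equals the one with a factor `t` replaced by `s`, and it vanishes if there is no factor `t`;
induct on the exponent of `t`. -/
theorem eq_zero_of_sub_mul_eq_zero {s t : σ} (hst : s ≠ t) {f : MvPowerSeries σ R}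
    (h : (X s - X t) * f = 0) : f = 0 := by
  classical
  have key : ∀ (k : ℕ) (e : σ →₀ ℕ), e t = k → coeff e f = 0 := by
    intro k
    induction k with
    | zero =>
      intro e he
      have := congrArg (coeff (Finsupp.single s 1 + e)) h
      rw [sub_mul, map_sub, X, X, coeff_add_monomial_mul, coeff_monomial_mul, if_neg] at this
      · simpa using this
      · rw [Finsupp.single_le_iff]; simp [he, Finsupp.single_eq_of_ne hst.symm]
    | succ k ih =>
      intro e he
      have := congrArg (coeff (Finsupp.single s 1 + e)) h
      rw [sub_mul, map_sub, X, X, coeff_add_monomial_mul, coeff_monomial_mul, if_pos,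
        ih (Finsupp.single s 1 + e - Finsupp.single t 1)] at this
      · simpa using this
      · simp [he, Finsupp.single_eq_of_ne hst.symm]
      · rw [Finsupp.single_le_iff]; simp only [Finsupp.add_apply, he]; omega
  ext e
  exact key _ e rfl

theorem X_sub_X_mem_nonZeroDivisors {s t : σ} (hst : s ≠ t) :
    (X s - X t : MvPowerSeries σ R) ∈ nonZeroDivisors (MvPowerSeries σ R) :=
  mem_nonZeroDivisors_iff_left.2 fun _ h => eq_zero_of_sub_mul_eq_zero hst h

variable (R) in
theorem algebraMap_coef_injective (N : ℕ) :
    Function.Injective (algebraMap (PS R N) (Coef R N)) := by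
  refine IsLocalization.injective (M := Submonoid.powers (disc R N)) _ ?_
  rw [Submonoid.powers_le]
  refine prod_mem fun i _ => prod_mem fun j hj => mul_mem ?_ ?_ <;>
  · refine X_sub_X_mem_nonZeroDivisors fun h => ?_
    obtain rfl : j = i := (Prod.ext_iff.1 h).2
    simp at hj

theorem map_inverse_of_isUnit {K L : Type*} [CommRing K] [CommRing L] (f : K →+* L) {a : K}
    (h : IsUnit a) : f (Ring.inverse a) = Ring.inverse (f a) := by
  obtain ⟨u, rfl⟩ := h
  rw [Ring.inverse_unit]
  exact (Ring.inverse_unit (Units.map (f : K →* L) u)).symm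

variable {N : ℕ}

theorem substVar_algebraMap (i j k l : Fin N) (hij : i ≠ j) (hkl : k ≠ l) (p : PS R 2) :
    substVar R i j k l hij hkl (algebraMap (PS R 2) (Coef R 2) p) =
      algebraMap (PS R N) (Coef R N) (rename (renameVar i j k l) p) :=
  IsLocalization.Away.lift_eq _ _ _

theorem isUnit_algebraMap_X_sub (o : Obj) {i j : Fin N} (h : i ≠ j) :
    IsUnit (algebraMap (PS R N) (Coef R N) (X (o, j) - X (o, i))) := by
  cases o
  · exact isUnit_dx R h
  · exact isUnit_dy R h

end Rings

section Tensor

variable {R : Type*} [CommRing R] {n : ℕ}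

/-- The tensor attached to a cyclic operation. -/
def tensor (op : Ops R n) : Matrix (Fin n × Fin n) (Fin n × Fin n) (Coef R 2) :=
  Matrix.of fun I J => IsCyclicOp.entry Prod.fst op (algebraMap (PS R 2) (Coef R 2))
    (.Y, 1) (.X, 1) (.Y, 0) (.X, 0) J.1 I.2 J.2 I.1

open IsCyclicOp

/-- Generating series and poles are both natural under renaming of variables, so every substituted
tensor in the Yang–Baxter equation is again given by `entry`. -/
theorem at4_tensor (op : Ops R n) {N : ℕ} (i j k l : Fin N) (hij : i ≠ j) (hkl : k ≠ l)
    (I J : Fin n × Fin n) :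
    at4 (tensor op) i j k l hij hkl I J = entry Prod.fst op (algebraMap (PS R N) (Coef R N))
      (.Y, l) (.X, j) (.Y, k) (.X, i) J.1 I.2 J.2 I.1 := by
  have hq : ∀ a' b a g, rename (renameVar i j k l)
      (quad (R := R) Prod.fst op (.Y, 1) (.X, 1) (.Y, 0) (.X, 0) a' b a g) =
        quad Prod.fst op (.Y, l) (.X, j) (.Y, k) (.X, i) a' b a g := by
    intro a' b a g
    rw [quad, rename_genSeries (ob' := Prod.fst)]
    · rfl
    · rintro ⟨o, s⟩; cases o <;> rfl
  have hkd : ∀ a b : Fin n, substVar R i j k l hij hkl (kd (Coef R 2) a b) = kd (Coef R N) a b := by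
    intro a b; by_cases h : a = b <;> simp [kd, h]
  rw [at4, tensor, Matrix.map_apply, Matrix.of_apply, entry, entry]
  simp only [map_add, map_neg, map_mul, hkd, substVar_algebraMap, hq]
  rw [map_inverse_of_isUnit _ (isUnit_algebraMap_X_sub .X (by decide)),
    map_inverse_of_isUnit _ (isUnit_algebraMap_X_sub .Y (by decide)), substVar_algebraMap,
    substVar_algebraMap]
  simp [rename_X, renameVar]

theorem tensor_singular_part (op : Ops R n) :
    tensor op = (Matrix.of fun I J => -quad (R := R) Prod.fst op (.Y, 1) (.X, 1) (.Y, 0) (.X, 0)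
        J.1 I.2 J.2 I.1 : Matrix _ _ (PS R 2)).map (algebraMap (PS R 2) (Coef R 2))
      + Ring.inverse (dx R (N := 2) 0 1) •
        ((1 : Matrix (Fin n) (Fin n) (Coef R 2)) ⊗ₖ (1 : Matrix (Fin n) (Fin n) (Coef R 2)))
      + Ring.inverse (dy R (N := 2) 1 0) • flipMatrix (Coef R 2) n := by
  ext ⟨i₁, i₂⟩ ⟨j₁, j₂⟩
  simp only [tensor, Matrix.of_apply, entry, Matrix.add_apply, Matrix.map_apply,
    Matrix.smul_apply, Matrix.kroneckerMap_apply, flipMatrix, smul_eq_mul, map_neg, dx, dy, xvar,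
    yvar, kd, Matrix.one_apply, ite_and]
  split_ifs <;> simp

theorem tensor_skew {op : Ops R n} (h : IsCyclicOp op) :
    leg21 (tensor op) = -at4 (N := 2) (tensor op) 1 0 1 0 (by decide) (by decide) := by
  ext ⟨i₁, i₂⟩ ⟨j₁, j₂⟩
  rw [Matrix.neg_apply, at4_tensor, ← h.entry_skew]
  rfl

/-- An entry of the Yang–Baxter expression is the quintic relation in which x₁, x₂, x₃ and y₁, y₂,
y₃ of `entry_quintic` are numbered 0, 2, 1, with the matrix indices distributed accordingly. -/
theorem aybe_tensor_apply {op : Ops R n} (h : IsCyclicOp op) (i₁ i₂ i₃ j₁ j₂ j₃ : Fin n) :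
    (leg12 (at4 (N := 3) (tensor op) 1 0 1 2 (by decide) (by decide)) *
        leg13 (at4 (N := 3) (tensor op) 0 2 0 2 (by decide) (by decide))
      - leg23 (at4 (N := 3) (tensor op) 0 2 0 1 (by decide) (by decide)) *
        leg12 (at4 (N := 3) (tensor op) 1 2 1 2 (by decide) (by decide))
      + leg13 (at4 (N := 3) (tensor op) 1 2 0 2 (by decide) (by decide)) *
        leg23 (at4 (N := 3) (tensor op) 0 1 0 1 (by decide) (by decide)))
      (i₁, i₂, i₃) (j₁, j₂, j₃) =
    -algebraMap (PS R 3) (Coef R 3) (genSeries Prod.fst (.Y, 1) [(.theta j₂, (.X, 1)),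
      (.eta i₁, (.Y, 2)), (.theta j₁, (.X, 2)), (.eta i₃, (.Y, 0)), (.theta j₃, (.X, 0))]
        (derive op (fun w => op w (.theta i₂)))) := by
  have h₁₂ : ∀ (A B : Matrix (Fin n × Fin n) (Fin n × Fin n) (Coef R 3)),
      (leg12 A * leg13 B) (i₁, i₂, i₃) (j₁, j₂, j₃) =
        ∑ k, A (i₁, i₂) (k, j₂) * B (k, i₃) (j₁, j₃) := by
    intro A B
    simp only [Matrix.mul_apply, leg12, leg13, Matrix.of_apply, Fintype.sum_prod_type]
    simp
  have h₂₃ : ∀ (A B : Matrix (Fin n × Fin n) (Fin n × Fin n) (Coef R 3)),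
      (leg23 A * leg12 B) (i₁, i₂, i₃) (j₁, j₂, j₃) =
        ∑ k, A (i₂, i₃) (k, j₃) * B (i₁, k) (j₁, j₂) := by
    intro A B
    simp only [Matrix.mul_apply, leg12, leg23, Matrix.of_apply, Fintype.sum_prod_type]
    simp
  have h₁₃ : ∀ (A B : Matrix (Fin n × Fin n) (Fin n × Fin n) (Coef R 3)),
      (leg13 A * leg23 B) (i₁, i₂, i₃) (j₁, j₂, j₃) =
        ∑ k, A (i₁, i₃) (j₁, k) * B (i₂, k) (j₂, j₃) := by
    intro A B
    simp only [Matrix.mul_apply, leg13, leg23, Matrix.of_apply, Fintype.sum_prod_type]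
    simp
  rw [Matrix.add_apply, Matrix.sub_apply, h₁₂, h₂₃, h₁₃]
  rw [← h.entry_quintic (ob := Prod.fst) (algebraMap (PS R 3) (Coef R 3)) rfl rfl rfl rfl rfl rfl
    (isUnit_algebraMap_X_sub .X (by decide)) (isUnit_algebraMap_X_sub .X (by decide))
    (isUnit_algebraMap_X_sub .X (by decide)) (isUnit_algebraMap_X_sub .Y (by decide))
    (isUnit_algebraMap_X_sub .Y (by decide)) (isUnit_algebraMap_X_sub .Y (by decide))]
  simp only [at4_tensor]
  -- Two of the factors occur with both pairs of variables exchanged; skew-symmetry brings them to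
  -- the form in `entry_quintic`.
  have e₁ : ∀ k, entry Prod.fst op (algebraMap (PS R 3) (Coef R 3)) (.Y, 2) (.X, 0) (.Y, 1)
      (.X, 1) k i₂ j₂ i₁ = _ := fun k => h.entry_skew _ _ _ _ _ _ _ _ _
  have e₂ : ∀ k, entry Prod.fst op (algebraMap (PS R 3) (Coef R 3)) (.Y, 2) (.X, 2) (.Y, 1)
      (.X, 1) j₁ k j₂ i₁ = _ := fun k => h.entry_skew _ _ _ _ _ _ _ _ _
  simp only [e₁, e₂, neg_mul, mul_neg, Finset.sum_neg_distrib]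
  ring

/-- The structure demands the relation on composable words; on all others the grading gives it. -/
theorem CyclicAInf.insertion_eq_zero (m : CyclicAInf R n) (w : List (Gen n)) (c : Gen n) :
    insertion m.op m.op w c = 0 := by
  by_contra hne
  obtain ⟨hw, hp, _⟩ := (m.isCyclicOp.graded.insertion m.isCyclicOp.graded) _ _ hne
  exact hne (m.ainf w ((isPath_iff_composable hw).1 hp).1 c)

/-- The solution of the associative Yang–Baxter equation attached to a cyclic structure. -/
def CyclicAInf.solution (m : CyclicAInf R n) : FormalSolution R n where
  r := tensor m.op
  singular_part := ⟨_, tensor_singular_part m.op⟩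
  skew := tensor_skew m.isCyclicOp
  aybe := by
    ext ⟨i₁, i₂, i₃⟩ ⟨j₁, j₂, j₃⟩
    rw [aybe_tensor_apply m.isCyclicOp, genSeries_eq_zero]
    · simp
    · intro w _
      rw [← insertion_eq_derive, m.insertion_eq_zero]

end Tensor

end

section

open MvPowerSeries IsCyclicOp

/-! ### Massey products -/

section Massey

variable {R : Type*} [CommRing R] {n N : ℕ}

theorem insertXi_succ {d : ℕ} (o : Fin (d + 2) → Obj) (a : Fin (d + 1) → Gen n)
    (k : Fin (d + 2) → ℕ) : insertXi o a k = List.replicate (k 0) (.xi (o 0)) ++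
      a 0 :: insertXi (fun j => o j.succ) (fun j => a j.succ) (fun j => k j.succ) := by
  simp [insertXi, List.ofFn_succ]

theorem insertXi_eq_slotWord {σ : Type*} (ob : σ → Obj) {d : ℕ} (T : Fin (d + 1) → σ)
    (a : Fin d → Gen n) (e : σ → ℕ) : insertXi (fun j => ob (T j)) a (fun j => e (T j)) =
      slotWord ob (T 0) (List.ofFn fun j => (a j, T j.succ)) e := by
  induction d with
  | zero => simp [insertXi, slotWord]
  | succ d ih =>
    rw [insertXi_succ, ih (fun j => T j.succ), List.ofFn_succ, slotWord]

/-- Twisting by multiples of ξ inserts runs of ξ's between the inputs. For distinct twisted objects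
the monomial determines the lengths of these runs, so at most one term of the defining sum is
present. -/
theorem twistedOp_eq_genSeries (m : CyclicAInf R n) {d : ℕ} (T : Fin (d + 1) → Obj × Fin N)
    (hT : Function.Injective T) (a : Fin d → Gen n) (c : Gen n) :
    twistedOp m T a c =
      genSeries Prod.fst (T 0) (List.ofFn fun j => (a j, T j.succ)) (fun w => m.op w c) := by
  classical
  have hl : T 0 :: (List.ofFn fun j : Fin d => (a j, T j.succ)).map Prod.snd = List.ofFn T := by
    rw [List.ofFn_succ, List.map_ofFn]; rfl
  have hsum : ∀ (k : Fin (d + 1) → ℕ) j, (∑ i, Finsupp.single (T i) (k i)) (T j) = k j := by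
    intro k j
    rw [Finsupp.finsetSum_apply, Finset.sum_eq_single j]
    · simp
    · intro i _ hij
      exact Finsupp.single_eq_of_ne fun h => hij (hT h.symm)
    · simp
  ext e
  rw [coeff_genSeries (by rw [hl]; exact List.nodup_ofFn.2 hT), hl]
  change ∑ k ∈ _ with _, _ = _
  split_ifs with he
  · rw [Finset.sum_eq_single fun j => e (T j)]
    · rw [insertXi_eq_slotWord Prod.fst T a e]
    · intro k hk hne
      refine absurd (funext fun j => ?_) hne
      rw [← (Finset.mem_filter.1 hk).2, hsum]
    · intro h
      refine absurd (Finset.mem_filter.2 ⟨by simp [Fintype.mem_piFinset], ?_⟩) h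
      ext t
      by_cases ht : e t = 0
      · rw [ht, Finsupp.finsetSum_apply]
        refine Finset.sum_eq_zero fun j _ => ?_
        by_cases hj : T j = t
        · simp [hj, ht]
        · exact Finsupp.single_eq_of_ne (Ne.symm hj)
      · obtain ⟨j, rfl⟩ := (List.mem_ofFn' _ _).1 (he t ht)
        exact hsum _ _
  · refine Finset.sum_eq_zero fun k hk => absurd ?_ he
    intro t ht
    rw [← (Finset.mem_filter.1 hk).2, Finsupp.finsetSum_apply] at ht
    obtain ⟨j, _, hj⟩ := Finset.exists_ne_zero_of_sum_ne_zero ht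
    rw [List.mem_ofFn']
    refine ⟨j, by_contra fun h => hj (Finsupp.single_eq_of_ne (Ne.symm h))⟩

variable (m : CyclicAInf R n)

theorem twistedMul_one {S T : Obj × Fin N} (h : S ≠ T) (v : TwMor R n N) (c : Gen n) :
    twistedMul m ![S, T] ![v] c = ∑ a, v a * algebraMap (PS R N) (Coef R N)
      (genSeries Prod.fst S [(a, T)] (fun w => m.op w c)) := by
  have hT : Function.Injective ![S, T] := by
    intro i j; fin_cases i <;> fin_cases j <;> simp [h, h.symm]
  rw [twistedMul]
  refine Fintype.sum_equiv (Equiv.funUnique (Fin 1) (Gen n)) _ _ fun a => ?_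
  rw [twistedOp_eq_genSeries m _ hT]
  simp [List.ofFn_succ]

theorem twistedMul_two {S T U : Obj × Fin N} (h : S ≠ T) (h' : T ≠ U) (h'' : S ≠ U)
    (v w : TwMor R n N) (c : Gen n) :
    twistedMul m ![S, T, U] ![v, w] c = ∑ a, ∑ b, v a * w b * algebraMap (PS R N) (Coef R N)
      (genSeries Prod.fst S [(a, T), (b, U)] (fun w => m.op w c)) := by
  have hT : Function.Injective ![S, T, U] := by
    intro i j; fin_cases i <;> fin_cases j <;> simp [h, h.symm, h', h'.symm, h'', h''.symm]
  rw [twistedMul, ← Fintype.sum_prod_type']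
  refine Fintype.sum_equiv (finTwoArrowEquiv (Gen n)) _ _ fun a => ?_
  rw [twistedOp_eq_genSeries m _ hT]
  simp [List.ofFn_succ, Fin.prod_univ_two]

theorem twistedMul_basisMor {d : ℕ} (T : Fin (d + 1) → Obj × Fin N) (hT : Function.Injective T)
    (a : Fin d → Gen n) (c : Gen n) :
    twistedMul m T (fun j => basisMor (a j)) c = algebraMap (PS R N) (Coef R N)
      (genSeries Prod.fst (T 0) (List.ofFn fun j => (a j, T j.succ)) (fun w => m.op w c)) := by
  rw [twistedMul, Finset.sum_eq_single a, twistedOp_eq_genSeries m T hT]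
  · simp [basisMor]
  · intro b _ hb
    obtain ⟨j, hj⟩ := Function.ne_iff.1 hb
    rw [Finset.prod_eq_zero (Finset.mem_univ j), zero_mul]
    simp [basisMor, hj]
  · simp

/-- Strict unitality leaves only μ₂(id, ξ) and μ₂(ξ, id), of opposite signs. So the twisted
differential of an identity is the difference of the two variables times ξ, which becomes invertible
after localization. -/
theorem IsCyclicOp.genSeries_id {σ : Type*} {ob : σ → Obj} {op : Ops R n} (h : IsCyclicOp op)
    {s t : σ} {o : Obj} (hs : ob s = o) (ht : ob t = o) (c : Gen n) :
    genSeries ob s [(.one o, t)] (fun w => op w c) =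
      if c = .xi o then X s - X t else 0 := by
  have hl : ∀ w : List (Gen n), 3 ≤ w.length → Gen.one o ∈ w → op w c = 0 :=
    fun w => h.strictly_unital w o c
  have z₀ : slotSum t (fun j => C (σ := σ) (op (List.replicate 0 (.xi o) ++
      .one o :: List.replicate j (.xi o)) c)) = X t * C (op [.one o, .xi o] c) := by
    rw [slotSum_eq_add, slotSum_eq_first]
    · simp [h.minimal]
    · intro j
      rw [hl _ (by simp) (by simp), map_zero]
  have z₁ : slotSum t (fun j => C (σ := σ) (op (List.replicate (0 + 1) (.xi o) ++
      .one o :: List.replicate j (.xi o)) c)) = C (op [.xi o, .one o] c) := by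
    rw [slotSum_eq_first]
    · simp
    · intro j
      rw [hl _ (by simp) (by simp), map_zero]
  have z₂ : ∀ k, slotSum t (fun j => C (σ := σ) (op (List.replicate (k + 1 + 1) (.xi o) ++
      .one o :: List.replicate j (.xi o)) c)) = 0 := by
    intro k
    rw [← slotSum_zero t]
    congr 1
    funext j
    rw [hl _ (by simp; omega) (by simp), map_zero]
  simp only [genSeries, slotEval, hs, ht]
  rw [slotSum_eq_add, z₀, slotSum_eq_first z₂, z₁]
  have hsg : sgn R 1 = -1 := by simp [sgn]
  by_cases hc : c = .xi o <;> simp [hc, h.op_two, mu2, Gen.src, Gen.tgt, Gen.deg, hsg]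
  ring

theorem InHom.eq_single {S T : Obj × Fin N} {o : Obj} (hS : S.1 = o) (hT : T.1 = o)
    {v : TwMor R n N} (h : InHom 0 S T v) : v = Pi.single (.one o) (v (.one o)) := by
  funext a
  by_cases ha : a = .one o
  · subst ha; simp
  · rw [Pi.single_eq_of_ne ha]
    by_contra hv
    obtain ⟨h₁, h₂, h₃⟩ := h a hv
    rw [hS] at h₁
    rw [hT] at h₂
    cases o <;> cases a <;> simp_all [Gen.src, Gen.tgt, Gen.deg]

theorem InHom.eq_zero {S T : Obj × Fin N} {p : ℤ} (hp : p < 0)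
    {v : TwMor R n N} (h : InHom p S T v) : v = 0 := by
  funext a
  by_contra hv
  have := (h a hv).2.2
  rcases a.deg_eq with ha | ha <;> omega

/-- The Massey product of `θ_{a'}, η_b, θ_a`. -/
def masseyValue (a' b a : Fin n) : TwMor R n 2 := fun c =>
  algebraMap (PS R 2) (Coef R 2) (genSeries Prod.fst (.Y, 1)
    [(.theta a', (.X, 1)), (.eta b, (.Y, 0)), (.theta a, (.X, 0))] (fun w => m.op w c))
  + (if c = .theta a then kd _ a' b * Ring.inverse (dy R (N := 2) 0 1) else 0)
  - (if c = .theta a' then kd _ b a * Ring.inverse (dx R (N := 2) 0 1) else 0)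

/-- The two products of neighbouring morphisms are multiples of ξ, which are boundaries of unique
multiples of identities. Multiplying by these homotopies produces the polar terms, and there is no
indeterminacy because there are no morphisms of degree -1. -/
theorem masseyTheta_eq (a' b a : Fin n) :
    masseyTheta m a' b a = {masseyValue m a' b a} := by
  have h := m.isCyclicOp
  have eXY : ∀ i j : Fin 2, ((Obj.X, i) : Obj × Fin 2) ≠ (.Y, j) := by decide
  have eYX : ∀ i j : Fin 2, ((Obj.Y, i) : Obj × Fin 2) ≠ (.X, j) := by decide
  have e10 : ∀ o : Obj, ((o, 1) : Obj × Fin 2) ≠ (o, 0) := by decide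
  have c₁ : ∀ i j : Fin 2, ∀ k : Fin n,
      twistedMul m ![(.Y, i), (.X, j)] ![basisMor (.theta k)] = 0 := by
    intro i j k
    funext c
    rw [twistedMul_one m (eYX _ _)]
    simp [basisMor, Pi.single_apply, h.genSeries_theta (ob := Prod.fst (β := Fin 2))
      (y := (.Y, i)) (x := (.X, j)) rfl rfl]
  have c₂ : twistedMul m ![(.X, (1 : Fin 2)), (.Y, 0)] ![basisMor (.eta b)] = 0 := by
    funext c
    rw [twistedMul_one m (eXY _ _)]
    simp [basisMor, Pi.single_apply, h.genSeries_eta (ob := Prod.fst (β := Fin 2))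
      (y := (.Y, 0)) (x := (.X, 1)) rfl rfl]
  have p₁ : twistedMul m ![(.X, (1 : Fin 2)), (.Y, 0), (.X, 0)]
      ![basisMor (.eta b), basisMor (.theta a)] = Pi.single (.xi .X) (kd _ b a) := by
    funext c
    rw [twistedMul_two m (eXY _ _) (eYX _ _) (e10 _)]
    simp only [basisMor, Pi.single_apply, ite_mul, mul_ite, one_mul, mul_one, mul_zero, zero_mul,
      Finset.sum_ite_eq', Finset.mem_univ, if_true]
    rw [h.genSeries_eta_theta (ob := Prod.fst (β := Fin 2)) rfl rfl rfl]
    split_ifs <;> simp_all [kd]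
  have p₂ : twistedMul m ![(.Y, (1 : Fin 2)), (.X, 1), (.Y, 0)]
      ![basisMor (.theta a'), basisMor (.eta b)] = Pi.single (.xi .Y) (-kd _ a' b) := by
    funext c
    rw [twistedMul_two m (eYX _ _) (eXY _ _) (e10 _)]
    simp only [basisMor, Pi.single_apply, ite_mul, mul_ite, one_mul, mul_one, mul_zero, zero_mul,
      Finset.sum_ite_eq', Finset.mem_univ, if_true]
    rw [h.genSeries_theta_eta (ob := Prod.fst (β := Fin 2)) rfl rfl rfl]
    split_ifs <;> simp_all [kd]
  have p₃ : ∀ (o : Obj) (z : Coef R 2), twistedMul m ![(o, (1 : Fin 2)), (o, 0)]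
      ![Pi.single (.one o) z] = Pi.single (.xi o)
        (z * algebraMap (PS R 2) (Coef R 2) (X (o, 1) - X (o, 0))) := by
    intro o z
    funext c
    rw [twistedMul_one m (e10 _)]
    simp only [Pi.single_apply, ite_mul, zero_mul, Finset.sum_ite_eq', Finset.mem_univ, if_true]
    rw [h.genSeries_id (ob := Prod.fst (β := Fin 2)) (s := (o, 1)) (t := (o, 0)) rfl rfl]
    split_ifs <;> simp
  have p₄ : ∀ z : Coef R 2, twistedMul m ![(.Y, (1 : Fin 2)), (.Y, 0), (.X, 0)]
      ![Pi.single (.one .Y) z, basisMor (.theta a)] = fun c => if c = .theta a then z else 0 := by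
    intro z
    funext c
    rw [twistedMul_two m (e10 _) (eYX _ _) (eYX _ _)]
    simp only [basisMor, Pi.single_apply, ite_mul, mul_ite, mul_one, mul_zero, zero_mul,
      Finset.sum_ite_eq', Finset.mem_univ, if_true]
    rw [h.genSeries_one (o := .Y) rfl (by simp)]
    by_cases hc : c = .theta a <;> simp [hc, h.op_two, mu2, Gen.tgt, Gen.deg]
  have p₅ : ∀ z : Coef R 2, twistedMul m ![(.Y, (1 : Fin 2)), (.X, 1), (.X, 0)]
      ![basisMor (.theta a'), Pi.single (.one .X) z] =
        fun c => if c = .theta a' then z else 0 := by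
    intro z
    funext c
    rw [twistedMul_two m (eYX _ _) (e10 _) (eYX _ _)]
    simp only [basisMor, Pi.single_apply, ite_mul, mul_ite, one_mul, mul_zero, zero_mul,
      Finset.sum_ite_eq', Finset.mem_univ, if_true]
    rw [h.genSeries_one (o := .X) rfl (by simp)]
    by_cases hc : c = .theta a' <;> simp [hc, h.op_two, mu2, Gen.src]
  have p₆ : ∀ c, twistedMul m ![(.Y, (1 : Fin 2)), (.X, 1), (.Y, 0), (.X, 0)]
      ![basisMor (.theta a'), basisMor (.eta b), basisMor (.theta a)] c =
        algebraMap (PS R 2) (Coef R 2) (genSeries Prod.fst (.Y, 1)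
          [(.theta a', (.X, 1)), (.eta b, (.Y, 0)), (.theta a, (.X, 0))] (fun w => m.op w c)) := by
    intro c
    have := twistedMul_basisMor m ![(.Y, (1 : Fin 2)), (.X, 1), (.Y, 0), (.X, 0)] (by decide)
      ![.theta a', .eta b, .theta a] c
    simp only [List.ofFn_succ, List.ofFn_zero] at this
    refine Eq.trans (congrFun (congrArg _ ?_) c) this
    funext j
    fin_cases j <;> rfl
  have p₇ : twistedMul m ![(.Y, (1 : Fin 2)), (.X, 0)] ![0] = 0 := by
    funext c
    rw [twistedMul_one m (eYX _ _)]
    simp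
  have ux := isUnit_dx R (N := 2) (i := 0) (j := 1) (by decide)
  have uy := isUnit_dy R (N := 2) (i := 0) (j := 1) (by decide)
  ext v
  rw [Set.mem_singleton_iff, masseyTheta, masseyProduct, Set.mem_ofPred_eq]
  constructor
  · rintro ⟨_, h₁, h₂, w, i₁, i₂, iw, e₁, e₂, rfl⟩
    -- Morphisms of degree 0 between twists of one object are multiples of the identity.
    rw [InHom.eq_single rfl rfl i₁, p₁, p₃] at e₁
    rw [InHom.eq_single rfl rfl i₂, p₂, p₃] at e₂
    have e₁ := congrFun e₁ (.xi .X)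
    have e₂ := congrFun e₂ (.xi .Y)
    rw [Pi.single_eq_same, Pi.single_eq_same] at e₁ e₂
    have f₁ : h₁ (.one .X) = kd _ b a * Ring.inverse (dx R (N := 2) 0 1) := by
      rw [← e₁, mul_assoc]
      exact ((congrArg _ (Ring.mul_inverse_cancel _ ux)).trans (mul_one _)).symm
    have f₂ : h₂ (.one .Y) = -kd _ a' b * Ring.inverse (dy R (N := 2) 0 1) := by
      rw [← e₂, mul_assoc]
      exact ((congrArg _ (Ring.mul_inverse_cancel _ uy)).trans (mul_one _)).symm
    rw [InHom.eq_single rfl rfl i₁, InHom.eq_single rfl rfl i₂, InHom.eq_zero (by norm_num) iw,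
      p₄, p₅, p₇, f₁, f₂]
    funext c
    simp only [Pi.add_apply, Pi.sub_apply, Pi.zero_apply, p₆, masseyValue]
    split_ifs <;> ring
  · rintro rfl
    refine ⟨⟨c₁ _ _ _, c₂, c₁ _ _ _⟩,
      Pi.single (.one .X) (kd _ b a * Ring.inverse (dx R (N := 2) 0 1)),
      Pi.single (.one .Y) (-kd _ a' b * Ring.inverse (dy R (N := 2) 0 1)), 0, ?_, ?_, ?_, ?_, ?_, ?_⟩
    · intro c hc
      obtain rfl : c = .one .X := by_contra fun h => hc (Pi.single_eq_of_ne h _)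
      exact ⟨rfl, rfl, rfl⟩
    · intro c hc
      obtain rfl : c = .one .Y := by_contra fun h => hc (Pi.single_eq_of_ne h _)
      exact ⟨rfl, rfl, rfl⟩
    · intro c hc
      exact absurd rfl hc
    · rw [p₁, p₃]
      congr 1
      rw [mul_assoc]
      exact (congrArg _ (Ring.inverse_mul_cancel _ ux)).trans (mul_one _)
    · rw [p₂, p₃]
      congr 1
      rw [mul_assoc]
      exact (congrArg _ (Ring.inverse_mul_cancel _ uy)).trans (mul_one _)
    · rw [p₄, p₅, p₇]
      funext c
      simp only [Pi.add_apply, Pi.sub_apply, Pi.zero_apply, p₆, masseyValue]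
      split_ifs <;> ring

/-- Pairing with `η_g` extracts minus the coefficient of `θ_g`, whence the sign of `quad` in
`entry`. -/
theorem CyclicAInf.isMasseyTensor_solution : IsMasseyTensor m m.solution.r := by
  intro a' b a
  refine ⟨_, masseyTheta_eq m a' b a, fun g => ?_⟩
  have hp : ∀ c : Gen n, pairing (Coef R 2) c (.eta g) = if c = .theta g then -1 else 0 := by
    intro c; cases c <;> simp [pairing]
  have hy : Ring.inverse (dy R (N := 2) 0 1) = -Ring.inverse (algebraMap (PS R 2) (Coef R 2)
      (X (.Y, 0) - X (.Y, 1))) := inverse_map_sub_comm _ _ _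
  simp only [hp, mul_ite, mul_zero, Finset.sum_ite_eq', Finset.mem_univ, if_true]
  change entry Prod.fst m.op _ _ _ _ _ _ _ _ _ = _
  simp only [entry, quad, masseyValue, hy, Gen.theta.injEq, dx, xvar, kd_comm a' b]
  simp only [kd]
  split_ifs <;> simp <;> ring

end Massey

end

section

open MvPowerSeries IsCyclicOp

/-! ### Words as sequences of letters separated by powers of `ξ` -/

section Parse

variable {n : ℕ}

/-- The decomposition `ξ^k a_1 ξ^{k_1} ⋯ a_d ξ^{k_d}` of a word, without the objects of the
`ξ`'s. -/
def parse : List (Gen n) → ℕ × List (Gen n × ℕ)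
  | [] => (0, [])
  | .xi _ :: w => ((parse w).1 + 1, (parse w).2)
  | .one o :: w => (0, (.one o, (parse w).1) :: (parse w).2)
  | .theta i :: w => (0, (.theta i, (parse w).1) :: (parse w).2)
  | .eta i :: w => (0, (.eta i, (parse w).1) :: (parse w).2)

theorem parse_cons {a : Gen n} (ha : ∀ o, a ≠ .xi o) (w : List (Gen n)) :
    parse (a :: w) = (0, (a, (parse w).1) :: (parse w).2) := by
  cases a <;> simp_all [parse]

theorem parse_replicate_append (k : ℕ) (o : Obj) (w : List (Gen n)) :
    parse (List.replicate k (.xi o) ++ w) = ((parse w).1 + k, (parse w).2) := by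
  induction k with
  | zero => simp
  | succ k ih => rw [List.replicate_succ, List.cons_append, parse, ih]; rfl

theorem parse_append_singleton {a : Gen n} (ha : ∀ o, a ≠ .xi o) (w : List (Gen n)) :
    parse (w ++ [a]) = ((parse w).1, (parse w).2 ++ [(a, 0)]) := by
  induction w with
  | nil => rw [List.nil_append, parse_cons ha]; rfl
  | cons b w ih => cases b <;> simp [parse, ih]

/-- Increase the last exponent of a list. -/
def bumpList : List (Gen n × ℕ) → List (Gen n × ℕ)
  | [] => []
  | [(a, j)] => [(a, j + 1)]
  | x :: y :: l => x :: bumpList (y :: l)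

/-- Increase the last exponent. -/
def bumpLast : ℕ × List (Gen n × ℕ) → ℕ × List (Gen n × ℕ)
  | (k, []) => (k + 1, [])
  | (k, x :: l) => (k, bumpList (x :: l))

theorem parse_append_xi (w : List (Gen n)) (o : Obj) :
    parse (w ++ [.xi o]) = bumpLast (parse w) := by
  have h₁ : ∀ (k : ℕ) (l : List (Gen n × ℕ)), bumpLast (k + 1, l) =
      ((bumpLast (k, l)).1 + 1, (bumpLast (k, l)).2) := by
    intro k l
    rcases l with _ | ⟨⟨a, j⟩, _ | ⟨y, l⟩⟩ <;> rfl
  have h₂ : ∀ (a : Gen n) (k : ℕ) (l : List (Gen n × ℕ)), bumpLast (0, (a, k) :: l) =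
      (0, (a, (bumpLast (k, l)).1) :: (bumpLast (k, l)).2) := by
    intro a k l
    rcases l with _ | ⟨⟨a, j⟩, _ | ⟨y, l⟩⟩ <;> rfl
  induction w with
  | nil => rfl
  | cons b w ih => cases b <;> simp [parse, ih, h₁, h₂]

theorem redDeg_parse (w : List (Gen n)) : redDeg ((parse w).2.map Prod.fst) = redDeg w := by
  induction w with
  | nil => rfl
  | cons b w ih => cases b <;> simp [parse, ih, Gen.deg]

theorem mem_parse {w : List (Gen n)} {a : Gen n} (ha : a ∈ w) (hxi : ∀ o, a ≠ .xi o) :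
    a ∈ (parse w).2.map Prod.fst := by
  induction w with
  | nil => simp at ha
  | cons b w ih =>
    rcases List.mem_cons.1 ha with rfl | h
    · rw [parse_cons hxi]; simp
    · have := ih h
      cases b <;> simp_all [parse]

end Parse

/-! ### Normal forms of paths from `X` to `Y` without identities. -/

section Paths

variable {n : ℕ}

theorem redDeg_nonpos (w : List (Gen n)) : redDeg w ≤ 0 := by
  induction w with
  | nil => simp
  | cons a w ih => rw [redDeg_cons]; rcases a.deg_eq with h | h <;> omega

/-- One isolates the first letter that is not a ξ; the ξ's before it all belong to the end object of
the path. -/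
theorem IsPath.split {o o' : Obj} {w : List (Gen n)} (hw : IsPath o o' w)
    (h1 : ∀ o, Gen.one o ∉ w) : (∃ k, w = List.replicate k (.xi o) ∧ o = o') ∨
      ∃ k a w', w = List.replicate k (.xi o) ++ a :: w' ∧ (∀ o, a ≠ .xi o) ∧ (∀ o, a ≠ .one o) ∧
        a.tgt = o ∧ IsPath a.src o' w' ∧ (∀ o, Gen.one o ∉ w') := by
  induction w generalizing o with
  | nil => exact .inl ⟨0, rfl, hw⟩
  | cons a w ih =>
    have h1' : ∀ o, Gen.one o ∉ w := fun o ho => h1 o (List.mem_cons_of_mem _ ho)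
    by_cases ha : ∃ p, a = .xi p
    · obtain ⟨p, rfl⟩ := ha
      obtain rfl : p = o := hw.1
      rcases ih hw.2 h1' with ⟨k, rfl, rfl⟩ | ⟨k, b, w', rfl, h⟩
      · exact .inl ⟨k + 1, rfl, rfl⟩
      · exact .inr ⟨k + 1, b, w', rfl, h⟩
    · exact .inr ⟨0, a, w, rfl, fun o h => ha ⟨o, h⟩, fun o h => h1 o (by simp [h]), hw.1, hw.2, h1'⟩

theorem IsPath.split_theta {w : List (Gen n)} (hw : IsPath .Y .X w) (h1 : ∀ o, Gen.one o ∉ w) :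
    ∃ k i w', w = List.replicate k (.xi .Y) ++ .theta i :: w' ∧ IsPath .X .X w' ∧
      (∀ o, Gen.one o ∉ w') ∧ redDeg w' = redDeg w + 1 := by
  rcases hw.split h1 with ⟨k, -, h⟩ | ⟨k, a, w', rfl, h₁, h₂, h₃, h₄, h₅⟩
  · cases h
  · cases a with
    | one o => exact absurd rfl (h₂ o)
    | xi o => exact absurd rfl (h₁ o)
    | eta i => cases h₃
    | theta i => exact ⟨k, i, w', rfl, h₄, h₅, by simp [redDeg_replicate_xi, Gen.deg]⟩

theorem IsPath.split_eta {w : List (Gen n)} (hw : IsPath .X .X w) (h1 : ∀ o, Gen.one o ∉ w) :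
    (∃ k, w = List.replicate k (.xi .X) ∧ redDeg w = 0) ∨
    ∃ k i w', w = List.replicate k (.xi .X) ++ .eta i :: w' ∧ IsPath .Y .X w' ∧
      (∀ o, Gen.one o ∉ w') ∧ redDeg w' = redDeg w := by
  rcases hw.split h1 with ⟨k, rfl, h⟩ | ⟨k, a, w', rfl, h₁, h₂, h₃, h₄, h₅⟩
  · exact .inl ⟨k, rfl, redDeg_replicate_xi _ _⟩
  · cases a with
    | one o => exact absurd rfl (h₂ o)
    | xi o => exact absurd rfl (h₁ o)
    | theta i => cases h₃
    | eta i => exact .inr ⟨k, i, w', rfl, h₄, h₅, by simp [redDeg_replicate_xi, Gen.deg]⟩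

/-- Without identities, minus the reduced degree counts the θ's. Since θ and η alternate, it fixes
the shape of the path; likewise for the two longer shapes below. -/
theorem IsPath.exists_one {w : List (Gen n)} (hw : IsPath .Y .X w) (h1 : ∀ o, Gen.one o ∉ w)
    (hd : redDeg w = -1) : ∃ k₁ i₁ k₀, w = List.replicate k₁ (.xi .Y) ++ .theta i₁ ::
      List.replicate k₀ (.xi .X) := by
  obtain ⟨k₁, i₁, w', rfl, h₁, h₂, h₃⟩ := hw.split_theta h1
  rcases h₁.split_eta h₂ with ⟨k₀, rfl, -⟩ | ⟨k₀, j, w'', rfl, h₄, h₅, h₆⟩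
  · exact ⟨k₁, i₁, k₀, rfl⟩
  · obtain ⟨_, _, w''', -, -, -, h₇⟩ := h₄.split_theta h₅
    have := redDeg_nonpos w'''
    omega

theorem IsPath.exists_two {w : List (Gen n)} (hw : IsPath .Y .X w) (h1 : ∀ o, Gen.one o ∉ w)
    (hd : redDeg w = -2) : ∃ k₃ i₂ k₂ j₁ k₁ i₁ k₀, w = List.replicate k₃ (.xi .Y) ++ .theta i₂ ::
      (List.replicate k₂ (.xi .X) ++ .eta j₁ :: (List.replicate k₁ (.xi .Y) ++ .theta i₁ ::
      List.replicate k₀ (.xi .X))) := by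
  obtain ⟨k₃, i₂, w', rfl, h₁, h₂, h₃⟩ := hw.split_theta h1
  rcases h₁.split_eta h₂ with ⟨k₂, rfl, h₄⟩ | ⟨k₂, j₁, w'', rfl, h₄, h₅, h₆⟩
  · omega
  · obtain ⟨k₁, i₁, k₀, rfl⟩ := h₄.exists_one h₅ (by omega)
    exact ⟨k₃, i₂, k₂, j₁, k₁, i₁, k₀, rfl⟩

theorem IsPath.exists_three {w : List (Gen n)} (hw : IsPath .Y .X w) (h1 : ∀ o, Gen.one o ∉ w)
    (hd : redDeg w = -3) : ∃ k₅ i₃ k₄ j₂ k₃ i₂ k₂ j₁ k₁ i₁ k₀,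
      w = List.replicate k₅ (.xi .Y) ++ .theta i₃ :: (List.replicate k₄ (.xi .X) ++ .eta j₂ ::
      (List.replicate k₃ (.xi .Y) ++ .theta i₂ ::
      (List.replicate k₂ (.xi .X) ++ .eta j₁ :: (List.replicate k₁ (.xi .Y) ++ .theta i₁ ::
      List.replicate k₀ (.xi .X))))) := by
  obtain ⟨k₅, i₃, w', rfl, h₁, h₂, h₃⟩ := hw.split_theta h1
  rcases h₁.split_eta h₂ with ⟨k₂, rfl, h₄⟩ | ⟨k₄, j₂, w'', rfl, h₄, h₅, h₆⟩
  · omega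
  · obtain ⟨k₃, i₂, k₂, j₁, k₁, i₁, k₀, rfl⟩ := h₄.exists_two h₅ (by omega)
    exact ⟨k₅, i₃, k₄, j₂, k₃, i₂, k₂, j₁, k₁, i₁, k₀, rfl⟩

end Paths

/-! ### The cyclic operation with a given generating series -/

section Potential

variable {R : Type*} [CommRing R] {n : ℕ}

/-- The values of a cyclic potential on cyclic words with four letters. -/
def potLetters (q : Fin n → Fin n → Fin n → Fin n → ℕ → ℕ → ℕ → ℕ → R) :
    Gen n → Gen n → Gen n → Gen n → ℕ → ℕ → ℕ → ℕ → R
  | .theta a, .eta b, .theta c, .eta d, k₁, k₂, k₃, k₄ => q a b c d k₁ k₂ k₃ k₄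
  | .eta d, .theta a, .eta b, .theta c, k₁, k₂, k₃, k₄ => q a b c d k₂ k₃ k₄ k₁
  | _, _, _, _, _, _, _, _ => 0

/-- The value of a cyclic potential on a parsed word. -/
def potParsed (q : Fin n → Fin n → Fin n → Fin n → ℕ → ℕ → ℕ → ℕ → R) :
    ℕ × List (Gen n × ℕ) → R
  | (k, [(a₁, k₁), (a₂, k₂), (a₃, k₃), (a₄, k₄)]) => potLetters q a₁ a₂ a₃ a₄ k₁ k₂ k₃ (k₄ + k)
  | _ => 0

open Classical in
/-- A cyclic potential with quadratic part in `θ`. -/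
def potential (q : Fin n → Fin n → Fin n → Fin n → ℕ → ℕ → ℕ → ℕ → R) (w : List (Gen n)) : R :=
  if ∃ o, IsPath o o w then potParsed q (parse w) else 0

variable {q : Fin n → Fin n → Fin n → Fin n → ℕ → ℕ → ℕ → ℕ → R}

theorem potLetters_rotate
    (hq : ∀ a b c d k₁ k₂ k₃ k₄, q a b c d k₁ k₂ k₃ k₄ = -q c d a b k₃ k₄ k₁ k₂)
    (a b c d : Gen n) (k₁ k₂ k₃ k₄ : ℕ) : potLetters q a b c d k₁ k₂ k₃ k₄ =
      sgn R ((a.deg - 1) * redDeg [b, c, d]) * potLetters q b c d a k₂ k₃ k₄ k₁ := by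
  have hs : sgn R 1 = -1 := by simp [sgn]
  cases a <;> cases b <;> try (simp [potLetters]; done)
  all_goals cases c <;> try (simp [potLetters]; done)
  all_goals cases d <;> try (simp [potLetters]; done)
  · simp only [potLetters, redDeg_cons, redDeg_nil, Gen.deg]
    rw [hq]
    norm_num [hs]
  · simp [potLetters, Gen.deg]

/-- In a cyclic word a ξ at the front and a ξ at the end belong to the same run, which is why the
two exponents are added in `potParsed`. -/
theorem potParsed_bumpLast (k : ℕ) (l : List (Gen n × ℕ)) :
    potParsed q (k + 1, l) = potParsed q (bumpLast (k, l)) := by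
  rcases l with _ | ⟨a₁, _ | ⟨a₂, _ | ⟨a₃, _ | ⟨a₄, _ | ⟨a₅, l⟩⟩⟩⟩⟩
  · rfl
  · rfl
  · rfl
  · rfl
  · simp only [bumpLast, bumpList, potParsed]
    rw [Nat.add_right_comm, Nat.add_assoc]
  · cases l <;> rfl

theorem potParsed_rotate
    (hq : ∀ a b c d k₁ k₂ k₃ k₄, q a b c d k₁ k₂ k₃ k₄ = -q c d a b k₃ k₄ k₁ k₂)
    (a : Gen n) (k : ℕ) (l : List (Gen n × ℕ)) : potParsed q (0, (a, k) :: l) =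
      sgn R ((a.deg - 1) * redDeg (l.map Prod.fst)) * potParsed q (k, l ++ [(a, 0)]) := by
  rcases l with _ | ⟨⟨a₁, k₁⟩, _ | ⟨⟨a₂, k₂⟩, _ | ⟨⟨a₃, k₃⟩, _ | ⟨⟨a₄, k₄⟩, l⟩⟩⟩⟩
  · simp [potParsed]
  · simp [potParsed]
  · simp [potParsed]
  · simp only [List.cons_append, List.nil_append, potParsed]
    rw [potLetters_rotate hq]
    simp
  · have h₁ : potParsed q (0, (a, k) :: (a₁, k₁) :: (a₂, k₂) :: (a₃, k₃) :: (a₄, k₄) :: l) = 0 := rfl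
    have h₂ : potParsed q (k, ((a₁, k₁) :: (a₂, k₂) :: (a₃, k₃) :: (a₄, k₄) :: l) ++ [(a, 0)]) = 0 := by
      cases l <;> rfl
    rw [h₁, h₂, mul_zero]

/-- Rotating a ξ only moves it from one end of a run to the other. Rotating another letter permutes
the four letters cyclically, and the skew-symmetry of `q` is the invariance under rotation by two.
-/
theorem potential_rotate
    (hq : ∀ a b c d k₁ k₂ k₃ k₄, q a b c d k₁ k₂ k₃ k₄ = -q c d a b k₃ k₄ k₁ k₂)
    (a : Gen n) (w : List (Gen n)) :
    potential q (a :: w) = sgn R ((a.deg - 1) * redDeg w) * potential q (w ++ [a]) := by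
  have hp : (∃ o, IsPath o o (a :: w)) ↔ ∃ o, IsPath o o (w ++ [a]) := by
    constructor
    · rintro ⟨o, rfl, h⟩
      exact ⟨a.src, isPath_append.2 ⟨_, h, rfl, rfl⟩⟩
    · rintro ⟨o, h⟩
      obtain ⟨p, h, rfl, h'⟩ := isPath_append.1 h
      obtain rfl : a.src = o := h'
      exact ⟨a.tgt, rfl, h⟩
  rw [potential, potential]
  by_cases h : ∃ o, IsPath o o (a :: w)
  · rw [if_pos h, if_pos (hp.1 h)]
    by_cases ha : ∃ o, a = .xi o
    · obtain ⟨o, rfl⟩ := ha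
      rw [parse_append_xi, parse, potParsed_bumpLast]
      simp [Gen.deg]
    · push Not at ha
      rw [parse_cons ha, parse_append_singleton ha, potParsed_rotate hq, redDeg_parse]
  · rw [if_neg h, if_neg (fun h' => h (hp.2 h')), mul_zero]

theorem potLetters_ne_zero {a b c d : Gen n} {k₁ k₂ k₃ k₄ : ℕ}
    (h : potLetters q a b c d k₁ k₂ k₃ k₄ ≠ 0) :
    redDeg [a, b, c, d] = -2 ∧ ∀ o, Gen.one o ∉ [a, b, c, d] := by
  cases a <;> cases b <;> try (exact absurd rfl h)
  all_goals cases c <;> try (exact absurd rfl h)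
  all_goals cases d <;> try (exact absurd rfl h)
  all_goals simp [Gen.deg]

theorem potential_ne_zero {w : List (Gen n)} (h : potential q w ≠ 0) :
    (∃ o, IsPath o o w) ∧ redDeg w = -2 ∧ ∀ o, Gen.one o ∉ w := by
  rw [potential] at h
  have hp : ∃ o, IsPath o o w := by_contra fun hp => h (if_neg hp)
  rw [if_pos hp] at h
  refine ⟨hp, ?_⟩
  have : redDeg ((parse w).2.map Prod.fst) = -2 ∧
      ∀ o, Gen.one o ∉ (parse w).2.map Prod.fst := by
    generalize parse w = p at h
    obtain ⟨k, l⟩ := p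
    rcases l with _ | ⟨⟨a₁, k₁⟩, _ | ⟨⟨a₂, k₂⟩, _ | ⟨⟨a₃, k₃⟩, _ | ⟨⟨a₄, k₄⟩, _ | ⟨⟨a₅, k₅⟩, l⟩⟩⟩⟩⟩ <;>
      try (exact absurd rfl h)
    exact potLetters_ne_zero h
  rw [redDeg_parse] at this
  exact ⟨this.1, fun o ho => this.2 o (mem_parse ho (by simp))⟩

/-- The operation with cyclic potential `potential q` and the prescribed product. -/
def potOp (q : Fin n → Fin n → Fin n → Fin n → ℕ → ℕ → ℕ → ℕ → R) : Ops R n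
  | [], _ => 0
  | [_], _ => 0
  | [a, b], c => mu2 R a b c
  | w, c => psign R c.dual * potential q (c.dual :: w)

theorem potOp_of_length {w : List (Gen n)} (hw : 3 ≤ w.length) (c : Gen n) :
    potOp q w c = psign R c.dual * potential q (c.dual :: w) := by
  rcases w with _ | ⟨a, _ | ⟨b, _ | ⟨d, w⟩⟩⟩
  · simp at hw
  · simp at hw
  · simp at hw
  · rfl

theorem mu2_ne_zero {a b c : Gen n} (h : mu2 R a b c ≠ 0) :
    a.src = b.tgt ∧ a.tgt = c.tgt ∧ b.src = c.src ∧ c.deg = a.deg + b.deg := by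
  cases a <;> cases b <;> simp [mu2, Gen.src, Gen.tgt, Gen.deg] at h ⊢ <;> aesop

theorem mu2_rotate (a b c : Gen n) : psign R a * mu2 R b c a.dual =
    sgn R ((a.deg - 1) * redDeg [b, c]) * (psign R b * mu2 R c a b.dual) := by
  have hs : sgn R 1 = -1 := by simp [sgn]
  have hs' : sgn R (-1) = -1 := by simp [sgn]
  cases a <;> cases b <;> cases c <;>
    simp [mu2, Gen.dual, psign, Gen.deg, Gen.src, Gen.tgt, hs] <;> grind

/-- For k ≥ 3 the pairing of `a` with the product of `w` is the potential of the cyclic word `a, w`;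
so cyclicity is rotation invariance, and unitality holds because the potential avoids identities.
The prescribed μ₂ is checked case by case. -/
theorem isCyclicOp_potOp
    (hq : ∀ a b c d k₁ k₂ k₃ k₄, q a b c d k₁ k₂ k₃ k₄ = -q c d a b k₃ k₄ k₁ k₂) :
    IsCyclicOp (potOp q) where
  graded := by
    intro w c h
    by_cases hw : 3 ≤ w.length
    · rw [potOp_of_length hw] at h
      obtain ⟨⟨o, h₁, h₂⟩, h₃, -⟩ := potential_ne_zero (right_ne_zero_of_mul h)
      rw [Gen.dual_tgt] at h₁
      rw [Gen.dual_src, ← h₁] at h₂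
      rw [redDeg_cons, Gen.dual_deg] at h₃
      exact ⟨by rintro rfl; simp at hw, h₂, by omega⟩
    · rcases w with _ | ⟨a, _ | ⟨b, _ | ⟨d, w⟩⟩⟩
      · exact absurd rfl h
      · exact absurd rfl h
      · obtain ⟨h₁, h₂, h₃, h₄⟩ := mu2_ne_zero (show mu2 R a b c ≠ 0 from h)
        exact ⟨by simp, ⟨h₂, h₁.symm, h₃⟩, by simp [h₄]; ring⟩
      · simp at hw
  minimal a c := rfl
  op_two a b c := rfl
  strictly_unital w o c hw ho := by
    rw [potOp_of_length hw]
    by_contra h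
    exact (potential_ne_zero (right_ne_zero_of_mul h)).2.2 o (List.mem_cons_of_mem _ ho)
  cyclic a b w := by
    simp only [sum_pairing]
    rcases w with _ | ⟨c, _ | ⟨d, w⟩⟩
    · simp [potOp]
    · exact mu2_rotate a b c
    · rw [potOp_of_length (by simp), potOp_of_length (by simp), Gen.dual_dual, Gen.dual_dual,
        ← mul_assoc, ← mul_assoc (psign R b), psign_mul_self, psign_mul_self, one_mul, one_mul,
        potential_rotate hq]
      rfl

theorem potOp_theta (k₃ k₂ k₁ k₀ : ℕ) (a' b a g : Fin n) :
    potOp q (List.replicate k₃ (.xi .Y) ++ .theta a' :: (List.replicate k₂ (.xi .X) ++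
      .eta b :: (List.replicate k₁ (.xi .Y) ++ .theta a :: List.replicate k₀ (.xi .X))))
      (.theta g) = q a' b a g k₂ k₁ k₀ k₃ := by
  rw [potOp_of_length (by simp; omega), potential, if_pos]
  · have : parse (List.replicate k₀ (.xi .X) : List (Gen n)) = (k₀, []) := by
      simpa [parse] using parse_replicate_append k₀ .X ([] : List (Gen n))
    simp [Gen.dual, parse, parse_replicate_append, this, potParsed, potLetters, psign, Gen.deg]
  · refine ⟨.X, rfl, ?_⟩
    refine isPath_replicate_append _ ⟨rfl, isPath_replicate_append _ ⟨rfl,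
      isPath_replicate_append _ ⟨rfl, ?_⟩⟩⟩
    change IsPath .X .X _
    simpa using isPath_replicate_append (n := n) k₀ (show IsPath .X .X [] from rfl)

end Potential

end

section

open MvPowerSeries IsCyclicOp

/-! ### Every solution comes from a cyclic structure -/

section Surjective

variable {R : Type*} [CommRing R] {n : ℕ}

/-- The exponent with given values at `x_2, y_1, x_1, y_2`. -/
def quadExp (k₁ k₂ k₃ k₄ : ℕ) : Obj × Fin 2 →₀ ℕ :=
  Finsupp.equivFunOnFinite.symm fun s =>
    if s = (.X, 1) then k₁ else if s = (.Y, 0) then k₂ else if s = (.X, 0) then k₃ else k₄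

theorem eq_quadExp (e : Obj × Fin 2 →₀ ℕ) :
    e = quadExp (e (.X, 1)) (e (.Y, 0)) (e (.X, 0)) (e (.Y, 1)) := by
  ext ⟨o, i⟩
  cases o <;> fin_cases i <;> simp [quadExp]

theorem mapDomain_quadExp (k₁ k₂ k₃ k₄ : ℕ) :
    (quadExp k₁ k₂ k₃ k₄).mapDomain (renameVar 1 0 1 0) = quadExp k₃ k₄ k₁ k₂ := by
  have hinj : Function.Injective (renameVar (N := 2) 1 0 1 0) := by decide
  ext ⟨o, i⟩
  cases o <;> fin_cases i
  · exact (Finsupp.mapDomain_apply hinj _ (Obj.X, 1)).trans (by simp [quadExp])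
  · exact (Finsupp.mapDomain_apply hinj _ (Obj.X, 0)).trans (by simp [quadExp])
  · exact (Finsupp.mapDomain_apply hinj _ (Obj.Y, 1)).trans (by simp [quadExp])
  · exact (Finsupp.mapDomain_apply hinj _ (Obj.Y, 0)).trans (by simp [quadExp])

theorem coeff_rename_quadExp (p : PS R 2) (k₁ k₂ k₃ k₄ : ℕ) :
    coeff (quadExp k₁ k₂ k₃ k₄) (rename (renameVar 1 0 1 0) p) =
      coeff (quadExp k₃ k₄ k₁ k₂) p := by
  classical
  have hinj : Function.Injective (renameVar (N := 2) 1 0 1 0) := by decide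
  rw [coeff_rename, Finset.sum_eq_single (quadExp k₃ k₄ k₁ k₂)]
  · intro d hd hne
    refine absurd (Finsupp.mapDomain_injective hinj ?_) hne
    rw [mapDomain_quadExp]
    simpa using hd
  · intro h
    refine absurd ?_ h
    simp [mapDomain_quadExp]

theorem quad_potOp (q : Fin n → Fin n → Fin n → Fin n → ℕ → ℕ → ℕ → ℕ → R) (a' b a g : Fin n)
    (k₁ k₂ k₃ k₄ : ℕ) : coeff (quadExp k₁ k₂ k₃ k₄)
      (quad Prod.fst (potOp q) (.Y, (1 : Fin 2)) (.X, 1) (.Y, 0) (.X, 0) a' b a g) =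
      q a' b a g k₁ k₂ k₃ k₄ := by
  rw [quad, coeff_genSeries_of_cover (by simp) (by simp; decide)]
  simpa [quadExp, slotWord] using potOp_theta (q := q) k₄ k₁ k₂ k₃ a' b a g

/-- The polar part is skew by itself, and power series embed in the localization, so the regular
part is skew coefficientwise. -/
theorem FormalSolution.skew_regular (s : FormalSolution R n)
    {f : Matrix (Fin n × Fin n) (Fin n × Fin n) (PS R 2)}
    (hf : s.r = f.map (algebraMap (PS R 2) (Coef R 2))
      + Ring.inverse (dx R (N := 2) 0 1) •
        ((1 : Matrix (Fin n) (Fin n) (Coef R 2)) ⊗ₖ (1 : Matrix (Fin n) (Fin n) (Coef R 2)))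
      + Ring.inverse (dy R (N := 2) 1 0) • flipMatrix (Coef R 2) n) (i₁ i₂ j₁ j₂ : Fin n) :
    f (i₂, i₁) (j₂, j₁) = -rename (renameVar 1 0 1 0) (f (i₁, i₂) (j₁, j₂)) := by
  have h := congrFun (congrFun s.skew (i₁, i₂)) (j₁, j₂)
  rw [leg21, Matrix.of_apply, Matrix.neg_apply, at4, Matrix.map_apply, hf] at h
  simp only [Matrix.add_apply, Matrix.map_apply, Matrix.smul_apply, smul_eq_mul, map_add, map_mul,
    substVar_algebraMap, Matrix.kroneckerMap_apply, flipMatrix, Matrix.of_apply] at h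
  have e₁ : Ring.inverse (dx R (N := 2) 0 1) = -Ring.inverse (dx R (N := 2) 1 0) :=
    inverse_map_sub_comm _ _ _
  have e₂ : Ring.inverse (dy R (N := 2) 0 1) = -Ring.inverse (dy R (N := 2) 1 0) :=
    inverse_map_sub_comm _ _ _
  have e₃ : substVar R (N := 2) 1 0 1 0 (by decide) (by decide) (dx R 0 1) = dx R 1 0 := by
    simp [dx, substVar_algebraMap, xvar, renameVar, rename_X]
  have e₄ : substVar R (N := 2) 1 0 1 0 (by decide) (by decide) (dy R 1 0) = dy R 0 1 := by
    simp [dy, substVar_algebraMap, yvar, renameVar, rename_X]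
  rw [map_inverse_of_isUnit _ (isUnit_dx R (by decide)),
    map_inverse_of_isUnit _ (isUnit_dy R (by decide)), e₃, e₄, e₁, e₂] at h
  refine algebraMap_coef_injective R 2 ?_
  rw [map_neg]
  have k₁ : ∀ a b : Fin n, substVar R (N := 2) 1 0 1 0 (by decide) (by decide)
      ((1 : Matrix (Fin n) (Fin n) (Coef R 2)) a b) = (1 : Matrix _ _ (Coef R 2)) a b := by
    intro a b; by_cases hab : a = b <;> simp [hab, Matrix.one_apply]
  have k₂ : ∀ (p : Prop) [Decidable p], substVar R (N := 2) 1 0 1 0 (by decide) (by decide)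
      (if p then (1 : Coef R 2) else 0) = if p then 1 else 0 := by
    intro p _; split_ifs <;> simp
  simp only [k₁, k₂, and_comm (a := i₂ = j₁)] at h
  linear_combination h

theorem genSeries_quintic_eq_zero {op : Ops R n} (h : IsCyclicOp op) {s : FormalSolution R n}
    (hs : tensor op = s.r) (a₃ b₂ a₂ b₁ a₁ g : Fin n) :
    genSeries Prod.fst (.Y, (1 : Fin 3)) [(.theta a₃, (.X, 1)),
      (.eta b₂, (.Y, 2)), (.theta a₂, (.X, 2)), (.eta b₁, (.Y, 0)), (.theta a₁, (.X, 0))]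
        (derive op (fun w => op w (.theta g))) = 0 := by
  have := aybe_tensor_apply h b₂ g b₁ a₂ a₃ a₁
  simp only [hs, s.aybe] at this
  refine algebraMap_coef_injective R 3 ?_
  rw [map_zero, ← neg_eq_zero, ← this]
  rfl

/-- A cyclic operation whose tensor is a solution satisfies the `A_∞`-relations. -/
theorem IsCyclicOp.insertion_eq_zero_of_tensor {op : Ops R n} (h : IsCyclicOp op)
    {s : FormalSolution R n} (hs : tensor op = s.r) (w : List (Gen n)) (c : Gen n) :
    insertion op op w c = 0 := by
  refine h.insertion_eq_zero (fun w h1 i => ?_) w c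
  by_contra hne
  obtain ⟨-, hp, hd⟩ := (h.graded.insertion h.graded) _ _ hne
  -- Both operations raise the reduced degree by 1 and θ has reduced degree -1, so exactly three θ's
  -- occur.
  have hd' : redDeg w = -3 := by simp only [Gen.deg] at hd; omega
  obtain ⟨k₅, i₃, k₄, j₂, k₃, i₂, k₂, j₁, k₁, i₁, k₀, rfl⟩ := IsPath.exists_three hp h1 hd'
  -- The exponent lists the lengths of the six runs of ξ's, in the variables of their slots.
  have h₀ := congrArg (coeff (Finsupp.equivFunOnFinite.symm fun t : Obj × Fin 3 =>
    if t = (.Y, 1) then k₅ else if t = (.X, 1) then k₄ else if t = (.Y, 2) then k₃ else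
    if t = (.X, 2) then k₂ else if t = (.Y, 0) then k₁ else k₀))
    (genSeries_quintic_eq_zero h hs i₃ j₂ i₂ j₁ i₁ i)
  rw [coeff_genSeries_of_cover (by simp) (by simp; decide), ← insertion_eq_derive] at h₀
  apply hne
  simpa [slotWord] using h₀

/-- The cyclic structure defined by a cyclic operation whose tensor is a solution. -/
def CyclicAInf.ofTensor {op : Ops R n} (h : IsCyclicOp op) {s : FormalSolution R n}
    (hs : tensor op = s.r) : CyclicAInf R n where
  op := op
  homogeneous := by simpa using (homogeneous_iff_graded 1 op).2 h.graded
  minimal := h.minimal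
  op_two := h.op_two
  strictly_unital := h.strictly_unital
  ainf w _ c := h.insertion_eq_zero_of_tensor hs w c
  cyclic := h.cyclic

/-- The regular part of the solution, with its sign changed, serves as potential; the tensor of the
resulting operation is the given solution, whose Yang–Baxter equation then yields the A∞-relations.
-/
theorem CyclicAInf.solution_surjective :
    Function.Surjective (CyclicAInf.solution (R := R) (n := n)) := by
  intro s
  obtain ⟨f, hf⟩ := s.singular_part
  let q : Fin n → Fin n → Fin n → Fin n → ℕ → ℕ → ℕ → ℕ → R := fun a' b a g k₁ k₂ k₃ k₄ =>
    -coeff (quadExp k₁ k₂ k₃ k₄) (f (g, b) (a', a))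
  have hq : ∀ a b c d k₁ k₂ k₃ k₄, q a b c d k₁ k₂ k₃ k₄ = -q c d a b k₃ k₄ k₁ k₂ := by
    intro a b c d k₁ k₂ k₃ k₄
    simp only [q]
    rw [s.skew_regular hf, map_neg, coeff_rename_quadExp]
  have h := isCyclicOp_potOp hq
  have hs : tensor (potOp q) = s.r := by
    rw [tensor_singular_part, hf]
    congr 3
    ext ⟨i₁, i₂⟩ ⟨j₁, j₂⟩ e
    rw [Matrix.of_apply, eq_quadExp e, map_neg, quad_potOp, neg_neg]
  exact ⟨CyclicAInf.ofTensor h hs, FormalSolution.ext hs⟩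

end Surjective

end

section

open MvPowerSeries IsCyclicOp

/-! ### Generating series of functors -/

section Blocks

variable {σ R : Type*} [CommRing R] {n : ℕ} {ob : σ → Obj}

variable (ob) in
/-- The generating series of the block substitution in the words which continue a given prefix. -/
def prefixSeries (F : Ops R n) (g : List (Gen n) → R) (s : σ) (l : List (Gen n × σ)) (b : Gen n)
    (t : σ) (l' : List (Gen n × σ)) : MvPowerSeries σ R :=
  slotEval ob s l fun u => genSeries ob t l' (blockSubst F fun z => g (u ++ b :: z))

variable {F : Ops R n}
  (hxi : ∀ s : σ, ∀ b, genSeries ob s [] (fun v => F v b) = if b = .xi (ob s) then X s else 0)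
  (hF0 : ∀ c, F [] c = 0)

include hxi hF0

/-- Only a run of ξ's remains to be cut, and the functor reproduces it. -/
theorem prefixSeries_nil (g : List (Gen n) → R) (s : σ) (l : List (Gen n × σ)) (b : Gen n) (t : σ) :
    prefixSeries ob F g s l b t [] = genSeries ob s (l ++ [(b, t)]) g := by
  rw [prefixSeries, genSeries, slotEval_append]
  simp only [genSeries_nil_blockSubst hxi hF0]
  rfl

/-- Blocks that are single ξ's lengthen the run after the output letter `b`; then comes the block
that contains `a`, with output `b'`. -/
theorem prefixSeries_cons (g : List (Gen n) → R) (s : σ) (l : List (Gen n × σ)) (b : Gen n) (t : σ)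
    (a : Gen n × σ) (l' : List (Gen n × σ)) :
    prefixSeries ob F g s l b t (a :: l') = splitSum (fun l₁ l₂ => ∑ b',
      genSeries ob t (a :: l₁) (fun v => F v b') *
        prefixSeries ob F g s (l ++ [(b, t)]) b' (endSlot a.2 l₁) l₂) l' := by
  simp only [prefixSeries, slotEval_append]
  simp only [genSeries_cons_blockSubst hxi hF0, slotEval, mul_slotEval, mul_slotSum,
    List.append_assoc, List.cons_append]
  simp only [splitSum_eq_sum_range, slotSum_sum, slotEval_sum]
  rw [Finset.sum_comm]

theorem genSeries_blockSubst_cons (g : List (Gen n) → R) (s : σ)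
    (a : Gen n × σ) (l' : List (Gen n × σ)) :
    genSeries ob s (a :: l') (blockSubst F g) = splitSum (fun l₁ l₂ => ∑ b',
      genSeries ob s (a :: l₁) (fun v => F v b') *
        prefixSeries ob F g s [] b' (endSlot a.2 l₁) l₂) l' := by
  simp only [prefixSeries]
  simp only [genSeries_cons_blockSubst hxi hF0, slotEval, mul_slotSum]
  simp only [splitSum_eq_sum_range, slotSum_sum]
  rw [Finset.sum_comm]

end Blocks

/-! ### Components of a functor and the constraints imposed by the pairing. -/

section Functor

variable {σ R : Type*} [CommRing R] {n : ℕ} {ob : σ → Obj} {F : Ops R n}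
  {x x' y y' : σ}

variable (ob F) in
/-- The generating series of the components `θ_a ↦ θ_g` of a functor. -/
def thetaSeries (y x : σ) (g a : Fin n) : MvPowerSeries σ R :=
  genSeries ob y [(.theta a, x)] (fun w => F w (.theta g))

variable (ob F) in
/-- The generating series of the components `η_a ↦ η_g` of a functor. -/
def etaSeries (x y : σ) (g a : Fin n) : MvPowerSeries σ R :=
  genSeries ob x [(.eta a, y)] (fun w => F w (.eta g))

variable (ob F) in
/-- The generating series of the components `(η_b, θ_a) ↦ id_X` of a functor. -/
def etaThetaSeries (x' y x : σ) (b a : Fin n) : MvPowerSeries σ R :=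
  genSeries ob x' [(.eta b, y), (.theta a, x)] (fun w => F w (.one .X))

variable (ob F) in
/-- The generating series of the components `(θ_a, η_b) ↦ id_Y` of a functor. -/
def thetaEtaSeries (y' x y : σ) (a b : Fin n) : MvPowerSeries σ R :=
  genSeries ob y' [(.theta a, x), (.eta b, y)] (fun w => F w (.one .Y))

namespace Graded

variable (hF : Graded 0 F) (hx : ob x = .X) (hy : ob y = .Y) (hx' : ob x' = .X) (hy' : ob y' = .Y)

include hF hx hy

theorem sum_theta (a : Fin n) (f : Gen n → MvPowerSeries σ R) :
    ∑ b, genSeries ob y [(.theta a, x)] (fun w => F w b) * f b =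
      ∑ g, thetaSeries ob F y x g a * f (.theta g) := by
  have hp : SlotPath ob y [(.theta a, x)] := ⟨hy.symm, hx.symm, trivial⟩
  refine sum_gen_theta (fun o => ?_) (fun o => ?_) (fun o => ?_) <;>
  · rw [hF.genSeries_eq_zero hp, zero_mul]
    simp [Gen.tgt, Gen.src, Gen.deg, hx, hy]
    try rintro rfl; simp

theorem sum_eta (a : Fin n) (f : Gen n → MvPowerSeries σ R) :
    ∑ b, genSeries ob x [(.eta a, y)] (fun w => F w b) * f b =
      ∑ g, etaSeries ob F x y g a * f (.eta g) := by
  have hp : SlotPath ob x [(.eta a, y)] := ⟨hx.symm, hy.symm, trivial⟩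
  refine sum_gen_eta (fun o => ?_) (fun o => ?_) (fun o => ?_) <;>
  · rw [hF.genSeries_eq_zero hp, zero_mul]
    simp [Gen.tgt, Gen.src, Gen.deg, hx, hy]
    try rintro rfl; simp

include hx' in
theorem genSeries_eta_theta (b a : Fin n) (c : Gen n) :
    genSeries ob x' [(.eta b, y), (.theta a, x)] (fun w => F w c) =
      if c = .one .X then etaThetaSeries ob F x' y x b a else 0 := by
  have hp : SlotPath ob x' [(.eta b, y), (.theta a, x)] :=
    ⟨hx'.symm, hy.symm, hy.symm, hx.symm, trivial⟩
  split_ifs with hc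
  · subst hc; rfl
  · refine hF.genSeries_eq_zero hp ?_
    cases c <;> simp_all [Gen.tgt, Gen.src, Gen.deg]; grind

include hy' in
theorem genSeries_theta_eta (a b : Fin n) (c : Gen n) :
    genSeries ob y' [(.theta a, x), (.eta b, y)] (fun w => F w c) =
      if c = .one .Y then thetaEtaSeries ob F y' x y a b else 0 := by
  have hp : SlotPath ob y' [(.theta a, x), (.eta b, y)] :=
    ⟨hy'.symm, hx.symm, hx.symm, hy.symm, trivial⟩
  split_ifs with hc
  · subst hc; rfl
  · refine hF.genSeries_eq_zero hp ?_
    cases c <;> simp_all [Gen.tgt, Gen.src, Gen.deg]; grind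

include hx' hy' in
theorem genSeries_theta_eta_theta (a' b a : Fin n) (c : Gen n) :
    genSeries ob y' [(.theta a', x'), (.eta b, y), (.theta a, x)] (fun w => F w c) = 0 := by
  have hp : SlotPath ob y' [(.theta a', x'), (.eta b, y), (.theta a, x)] :=
    ⟨hy'.symm, hx'.symm, hx'.symm, hy.symm, hy.symm, hx.symm, trivial⟩
  refine hF.genSeries_eq_zero hp ?_
  cases c <;> simp_all [Gen.tgt, Gen.src, Gen.deg]

variable (hxi : ∀ s : σ, ∀ b, genSeries ob s [] (fun v => F v b) =
  if b = .xi (ob s) then X s else 0)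

include hxi

-- The word is cut inside its first run, its middle run or its last run. In the outer cases a ξ
-- pairs with the component into id_X, which gives the factors `X x'` and `-X x`; in the middle case
-- η pairs with θ.
include hx' in
theorem genSeries_form_eta_theta (b a : Fin n) :
    genSeries ob x' [(.eta b, y), (.theta a, x)] (fun w => ∑ c, ∑ d, pairing R c d *
      conv (fun v => F v c) (fun v => F v d) w) =
      (X x' - X x) * etaThetaSeries ob F x' y x b a +
        ∑ g, etaSeries ob F x' y g b * thetaSeries ob F y x g a := by
  have hsum : ∀ f g : Gen n → MvPowerSeries σ R, ∑ c, ∑ d, C (pairing R c d) * (f c * g d) =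
      ∑ c, f c * (C (psign R c) * g c.dual) := by
    intro f g
    refine Finset.sum_congr rfl fun c _ => ?_
    rw [Finset.sum_eq_single c.dual]
    · rw [pairing_eq, if_pos rfl]; ring
    · intro d _ hd
      rw [pairing_eq, if_neg hd]; simp
    · simp
  simp only [genSeries_sum, genSeries_smul, genSeries_conv, splitSum_cons, splitSum_nil,
    endSlot_cons, endSlot_nil, mul_add, Finset.sum_add_distrib, hsum, hF.sum_eta hx' hy,
    hF.genSeries_eta_theta hx hy hx', hxi, hx', hx]
  have hp1 : psign R (.xi .X : Gen n) = 1 := by simp [psign, Gen.deg]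
  have hp2 : psign R (.one .X : Gen n) = -1 := by simp [psign, Gen.deg]
  have hp3 : ∀ i, psign R (.eta i : Gen n) = 1 := by simp [psign, Gen.deg]
  simp [hp1, hp2, hp3, Gen.dual, thetaSeries]
  ring

include hy' in
theorem genSeries_form_theta_eta (a b : Fin n) :
    genSeries ob y' [(.theta a, x), (.eta b, y)] (fun w => ∑ c, ∑ d, pairing R c d *
      conv (fun v => F v c) (fun v => F v d) w) =
      (X y' - X y) * thetaEtaSeries ob F y' x y a b -
        ∑ g, thetaSeries ob F y' x g a * etaSeries ob F x y g b := by
  have hsum : ∀ f g : Gen n → MvPowerSeries σ R, ∑ c, ∑ d, C (pairing R c d) * (f c * g d) =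
      ∑ c, f c * (C (psign R c) * g c.dual) := by
    intro f g
    refine Finset.sum_congr rfl fun c _ => ?_
    rw [Finset.sum_eq_single c.dual]
    · rw [pairing_eq, if_pos rfl]; ring
    · intro d _ hd
      rw [pairing_eq, if_neg hd]; simp
    · simp
  simp only [genSeries_sum, genSeries_smul, genSeries_conv, splitSum_cons, splitSum_nil,
    endSlot_cons, endSlot_nil, mul_add, Finset.sum_add_distrib, hsum, hF.sum_theta hx hy',
    hF.genSeries_theta_eta hx hy hy', hxi, hy', hy]
  have hp1 : psign R (.xi .Y : Gen n) = 1 := by simp [psign, Gen.deg]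
  have hp2 : psign R (.one .Y : Gen n) = -1 := by simp [psign, Gen.deg]
  have hp3 : ∀ i, psign R (.theta i : Gen n) = -1 := by simp [psign, Gen.deg]
  simp [hp1, hp2, hp3, Gen.dual, etaSeries]
  ring

end Graded

theorem genSeries_twoForm {l : List (Gen n × σ)} (hl : l.length = 2) (s : σ) :
    genSeries ob s l (twoForm R n) = C (twoForm R n (l.map Prod.fst)) :=
  genSeries_of_minimal fun w _ hw => twoForm_of_length_ne (by omega)

namespace IsFunctorData

/-- The form on the word (id, ξ^k) has a single term, in which the identity pairs with the
coefficient of ξ in the image of ξ^k. -/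
theorem map_replicate_xi (hF : IsFunctorData F) (k : ℕ) (o : Obj) :
    F (List.replicate k (.xi o)) (.xi o) = if k = 1 then 1 else 0 := by
  have h := hF.form (.one o :: List.replicate k (.xi o))
  have h₁ : ∀ c d, conv (fun v => F v c) (fun v => F v d) (.one o :: List.replicate k (.xi o)) =
      F [.one o] c * F (List.replicate k (.xi o)) d := by
    intro c d
    rw [conv_cons, hF.graded.nil, zero_mul, zero_add]
    cases k with
    | zero => rfl
    | succ k =>
      rw [List.replicate_succ, conv_cons, conv, splitSum_eq_zero, add_zero]
      intro u v _
      rw [hF.strictly_unital _ o _ (by simp) (by simp), zero_mul]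
  simp only [h₁, hF.map_one, ite_mul, zero_mul, mul_ite, mul_zero, one_mul, Finset.sum_ite_irrel,
    Finset.sum_const_zero, Finset.sum_ite_eq', Finset.mem_univ, if_true, sum_pairing] at h
  have hp : psign R (.one o : Gen n) = -1 := by simp [psign, Gen.deg]
  rw [hp] at h
  split_ifs with hk
  · subst hk
    have h₂ : twoForm R n (.one o :: List.replicate 1 (.xi o)) = -1 := by
      simp [twoForm_pair, pairing]
    rw [h₂] at h
    simpa [Gen.dual] using h
  · rw [twoForm_of_length_ne (by simpa using hk)] at h
    simpa [Gen.dual] using h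

theorem genSeries_nil (hF : IsFunctorData F) (s : σ) (b : Gen n) :
    genSeries ob s [] (fun v => F v b) = if b = .xi (ob s) then X s else 0 := by
  split_ifs with hb
  · subst hb
    simp only [genSeries, slotEval, hF.map_replicate_xi]
    rw [slotSum_eq_add, slotSum_eq_first]
    · simp
    · simp
  · refine hF.graded.genSeries_eq_zero (by trivial) ?_
    cases b <;> simp_all [Gen.tgt, Gen.src, Gen.deg]
    grind

variable (hF : IsFunctorData F) (hx : ob x = .X) (hy : ob y = .Y) (hx' : ob x' = .X)
  (hy' : ob y' = .Y)

include hF hx hy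

include hx' in
theorem sub_mul_etaThetaSeries (b a : Fin n) :
    (X x' - X x) * etaThetaSeries ob F x' y x b a =
      kd _ b a - ∑ g, etaSeries ob F x' y g b * thetaSeries ob F y x g a := by
  have h := hF.graded.genSeries_form_eta_theta hx hy hx' hF.genSeries_nil b a
  rw [genSeries_congr fun w _ => hF.form w, genSeries_twoForm rfl] at h
  simp only [List.map_cons, List.map_nil, twoForm_pair, pairing] at h
  have hk : C (σ := σ) (if b = a then (1 : R) else 0) = kd _ b a := by
    by_cases hab : b = a <;> simp [hab, kd]
  rw [← hk, h]
  ring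

include hy' in
theorem sub_mul_thetaEtaSeries (a b : Fin n) :
    (X y' - X y) * thetaEtaSeries ob F y' x y a b =
      ∑ g, thetaSeries ob F y' x g a * etaSeries ob F x y g b - kd _ a b := by
  have h := hF.graded.genSeries_form_theta_eta hx hy hy' hF.genSeries_nil a b
  rw [genSeries_congr fun w _ => hF.form w, genSeries_twoForm rfl] at h
  simp only [List.map_cons, List.map_nil, twoForm_pair, pairing] at h
  have hk : C (σ := σ) (if a = b then (-1 : R) else 0) = -kd _ a b := by
    by_cases hab : a = b <;> simp [hab, kd]
  rw [hk] at h
  linear_combination -h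

/-- Taking the same variable for both slots of type `X` kills the left side of
`sub_mul_etaThetaSeries`. Hence the matrices of η ↦ η and θ ↦ θ are mutually inverse. -/
theorem sum_etaSeries_mul_thetaSeries (b a : Fin n) :
    ∑ g, etaSeries ob F x y g b * thetaSeries ob F y x g a = kd _ b a := by
  have := hF.sub_mul_etaThetaSeries hx hy hx b a
  rw [sub_self, zero_mul] at this
  exact (sub_eq_zero.1 this.symm).symm

-- The letters θ, η, θ form three blocks, or two blocks in which a pair θη or ηθ is contracted to an
-- identity; one block of all three has no output by degree.
include hx' hy' in
theorem genSeries_blockSubst_theta {op' : Ops R n} (h' : IsCyclicOp op') (a' b a g : Fin n) :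
    genSeries ob y' [(.theta a', x'), (.eta b, y), (.theta a, x)]
      (blockSubst F (fun w => op' w (.theta g))) =
      ∑ p, ∑ q, ∑ r, thetaSeries ob F y' x' p a' * etaSeries ob F x' y q b *
        thetaSeries ob F y x r a * quad ob op' y' x' y x p q r g
      + thetaEtaSeries ob F y' x' y a' b * thetaSeries ob F y x g a
      + thetaSeries ob F y' x' g a' * etaThetaSeries ob F x' y x b a := by
  have hxi := hF.genSeries_nil (ob := ob)
  have h0 := hF.graded.nil
  rw [genSeries_blockSubst_cons hxi h0]
  simp only [splitSum_cons, splitSum_nil, endSlot_cons, endSlot_nil,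
    hF.graded.genSeries_theta_eta_theta hx hy hx' hy', zero_mul, Finset.sum_const_zero, add_zero,
    hF.graded.sum_theta hx' hy', hF.graded.genSeries_theta_eta hx' hy hy', ite_mul,
    Finset.sum_ite_eq', Finset.mem_univ, if_true]
  have h₁ : prefixSeries ob F (fun w => op' w (.theta g)) y' [] (.one .Y) y [(.theta a, x)] =
      thetaSeries ob F y x g a := by
    rw [prefixSeries_cons hxi h0]
    simp only [splitSum_nil, endSlot_nil, hF.graded.sum_theta hx hy, prefixSeries_nil hxi h0,
      List.nil_append, List.cons_append, h'.genSeries_one_theta, mul_ite, mul_one, mul_zero,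
      Finset.sum_ite_eq', Finset.mem_univ, if_true]
  have h₂ : ∀ p, prefixSeries ob F (fun w => op' w (.theta g)) y' [] (.theta p) x'
      [(.eta b, y), (.theta a, x)] = ∑ q, etaSeries ob F x' y q b * ∑ r, thetaSeries ob F y x r a *
        quad ob op' y' x' y x p q r g + if p = g then etaThetaSeries ob F x' y x b a else 0 := by
    intro p
    rw [prefixSeries_cons hxi h0]
    simp only [splitSum_cons, splitSum_nil, endSlot_nil, endSlot_cons, hF.graded.sum_eta hx' hy,
      hF.graded.genSeries_eta_theta hx hy hx', prefixSeries_nil hxi h0, List.nil_append,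
      List.cons_append, h'.genSeries_theta_one, mul_ite, mul_one, mul_zero, ite_mul, zero_mul,
      Finset.sum_ite_eq', Finset.mem_univ, if_true]
    congr 1
    refine Finset.sum_congr rfl fun q _ => ?_
    rw [prefixSeries_cons hxi h0]
    simp only [splitSum_nil, endSlot_nil, hF.graded.sum_theta hx hy, prefixSeries_nil hxi h0,
      List.nil_append, List.cons_append, quad]
  simp only [h₁, h₂, mul_add, Finset.sum_add_distrib, mul_ite, mul_zero, Finset.sum_ite_eq',
    Finset.mem_univ, if_true, Finset.mul_sum, mul_assoc]
  ring

-- The inner operation uses all three letters, or it is a μ₂ of two of them and contributes an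
-- additional ξ to the argument of `F`.
omit hF in
include hx' hy' in
theorem genSeries_derive_theta {op : Ops R n} (h : IsCyclicOp op) (a' b a g : Fin n) :
    genSeries ob y' [(.theta a', x'), (.eta b, y), (.theta a, x)]
      (derive op (fun w => F w (.theta g))) =
      ∑ k, quad ob op y' x' y x a' b a k * thetaSeries ob F y' x g k
      + kd _ a' b * genSeries ob y' [(.xi .Y, y), (.theta a, x)] (fun w => F w (.theta g))
      + kd _ b a * genSeries ob y' [(.theta a', x'), (.xi .X, x)] (fun w => F w (.theta g)) := by
  have hs : sgn R (-1) = -1 := by simp [sgn]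
  rw [genSeries_derive]
  simp only [splitSum_cons, splitSum_nil, endSlot_cons, endSlot_nil, h.genSeries_nil,
    h.genSeries_theta hy' hx', h.genSeries_eta hy hx', h.genSeries_theta hy hx, zero_mul,
    Finset.sum_const_zero, mul_zero, add_zero, zero_add, h.genSeries_eta_theta hx hy hx',
    h.genSeries_theta_eta hy hx' hy', h.sum_theta_eta_theta hx hy hx' hy', ite_mul,
    Finset.sum_ite_eq', Finset.mem_univ, if_true, List.cons_append, List.nil_append]
  simp only [List.map_cons, List.map_nil, redDeg_cons, redDeg_nil, Gen.deg, thetaSeries, kd]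
  by_cases h₁ : a' = b <;> by_cases h₂ : b = a <;> simp [h₁, h₂, hs] <;> ring

end IsFunctorData

end Functor

end

section

open MvPowerSeries IsCyclicOp

/-! ### Functors and gauge transformations -/

section Star

variable {σ R : Type*} [CommRing R] {n : ℕ} {ob : σ → Obj} {F op op' : Ops R n}
  {K : Type*} [CommRing K]

/-- The contractions to identities and the additional ξ's are both differences divided by x' - x or
y - y'. In the functor equation they are what the polar parts of the two tensors contribute, so the
defect is a relation between complete entries: three functor matrices on the inputs of one, a single
matrix on the output of the other. -/
theorem IsFunctorData.entry_functor (hF : IsFunctorData F) (h : IsCyclicOp op)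
    (h' : IsCyclicOp op') (ι : MvPowerSeries σ R →+* K) {x x' y y' : σ}
    (hx : ob x = .X) (hy : ob y = .Y) (hx' : ob x' = .X) (hy' : ob y' = .Y)
    (ux : IsUnit (ι (X x' - X x))) (uy : IsUnit (ι (X y - X y'))) (a' b a g : Fin n) :
    ι (genSeries ob y' [(.theta a', x'), (.eta b, y), (.theta a, x)]
        (blockSubst F (fun w => op' w (.theta g)))) -
      ι (genSeries ob y' [(.theta a', x'), (.eta b, y), (.theta a, x)]
        (derive op (fun w => F w (.theta g)))) =
    ∑ k, ι (thetaSeries ob F y' x g k) * entry ob op ι y' x' y x a' b a k -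
      ∑ p, ∑ q, ∑ r, ι (thetaSeries ob F y' x' p a') * ι (etaSeries ob F x' y q b) *
        ι (thetaSeries ob F y x r a) * entry ob op' ι y' x' y x p q r g := by
  have hkd : ∀ c d : Fin n, ι (kd _ c d) = kd K c d := by
    intro c d; by_cases hcd : c = d <;> simp [kd, hcd]
  have d₁ := congrArg ι (hF.sub_mul_etaThetaSeries hx hy hx' b a)
  have d₂ := congrArg ι (hF.sub_mul_thetaEtaSeries hx' hy hy' a' b)
  have d₃ := congrArg ι (sub_mul_genSeries_xi_head (hy'.trans hy.symm) [(.theta a, x)]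
    (fun w => F w (.theta g)))
  have d₄ := congrArg ι (sub_mul_genSeries_xi (hx'.trans hx.symm) y' [] (.theta a') []
    (fun w => F w (.theta g)))
  simp only [hy', hx', List.nil_append] at d₃ d₄
  rw [hF.genSeries_blockSubst_theta hx hy hx' hy' h',
    IsFunctorData.genSeries_derive_theta hx hy hx' hy' h]
  have eu := Ring.inverse_mul_cancel _ ux
  have ev := Ring.inverse_mul_cancel _ uy
  have e₁ : ∑ k, ι (thetaSeries ob F y' x g k) * entry ob op ι y' x' y x a' b a k =
      -(∑ k, ι (quad ob op y' x' y x a' b a k) * ι (thetaSeries ob F y' x g k))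
      + ι (thetaSeries ob F y' x g a') * (kd K b a * Ring.inverse (ι (X x' - X x)))
      + ι (thetaSeries ob F y' x g a) * (kd K b a' * Ring.inverse (ι (X y - X y'))) := by
    rw [← sum_mul_kd a' fun k => ι (thetaSeries ob F y' x g k),
      ← sum_mul_kd a fun k => ι (thetaSeries ob F y' x g k), Finset.sum_mul, Finset.sum_mul,
      ← Finset.sum_neg_distrib, ← Finset.sum_add_distrib, ← Finset.sum_add_distrib]
    exact Finset.sum_congr rfl fun k _ => by rw [entry]; ring
  have e₂ : ∑ p, ∑ q, ∑ r, ι (thetaSeries ob F y' x' p a') * ι (etaSeries ob F x' y q b) *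
        ι (thetaSeries ob F y x r a) * entry ob op' ι y' x' y x p q r g =
      -(∑ p, ∑ q, ∑ r, ι (thetaSeries ob F y' x' p a') * ι (etaSeries ob F x' y q b) *
        ι (thetaSeries ob F y x r a) * ι (quad ob op' y' x' y x p q r g))
      + ι (thetaSeries ob F y' x' g a') * (∑ q, ι (etaSeries ob F x' y q b) *
        ι (thetaSeries ob F y x q a)) * Ring.inverse (ι (X x' - X x))
      + ι (thetaSeries ob F y x g a) * (∑ q, ι (thetaSeries ob F y' x' q a') *
        ι (etaSeries ob F x' y q b)) * Ring.inverse (ι (X y - X y')) := by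
    have t₁ : ∑ p, ∑ q, ∑ r, ι (thetaSeries ob F y' x' p a') * ι (etaSeries ob F x' y q b) *
        ι (thetaSeries ob F y x r a) * (kd K g p * (kd K q r * Ring.inverse (ι (X x' - X x)))) =
        ι (thetaSeries ob F y' x' g a') * (∑ q, ι (etaSeries ob F x' y q b) *
          ι (thetaSeries ob F y x q a)) * Ring.inverse (ι (X x' - X x)) := by
      simp [kd, Finset.mul_sum, Finset.sum_mul, mul_assoc]
    have t₂ : ∑ p, ∑ q, ∑ r, ι (thetaSeries ob F y' x' p a') * ι (etaSeries ob F x' y q b) *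
        ι (thetaSeries ob F y x r a) * (kd K g r * (kd K q p * Ring.inverse (ι (X y - X y')))) =
        ι (thetaSeries ob F y x g a) * (∑ q, ι (thetaSeries ob F y' x' q a') *
          ι (etaSeries ob F x' y q b)) * Ring.inverse (ι (X y - X y')) := by
      simp [kd, Finset.mul_sum, Finset.sum_mul]
      exact Finset.sum_congr rfl fun k _ => by ring
    rw [← t₁, ← t₂]
    simp only [← Finset.sum_neg_distrib, ← Finset.sum_add_distrib]
    refine Finset.sum_congr rfl fun p _ => Finset.sum_congr rfl fun q _ =>
      Finset.sum_congr rfl fun r _ => ?_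
    rw [entry]; ring
  rw [e₁, e₂]
  simp only [map_add, map_mul, map_sum, map_sub, hkd, kd_comm b a'] at d₁ d₂ d₃ d₄ eu ev ⊢
  simp only [thetaSeries, etaSeries] at *
  linear_combination (Ring.inverse (ι (X x') - ι (X x)) *
      ι (genSeries ob y' [(.theta a', x')] fun w => F w (.theta g))) * d₁ -
    (Ring.inverse (ι (X y) - ι (X y')) *
      ι (genSeries ob y [(.theta a, x)] fun w => F w (.theta g))) * d₂ +
    (kd K a' b * Ring.inverse (ι (X y) - ι (X y'))) * d₃ -
    (kd K b a * Ring.inverse (ι (X x') - ι (X x))) * d₄ +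
    (-ι (genSeries ob y' [(.theta a', x')] fun w => F w (.theta g)) *
      ι (etaThetaSeries ob F x' y x b a) + kd K b a *
      ι (genSeries ob y' [(.theta a', x'), (.xi .X, x)] fun w => F w (.theta g))) * eu +
    (-ι (genSeries ob y [(.theta a, x)] fun w => F w (.theta g)) *
      ι (thetaEtaSeries ob F y' x' y a' b) + kd K a' b *
      ι (genSeries ob y' [(.xi .Y, y), (.theta a, x)] fun w => F w (.theta g))) * ev

end Star

/-! ### The functor equation as a gauge transformation. -/

section Gauge

variable {R : Type*} [CommRing R] {n : ℕ}

theorem gaugeAt_mul (φ ψ : Matrix (Fin n) (Fin n) (MvPowerSeries Obj R)) (i j : Fin 2) :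
    gaugeAt (φ * ψ) i j = gaugeAt φ i j * gaugeAt ψ i j := by
  ext a b
  simp [gaugeAt, Matrix.mul_apply]

theorem gaugeAt_one (i j : Fin 2) :
    gaugeAt (1 : Matrix (Fin n) (Fin n) (MvPowerSeries Obj R)) i j = 1 := by
  ext a b
  by_cases h : a = b <;> simp [gaugeAt, h, Matrix.one_apply]

theorem gauge_eq {φ ψ : Matrix (Fin n) (Fin n) (MvPowerSeries Obj R)} (h : φ * ψ = 1)
    (r : Matrix (Fin n × Fin n) (Fin n × Fin n) (Coef R 2)) :
    gauge φ r = (gaugeAt φ 0 1 ⊗ₖ gaugeAt φ 1 0) * r * (gaugeAt ψ 1 1 ⊗ₖ gaugeAt ψ 0 0) := by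
  rw [gauge, Matrix.inv_eq_right_inv (B := gaugeAt ψ 1 1 ⊗ₖ gaugeAt ψ 0 0)]
  rw [← Matrix.mul_kronecker_mul, ← gaugeAt_mul, ← gaugeAt_mul, h, gaugeAt_one, gaugeAt_one,
    Matrix.one_kronecker_one]

/-- One factor is moved to the other side so that the formula has the shape of `entry_functor`, with
the inverse `ψ` acting on the η-index. -/
theorem eq_gauge_iff {φ ψ : Matrix (Fin n) (Fin n) (MvPowerSeries Obj R)} (h : φ * ψ = 1)
    (r r' : Matrix (Fin n × Fin n) (Fin n × Fin n) (Coef R 2)) :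
    r' = gauge φ r ↔ (1 ⊗ₖ gaugeAt ψ 1 0) * r' * (gaugeAt φ 1 1 ⊗ₖ gaugeAt φ 0 0) =
      (gaugeAt φ 0 1 ⊗ₖ 1) * r := by
  have h' : ψ * φ = 1 := mul_eq_one_comm.1 h
  have k₁ : (gaugeAt ψ 1 1 ⊗ₖ gaugeAt ψ 0 0) * (gaugeAt φ 1 1 ⊗ₖ gaugeAt φ 0 0) = 1 := by
    rw [← Matrix.mul_kronecker_mul, ← gaugeAt_mul, ← gaugeAt_mul, h', gaugeAt_one, gaugeAt_one,
      Matrix.one_kronecker_one]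
  have k₂ := mul_eq_one_comm.1 k₁
  have k₃ : (1 ⊗ₖ gaugeAt ψ 1 0) * (gaugeAt φ 0 1 ⊗ₖ gaugeAt φ 1 0) = gaugeAt φ 0 1 ⊗ₖ 1 := by
    rw [← Matrix.mul_kronecker_mul, ← gaugeAt_mul, h', gaugeAt_one, one_mul]
  have k₄ : ((1 : Matrix (Fin n) (Fin n) (Coef R 2)) ⊗ₖ gaugeAt φ 1 0) *
      (1 ⊗ₖ gaugeAt ψ 1 0) = 1 := by
    rw [← Matrix.mul_kronecker_mul, ← gaugeAt_mul, h, gaugeAt_one, one_mul,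
      Matrix.one_kronecker_one]
  have k₅ : ((1 : Matrix (Fin n) (Fin n) (Coef R 2)) ⊗ₖ gaugeAt φ 1 0) *
      (gaugeAt φ 0 1 ⊗ₖ 1) = gaugeAt φ 0 1 ⊗ₖ gaugeAt φ 1 0 := by
    rw [← Matrix.mul_kronecker_mul, one_mul, mul_one]
  rw [gauge_eq h]
  constructor
  · rintro rfl
    rw [← mul_assoc, ← mul_assoc, k₃, mul_assoc, k₁, mul_one]
  · intro h₁
    have h₂ := congrArg (fun M => (1 ⊗ₖ gaugeAt φ 1 0) * M * (gaugeAt ψ 1 1 ⊗ₖ gaugeAt ψ 0 0)) h₁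
    simp only [← mul_assoc] at h₂
    rw [k₄, k₅, one_mul, mul_assoc, k₂, mul_one] at h₂
    exact h₂

/-- The matrix `φ^x_y` of the components `θ ↦ θ` of a functor. -/
def thetaMatrix (F : Ops R n) : Matrix (Fin n) (Fin n) (MvPowerSeries Obj R) :=
  Matrix.of fun g a => thetaSeries id F .Y .X g a

/-- The transpose of the matrix of the components `η ↦ η` of a functor. -/
def etaMatrix (F : Ops R n) : Matrix (Fin n) (Fin n) (MvPowerSeries Obj R) :=
  Matrix.of fun a g => etaSeries id F .X .Y g a

theorem gaugeAt_thetaMatrix (F : Ops R n) (i j : Fin 2) (g a : Fin n) :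
    gaugeAt (thetaMatrix F) i j g a =
      algebraMap (PS R 2) (Coef R 2) (thetaSeries Prod.fst F (.Y, j) (.X, i) g a) := by
  rw [gaugeAt, Matrix.map_apply, thetaMatrix, Matrix.of_apply, thetaSeries,
    rename_genSeries (ob' := Prod.fst)]
  · rfl
  · rintro (_ | _) <;> rfl

theorem gaugeAt_etaMatrix (F : Ops R n) (i j : Fin 2) (g a : Fin n) :
    gaugeAt (etaMatrix F) i j a g =
      algebraMap (PS R 2) (Coef R 2) (etaSeries Prod.fst F (.X, i) (.Y, j) g a) := by
  rw [gaugeAt, Matrix.map_apply, etaMatrix, Matrix.of_apply, etaSeries,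
    rename_genSeries (ob' := Prod.fst)]
  · rfl
  · rintro (_ | _) <;> rfl

theorem IsFunctorData.thetaMatrix_mul_etaMatrix {F : Ops R n} (hF : IsFunctorData F) :
    thetaMatrix F * etaMatrix F = 1 := by
  rw [mul_eq_one_comm]
  refine Matrix.ext fun b a => ?_
  rw [Matrix.mul_apply]
  exact (hF.sum_etaSeries_mul_thetaSeries (ob := id) rfl rfl b a).trans (Matrix.one_apply ..).symm

/-- The gauge formula, rearranged by `eq_gauge_iff`, is the vanishing of the right side of
`entry_functor`; injectivity of the localization returns to power series. -/
theorem IsFunctorData.gauge_iff {F op op' : Ops R n} (hF : IsFunctorData F) (h : IsCyclicOp op)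
    (h' : IsCyclicOp op') :
    tensor op' = gauge (thetaMatrix F) (tensor op) ↔
    ∀ a' b a g, genSeries Prod.fst (.Y, (1 : Fin 2)) [(.theta a', (.X, 1)), (.eta b, (.Y, 0)),
        (.theta a, (.X, 0))] (blockSubst F (fun w => op' w (.theta g))) =
      genSeries Prod.fst (.Y, 1) [(.theta a', (.X, 1)), (.eta b, (.Y, 0)),
        (.theta a, (.X, 0))] (derive op (fun w => F w (.theta g))) := by
  rw [eq_gauge_iff hF.thetaMatrix_mul_etaMatrix]
  have hs := hF.entry_functor (ob := Prod.fst) h h' (algebraMap (PS R 2) (Coef R 2))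
    (x := (.X, 0)) (x' := (.X, 1)) (y := (.Y, 0)) (y' := (.Y, 1)) rfl rfl rfl rfl
    (isUnit_algebraMap_X_sub .X (by decide)) (isUnit_algebraMap_X_sub .Y (by decide))
  have hL : ∀ g b a' a, (((1 : Matrix (Fin n) (Fin n) (Coef R 2)) ⊗ₖ gaugeAt (etaMatrix F) 1 0) * tensor op' *
      (gaugeAt (thetaMatrix F) 1 1 ⊗ₖ gaugeAt (thetaMatrix F) 0 0)) (g, b) (a', a) =
      ∑ p, ∑ q, ∑ r, algebraMap (PS R 2) (Coef R 2) (thetaSeries Prod.fst F (.Y, 1) (.X, 1) p a') *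
        algebraMap (PS R 2) (Coef R 2) (etaSeries Prod.fst F (.X, 1) (.Y, 0) q b) *
        algebraMap (PS R 2) (Coef R 2) (thetaSeries Prod.fst F (.Y, 0) (.X, 0) r a) *
        entry Prod.fst op' (algebraMap (PS R 2) (Coef R 2)) (.Y, 1) (.X, 1) (.Y, 0) (.X, 0)
          p q r g := by
    intro g b a' a
    simp only [Matrix.mul_apply, Fintype.sum_prod_type, Matrix.kroneckerMap_apply, Matrix.one_apply,
      gaugeAt_thetaMatrix, gaugeAt_etaMatrix, ite_mul, one_mul, zero_mul, Finset.sum_ite_irrel,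
      Finset.sum_const_zero, Finset.sum_ite_eq, Finset.mem_univ, if_true, Finset.sum_mul]
    refine Finset.sum_congr rfl fun p _ => ?_
    rw [Finset.sum_comm]
    refine Finset.sum_congr rfl fun q _ => Finset.sum_congr rfl fun r _ => ?_
    rw [tensor, Matrix.of_apply]
    ring
  have hR : ∀ g b a' a, ((gaugeAt (thetaMatrix F) 0 1 ⊗ₖ
      (1 : Matrix (Fin n) (Fin n) (Coef R 2))) * tensor op) (g, b) (a', a) =
      ∑ k, algebraMap (PS R 2) (Coef R 2) (thetaSeries Prod.fst F (.Y, 1) (.X, 0) g k) *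
        entry Prod.fst op (algebraMap (PS R 2) (Coef R 2)) (.Y, 1) (.X, 1) (.Y, 0) (.X, 0)
          a' b a k := by
    intro g b a' a
    simp only [Matrix.mul_apply, Fintype.sum_prod_type, Matrix.kroneckerMap_apply, Matrix.one_apply,
      gaugeAt_thetaMatrix, mul_ite, mul_one, mul_zero, ite_mul, zero_mul, Finset.sum_ite_eq,
      Finset.mem_univ, if_true]
    rfl
  constructor
  · intro hm a' b a g
    refine algebraMap_coef_injective R 2 (sub_eq_zero.1 ?_)
    rw [hs, ← hL, ← hR, hm, sub_self]
  · intro hm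
    ext ⟨g, b⟩ ⟨a', a⟩
    rw [hL, hR]
    refine (sub_eq_zero.1 ?_).symm
    rw [← hs, hm, sub_self]

end Gauge

end

section

open MvPowerSeries IsCyclicOp

/-! ### From cyclic functors to gauge equivalences. -/

section FunctorToGauge

variable {R : Type*} [CommRing R] {n : ℕ}

theorem sum_pairing_conv {F : Ops R n} (hF0 : ∀ c, F [] c = 0) (w : List (Gen n)) :
    ∑ c, ∑ d, pairing R c d * conv (fun v => F v c) (fun v => F v d) w =
      ∑ l ∈ Finset.Ioo 0 w.length, ∑ c, ∑ d, F (w.take l) c * F (w.drop l) d * pairing R c d := by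
  have h : ∀ c d, conv (fun v => F v c) (fun v => F v d) w =
      ∑ l ∈ Finset.Ioo 0 w.length, F (w.take l) c * F (w.drop l) d := by
    intro c d
    rw [conv, splitSum_eq_sum_range]
    symm
    refine Finset.sum_subset (fun l hl => ?_) fun l hl hl' => ?_
    · simp at hl ⊢; omega
    · have : l = 0 ∨ l = w.length := by simp at hl hl'; omega
      rcases this with rfl | rfl
      · simp [hF0]
      · simp [hF0]
  simp only [h, Finset.mul_sum]
  rw [Finset.sum_congr rfl fun c _ => Finset.sum_comm, Finset.sum_comm]
  refine Finset.sum_congr rfl fun l _ => Finset.sum_congr rfl fun c _ =>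
    Finset.sum_congr rfl fun d _ => ?_
  ring

theorem isPath_of_pairing {F : Ops R n} (hF : Graded 0 F) {u v : List (Gen n)} {c d : Gen n}
    (h : F u c * F v d * pairing R c d ≠ 0) : IsPath c.tgt c.tgt (u ++ v) := by
  have hcd : d = c.dual := by
    by_contra hne
    exact right_ne_zero_of_mul h (by rw [pairing_eq, if_neg hne])
  have h₁ := (hF _ _ (left_ne_zero_of_mul (left_ne_zero_of_mul h))).2.1
  have h₂ := (hF _ _ (right_ne_zero_of_mul (left_ne_zero_of_mul h))).2.1
  subst hcd
  rw [Gen.dual_tgt, Gen.dual_src] at h₂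
  exact isPath_append.2 ⟨_, h₁, h₂⟩

/-- The linear and the higher pairing conditions combine into the single statement that the
substitution preserves the two-form. Words that are not composable contribute nothing by the
grading. -/
theorem CyclicFunctor.isFunctorData {m m' : CyclicAInf R n} (f : CyclicFunctor m m') :
    IsFunctorData f.map := by
  have hg : Graded 0 f.map := (homogeneous_iff_graded 0 f.map).1 (by simpa using f.homogeneous)
  refine ⟨hg, f.map_one, f.strictly_unital, fun w => ?_⟩
  rw [sum_pairing_conv hg.nil]
  by_cases h2 : w.length = 2
  · obtain ⟨a, b, rfl⟩ := List.length_eq_two.1 h2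
    rw [twoForm_pair, ← f.cyclic_one, show Finset.Ioo 0 [a, b].length = {1} from rfl,
      Finset.sum_singleton]
    rfl
  · rw [twoForm_of_length_ne h2]
    by_cases h3 : 3 ≤ w.length
    · by_cases hc : Composable w
      · exact f.cyclic w h3 hc
      · refine Finset.sum_eq_zero fun l _ => Finset.sum_eq_zero fun c _ =>
          Finset.sum_eq_zero fun d _ => ?_
        by_contra hne
        have := isPath_of_pairing hg hne
        rw [List.take_append_drop, isPath_iff_composable (by rintro rfl; simp at h3)] at this
        exact hc this.1
    · refine Finset.sum_eq_zero fun l hl => ?_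
      simp at hl
      omega

/-- A cyclic functor, from its components with the equations on words without identities and with
output `θ_i`. -/
def CyclicFunctor.ofFunctorData {m m' : CyclicAInf R n} {F : Ops R n} (hF : IsFunctorData F)
    (htheta : ∀ w, (∀ o, Gen.one o ∉ w) → ∀ i,
      blockSum m'.op F w (.theta i) = insertion F m.op w (.theta i)) : CyclicFunctor m m' where
  map := F
  homogeneous := by simpa using (homogeneous_iff_graded 0 F).2 hF.graded
  map_one := hF.map_one
  strictly_unital := hF.strictly_unital
  functor_eq w _ _ c := hF.functor_eq m.isCyclicOp m'.isCyclicOp htheta w c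
  cyclic_one a b := by
    have := hF.form [a, b]
    rw [sum_pairing_conv hF.graded.nil, twoForm_pair,
      show Finset.Ioo 0 [a, b].length = {1} from rfl, Finset.sum_singleton] at this
    exact this
  cyclic w hw _ := by
    rw [← sum_pairing_conv hF.graded.nil, hF.form, twoForm_of_length_ne (by omega)]

theorem constTerm_mul (φ ψ : Matrix (Fin n) (Fin n) (MvPowerSeries Obj R)) :
    constTerm (φ * ψ) = constTerm φ * constTerm ψ := by
  ext a b
  simp [constTerm, Matrix.mul_apply]

theorem constTerm_one : constTerm (1 : Matrix (Fin n) (Fin n) (MvPowerSeries Obj R)) = 1 := by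
  ext a b
  by_cases h : a = b <;> simp [constTerm, h, Matrix.one_apply]

theorem coeff_thetaMatrix (F : Ops R n) (g a : Fin n) (e : Obj →₀ ℕ) :
    coeff e (thetaMatrix F g a) = F (List.replicate (e .Y) (.xi .Y) ++
      .theta a :: List.replicate (e .X) (.xi .X)) (.theta g) := by
  rw [thetaMatrix, Matrix.of_apply, thetaSeries, coeff_genSeries_of_cover (by simp)
    (by simp; decide)]
  rfl

theorem coeff_etaMatrix (F : Ops R n) (g a : Fin n) (e : Obj →₀ ℕ) :
    coeff e (etaMatrix F a g) = F (List.replicate (e .X) (.xi .X) ++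
      .eta a :: List.replicate (e .Y) (.xi .Y)) (.eta g) := by
  rw [etaMatrix, Matrix.of_apply, etaSeries, coeff_genSeries_of_cover (by simp)
    (by simp; decide)]
  rfl

theorem constTerm_thetaMatrix (F : Ops R n) (g a : Fin n) :
    constTerm (thetaMatrix F) g a = F [.theta a] (.theta g) := by
  rw [constTerm, Matrix.map_apply, ← coeff_zero_eq_constantCoeff_apply, coeff_thetaMatrix]
  rfl

theorem CyclicFunctor.solution_eq_gauge {m m' : CyclicAInf R n} (f : CyclicFunctor m m') :
    m'.solution.r = gauge (thetaMatrix f.map) m.solution.r := by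
  refine (f.isFunctorData.gauge_iff m.isCyclicOp m'.isCyclicOp).2 fun a' b a g => ?_
  refine genSeries_congr fun w hw => ?_
  have hne : w ≠ [] := by
    have := hw.length_le
    rintro rfl
    simp at this
  have hp : SlotPath Prod.fst (.Y, (1 : Fin 2)) [(.theta a', (.X, 1)), (.eta b, (.Y, 0)),
    (.theta a, (.X, 0))] := ⟨rfl, rfl, rfl, rfl, rfl, rfl, trivial⟩
  rw [← blockSum_eq_blockSubst, ← insertion_eq_derive]
  exact f.functor_eq w hne ((isPath_iff_composable hne).1 (hw.isPath hp)).1 _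

theorem CyclicEquiv.gaugeEquiv {m m' : CyclicAInf R n} (h : CyclicEquiv m m') :
    GaugeEquiv m.solution m'.solution := by
  obtain ⟨f, -⟩ := h
  refine ⟨thetaMatrix f.map, ?_, f.solution_eq_gauge⟩
  have := congrArg constTerm f.isFunctorData.thetaMatrix_mul_etaMatrix
  rw [constTerm_mul, constTerm_one] at this
  exact IsUnit.of_mul_eq_one _ this

theorem StrictCyclicEquiv.strictGaugeEquiv {m m' : CyclicAInf R n} (h : StrictCyclicEquiv m m') :
    StrictGaugeEquiv m.solution m'.solution := by
  obtain ⟨f, hf⟩ := h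
  refine ⟨thetaMatrix f.map, ?_, f.solution_eq_gauge⟩
  ext g a
  rw [constTerm_thetaMatrix]
  have := congrFun (congrFun hf (.theta g)) (.theta a)
  rw [CyclicFunctor.linear, Matrix.of_apply] at this
  rw [this]
  by_cases hga : g = a <;> simp [Matrix.one_apply, hga]

end FunctorToGauge

/-! ### Functor components with prescribed coefficients. -/

section GaugeToFunctor

variable {R : Type*} [CommRing R] {n : ℕ}

/-- The values of the components of a functor on parsed words. -/
def funParsed (fθ fη : Fin n → Fin n → ℕ → ℕ → R) (hX hY : Fin n → Fin n → ℕ → ℕ → ℕ → R) :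
    ℕ × List (Gen n × ℕ) → Gen n → R
  | (k, [(.theta a, k₁)]), .theta g => fθ g a k k₁
  | (k, [(.eta a, k₁)]), .eta g => fη g a k k₁
  | (k, [(.eta b, k₁), (.theta a, k₂)]), .one _ => hX b a k k₁ k₂
  | (k, [(.theta a, k₁), (.eta b, k₂)]), .one _ => hY a b k k₁ k₂
  | (k, [(.one _, k₁)]), .one _ => if k = 0 ∧ k₁ = 0 then 1 else 0
  | (k, []), .xi _ => if k = 1 then 1 else 0
  | _, _ => 0

open Classical in
/-- The operations with given generating series of the components of a functor. -/
def funOp (fθ fη : Fin n → Fin n → ℕ → ℕ → R) (hX hY : Fin n → Fin n → ℕ → ℕ → ℕ → R) :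
    Ops R n := fun w c => if IsPath c.tgt c.src w then funParsed fθ fη hX hY (parse w) c else 0

variable {fθ fη : Fin n → Fin n → ℕ → ℕ → R} {hX hY : Fin n → Fin n → ℕ → ℕ → ℕ → R}

theorem parse_replicate (k : ℕ) (o : Obj) :
    parse (List.replicate k (.xi o) : List (Gen n)) = (k, []) := by
  simpa [parse] using parse_replicate_append k o ([] : List (Gen n))

theorem isPath_replicate (k : ℕ) (o : Obj) :
    IsPath o o (List.replicate k (.xi o) : List (Gen n)) := by
  simpa using isPath_replicate_append (n := n) k (show IsPath o o [] from rfl)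

theorem funOp_theta (k₁ k₀ : ℕ) (g a : Fin n) :
    funOp fθ fη hX hY (List.replicate k₁ (.xi .Y) ++ .theta a :: List.replicate k₀ (.xi .X))
      (.theta g) = fθ g a k₁ k₀ := by
  rw [funOp, if_pos]
  · simp [parse_replicate_append, parse_replicate, parse, funParsed]
  · exact isPath_replicate_append _ ⟨rfl, isPath_replicate _ _⟩

theorem funOp_eta (k₁ k₀ : ℕ) (g a : Fin n) :
    funOp fθ fη hX hY (List.replicate k₁ (.xi .X) ++ .eta a :: List.replicate k₀ (.xi .Y))
      (.eta g) = fη g a k₁ k₀ := by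
  rw [funOp, if_pos]
  · simp [parse_replicate_append, parse_replicate, parse, funParsed]
  · exact isPath_replicate_append _ ⟨rfl, isPath_replicate _ _⟩

theorem funOp_eta_theta (k₂ k₁ k₀ : ℕ) (b a : Fin n) :
    funOp fθ fη hX hY (List.replicate k₂ (.xi .X) ++ .eta b :: (List.replicate k₁ (.xi .Y) ++
      .theta a :: List.replicate k₀ (.xi .X))) (.one .X) = hX b a k₂ k₁ k₀ := by
  rw [funOp, if_pos]
  · simp [parse_replicate_append, parse_replicate, parse, funParsed]
  · exact isPath_replicate_append _ ⟨rfl, isPath_replicate_append _ ⟨rfl, isPath_replicate _ _⟩⟩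

theorem funOp_theta_eta (k₂ k₁ k₀ : ℕ) (a b : Fin n) :
    funOp fθ fη hX hY (List.replicate k₂ (.xi .Y) ++ .theta a :: (List.replicate k₁ (.xi .X) ++
      .eta b :: List.replicate k₀ (.xi .Y))) (.one .Y) = hY a b k₂ k₁ k₀ := by
  rw [funOp, if_pos]
  · simp [parse_replicate_append, parse_replicate, parse, funParsed]
  · exact isPath_replicate_append _ ⟨rfl, isPath_replicate_append _ ⟨rfl, isPath_replicate _ _⟩⟩

theorem funOp_one (o : Obj) (c : Gen n) :
    funOp fθ fη hX hY [.one o] c = if c = .one o then 1 else 0 := by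
  rw [funOp]
  cases c with
  | one o' =>
    by_cases h : o' = o
    · subst h
      rw [if_pos ⟨rfl, rfl⟩]
      simp [parse, funParsed]
    · rw [if_neg fun hp => h hp.1.symm, if_neg (by simpa using h)]
  | xi o' => simp [parse, funParsed]
  | theta i => simp [parse, funParsed]
  | eta i => simp [parse, funParsed]

theorem funOp_replicate (k : ℕ) (o : Obj) :
    funOp fθ fη hX hY (List.replicate k (.xi o)) (.xi o) = if k = 1 then 1 else 0 := by
  rw [funOp, if_pos]
  · simp [parse_replicate, funParsed]
  · exact isPath_replicate k o

theorem funParsed_ne_zero {p : ℕ × List (Gen n × ℕ)} {c : Gen n}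
    (h : funParsed fθ fη hX hY p c ≠ 0) : p ≠ (0, []) ∧
      c.deg - 1 = redDeg (p.2.map Prod.fst) ∧
      ((∃ o, p = (0, [(.one o, 0)])) ∨ ∀ o, Gen.one o ∉ p.2.map Prod.fst) := by
  obtain ⟨k, l⟩ := p
  rcases l with _ | ⟨⟨a₁, k₁⟩, _ | ⟨⟨a₂, k₂⟩, _ | ⟨⟨a₃, k₃⟩, l⟩⟩⟩
  · cases c <;> simp_all [funParsed, Gen.deg]
  · cases a₁ <;> cases c <;> simp_all [funParsed, Gen.deg]
  · cases a₁ <;> cases a₂ <;> cases c <;> simp_all [funParsed, Gen.deg]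
  · cases a₁ <;> cases a₂ <;> cases c <;> simp_all [funParsed]

theorem graded_funOp : Graded 0 (funOp fθ fη hX hY) := by
  intro w c h
  rw [funOp] at h
  have hp : IsPath c.tgt c.src w := by_contra fun hp => h (if_neg hp)
  rw [if_pos hp] at h
  obtain ⟨h₁, h₂, -⟩ := funParsed_ne_zero h
  refine ⟨?_, hp, by rw [h₂, redDeg_parse, add_zero]⟩
  rintro rfl
  exact h₁ rfl

theorem length_parse (w : List (Gen n)) :
    w.length = (parse w).1 + ((parse w).2.map fun a => a.2 + 1).sum := by
  induction w with
  | nil => rfl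
  | cons a w ih => cases a <;> simp [parse, ih] <;> omega

theorem funOp_unital (w : List (Gen n)) (o : Obj) (c : Gen n) (hw : 2 ≤ w.length)
    (ho : Gen.one o ∈ w) : funOp fθ fη hX hY w c = 0 := by
  by_contra h
  rw [funOp] at h
  have hp : IsPath c.tgt c.src w := by_contra fun hp => h (if_neg hp)
  rw [if_pos hp] at h
  rcases (funParsed_ne_zero h).2.2 with ⟨o', h₁⟩ | h₁
  · have := length_parse w
    rw [h₁] at this
    simp at this
    omega
  · exact h₁ o (mem_parse ho (by simp))

end GaugeToFunctor

end

section

open MvPowerSeries IsCyclicOp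

/-! ### Words on which compatibility with the pairing has to be tested. -/

section Form

variable {R : Type*} [CommRing R] {n : ℕ} {F : Ops R n}

theorem twoForm_one_cons (o : Obj) (v : List (Gen n)) :
    twoForm R n (.one o :: v) = if v = [.xi o] then -1 else 0 := by
  rcases v with _ | ⟨b, _ | ⟨b', v⟩⟩
  · rw [twoForm_of_length_ne (by simp)]; simp
  · rw [twoForm_pair, pairing_eq]
    simp [Gen.dual, psign, Gen.deg]
  · rw [twoForm_of_length_ne (by simp)]; simp

theorem twoForm_append_one (o : Obj) (v : List (Gen n)) :
    twoForm R n (v ++ [.one o]) = if v = [.xi o] then 1 else 0 := by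
  rcases v with _ | ⟨b, _ | ⟨b', v⟩⟩
  · rw [twoForm_of_length_ne (by simp)]; simp
  · rw [List.cons_append, List.nil_append, twoForm_pair, pairing_symm, pairing_eq]
    simp [Gen.dual, psign, Gen.deg]
    split_ifs <;> simp
  · rw [twoForm_of_length_ne (by simp)]; simp

/-- The compatibility with the pairing on words with an identity. -/
theorem form_of_one_mem (hF : Graded 0 F)
    (map_one : ∀ o c, F [Gen.one o] c = if c = Gen.one o then 1 else 0)
    (unital : ∀ (w : List (Gen n)) (o : Obj) (c : Gen n), 2 ≤ w.length → Gen.one o ∈ w → F w c = 0)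
    (hxi : ∀ v o, F v (.xi o) = if v = [.xi o] then 1 else 0) {w : List (Gen n)} {o : Obj}
    (ho : Gen.one o ∈ w) :
    ∑ c, ∑ d, pairing R c d * conv (fun v => F v c) (fun v => F v d) w = twoForm R n w := by
  rw [sum_pairing_conv hF.nil]
  obtain ⟨u, v, rfl⟩ := List.append_of_mem ho
  rcases u with _ | ⟨a, u⟩
  · rw [List.nil_append, twoForm_one_cons]
    rcases v with _ | ⟨b, v⟩
    · rw [if_neg (by simp)]
      exact Finset.sum_eq_zero fun l hl => by simp at hl; omega
    rw [Finset.sum_eq_single 1]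
    · simp only [List.take_succ_cons, List.take_zero, List.drop_succ_cons, List.drop_zero, map_one,
        ite_mul, one_mul, zero_mul, Finset.sum_ite_irrel, Finset.sum_const_zero,
        Finset.sum_ite_eq', Finset.mem_univ, if_true, mul_comm (F _ _), sum_pairing]
      simp only [Gen.dual, hxi, psign, Gen.deg]
      split_ifs <;> simp
    · intro l hl hl1
      refine Finset.sum_eq_zero fun c _ => Finset.sum_eq_zero fun d _ => ?_
      simp at hl
      obtain ⟨l, rfl⟩ : ∃ l', l = l' + 2 := ⟨l - 2, by omega⟩
      rw [unital _ o c (by simp) (by simp), zero_mul, zero_mul]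
    · simp
  · rcases v with _ | ⟨b, v⟩
    · rw [twoForm_append_one, Finset.sum_eq_single (a :: u).length]
      · have hp : ∀ c : Gen n, pairing R c (.one o) = if c = .xi o then 1 else 0 := by
          intro c; cases c <;> simp [pairing]
        rw [List.take_left, List.drop_left]
        simp only [map_one, mul_ite, mul_one, mul_zero, ite_mul, zero_mul, Finset.sum_ite_eq',
          Finset.mem_univ, if_true, hp, hxi]
      · intro l hl hl1
        refine Finset.sum_eq_zero fun c _ => Finset.sum_eq_zero fun d _ => ?_
        simp at hl hl1
        rw [unital (List.drop l _) o d (by simp; omega), mul_zero, zero_mul]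
        rw [List.drop_append_of_le_length (by simp; omega)]
        simp
      · simp
    · rw [twoForm_of_length_ne (by simp; omega)]
      refine Finset.sum_eq_zero fun l hl => Finset.sum_eq_zero fun c _ =>
        Finset.sum_eq_zero fun d _ => ?_
      simp at hl
      by_cases hlu : l ≤ (a :: u).length
      · rw [unital (List.drop l _) o d (by simp at hlu ⊢; omega), mul_zero, zero_mul]
        rw [List.drop_append_of_le_length hlu]
        simp
      · rw [unital (List.take l _) o c (by simp at hlu ⊢; omega), zero_mul, zero_mul]
        rw [List.take_append]
        obtain ⟨j, hj⟩ : ∃ j, l - (a :: u).length = j + 1 := ⟨l - (a :: u).length - 1, by omega⟩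
        rw [hj]
        simp

/-- Two paired outputs have reduced degrees summing to -1 and compose to a loop; the two-form itself
lives on loops of the same degree. So words of type ηθ and θη suffice when there are no identities.
-/
theorem exists_loop_of_form (hF : Graded 0 F) {w : List (Gen n)}
    (h : ∑ c, ∑ d, pairing R c d * conv (fun v => F v c) (fun v => F v d) w ≠ twoForm R n w) :
    ∃ o, IsPath o o w ∧ redDeg w = -1 := by
  rw [sum_pairing_conv hF.nil] at h
  by_cases h0 : twoForm R n w = 0
  · rw [h0] at h
    obtain ⟨l, _, h⟩ := Finset.exists_ne_zero_of_sum_ne_zero h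
    obtain ⟨c, _, h⟩ := Finset.exists_ne_zero_of_sum_ne_zero h
    obtain ⟨d, _, h⟩ := Finset.exists_ne_zero_of_sum_ne_zero h
    have hp := isPath_of_pairing hF h
    rw [List.take_append_drop] at hp
    refine ⟨_, hp, ?_⟩
    have hcd : d = c.dual := by
      by_contra hne
      exact right_ne_zero_of_mul h (by rw [pairing_eq, if_neg hne])
    have h₁ := (hF _ _ (left_ne_zero_of_mul (left_ne_zero_of_mul h))).2.2
    have h₂ := (hF _ _ (right_ne_zero_of_mul (left_ne_zero_of_mul h))).2.2
    rw [hcd, Gen.dual_deg] at h₂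
    rw [← List.take_append_drop l w, redDeg_append]
    omega
  · have h2 : w.length = 2 := by_contra fun h2 => h0 (twoForm_of_length_ne h2)
    obtain ⟨a, b, rfl⟩ := List.length_eq_two.1 h2
    rw [twoForm_pair, pairing_eq] at h0
    have hb : b = a.dual := by_contra fun hb => h0 (if_neg hb)
    subst hb
    refine ⟨a.tgt, ⟨rfl, by simp, by simp [IsPath]⟩, ?_⟩
    simp
    ring

theorem IsPath.exists_eta_theta {w : List (Gen n)} (hw : IsPath .X .X w)
    (h1 : ∀ o, Gen.one o ∉ w) (hd : redDeg w = -1) : ∃ k₂ b k₁ a k₀,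
      w = List.replicate k₂ (.xi .X) ++ .eta b :: (List.replicate k₁ (.xi .Y) ++ .theta a ::
        List.replicate k₀ (.xi .X)) := by
  rcases hw.split_eta h1 with ⟨k, -, h⟩ | ⟨k₂, b, w', rfl, h₁, h₂, h₃⟩
  · omega
  · obtain ⟨k₁, a, k₀, rfl⟩ := h₁.exists_one h₂ (by omega)
    exact ⟨k₂, b, k₁, a, k₀, rfl⟩

theorem IsPath.exists_theta_eta {w : List (Gen n)} (hw : IsPath .Y .Y w)
    (h1 : ∀ o, Gen.one o ∉ w) (hd : redDeg w = -1) : ∃ k₂ a k₁ b k₀,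
      w = List.replicate k₂ (.xi .Y) ++ .theta a :: (List.replicate k₁ (.xi .X) ++ .eta b ::
        List.replicate k₀ (.xi .Y)) := by
  rcases hw.split h1 with ⟨k, rfl, -⟩ | ⟨k₂, a, w', rfl, h₁, h₂, h₃, h₄, h₅⟩
  · rw [redDeg_replicate_xi] at hd; omega
  rw [redDeg_append, redDeg_replicate_xi, redDeg_cons] at hd
  cases a with
  | one o => exact absurd rfl (h₂ o)
  | xi o => exact absurd rfl (h₁ o)
  | eta i => cases h₃
  | theta a =>
    rcases h₄.split h₅ with ⟨k, -, h⟩ | ⟨k₁, b, w'', rfl, g₁, g₂, g₃, g₄, g₅⟩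
    · cases h
    rw [redDeg_append, redDeg_replicate_xi, redDeg_cons] at hd
    cases b with
    | one o => exact absurd rfl (g₂ o)
    | xi o => exact absurd rfl (g₁ o)
    | theta i => cases g₃
    | eta b =>
      rcases g₄.split g₅ with ⟨k₀, rfl, -⟩ | ⟨k₀, c, w''', rfl, e₁, e₂, e₃, e₄, e₅⟩
      · exact ⟨k₂, a, k₁, b, k₀, rfl⟩
      rw [redDeg_append, redDeg_replicate_xi, redDeg_cons] at hd
      have := redDeg_nonpos w'''
      cases c with
      | one o => exact absurd rfl (e₂ o)
      | xi o => exact absurd rfl (e₁ o)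
      | eta i => cases e₃
      | theta a => simp only [Gen.deg] at hd; omega

end Form

/-! ### The functor with a given invertible matrix. -/

section Construction

variable {R : Type*} [CommRing R] {n : ℕ}

/-- The map of variables sending `x, y` to given variables. -/
def objMap {σ : Type*} (x y : σ) : Obj → σ
  | .X => x
  | .Y => y

theorem thetaSeries_eq_rename {σ : Type*} {ob : σ → Obj} {x y : σ} (hx : ob x = .X)
    (hy : ob y = .Y) (F : Ops R n) (g a : Fin n) :
    thetaSeries ob F y x g a = rename (objMap x y) (thetaMatrix F g a) := by
  rw [thetaMatrix, Matrix.of_apply, thetaSeries, thetaSeries, rename_genSeries (ob' := ob)]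
  · rfl
  · rintro (_ | _) <;> simp [objMap, hx, hy]

theorem etaSeries_eq_rename {σ : Type*} {ob : σ → Obj} {x y : σ} (hx : ob x = .X)
    (hy : ob y = .Y) (F : Ops R n) (g a : Fin n) :
    etaSeries ob F x y g a = rename (objMap x y) (etaMatrix F a g) := by
  rw [etaMatrix, Matrix.of_apply, etaSeries, etaSeries, rename_genSeries (ob' := ob)]
  · rfl
  · rintro (_ | _) <;> simp [objMap, hx, hy]

theorem sum_rename_mul {σ : Type*} {x y : σ}
    {φ ψ : Matrix (Fin n) (Fin n) (MvPowerSeries Obj R)} (h : φ * ψ = 1) (a b : Fin n) :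
    ∑ g, rename (objMap x y) (φ a g) * rename (objMap x y) (ψ g b) = kd _ a b := by
  have := congrArg (rename (objMap x y)) (congrFun (congrFun h a) b)
  simp only [Matrix.mul_apply, map_sum, map_mul] at this
  rw [this]
  by_cases hab : a = b <;> simp [kd, hab, Matrix.one_apply]

/-- The exponent with given values at `x` and `y`. -/
def objExp (i j : ℕ) : Obj →₀ ℕ := Finsupp.equivFunOnFinite.symm (objMap i j)

theorem eq_objExp (e : Obj →₀ ℕ) : e = objExp (e .X) (e .Y) := by
  ext o
  cases o <;> rfl

/-- The exponent with three given values. -/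
def threeExp (k₂ k₁ k₀ : ℕ) : Fin 3 →₀ ℕ := Finsupp.equivFunOnFinite.symm ![k₂, k₁, k₀]

theorem eq_threeExp (e : Fin 3 →₀ ℕ) : e = threeExp (e 0) (e 1) (e 2) := by
  ext i
  fin_cases i <;> rfl

variable (φ ψ : Matrix (Fin n) (Fin n) (MvPowerSeries Obj R))
  (HX HY : Fin n → Fin n → MvPowerSeries (Fin 3) R)

/-- The operations whose generating series are the given power series. -/
def seriesOp : Ops R n :=
  -- A word around θ begins with its run of ξ_Y, hence the exchange of the two exponents.
  funOp (fun g a j i => coeff (objExp i j) (φ g a)) (fun g a i j => coeff (objExp i j) (ψ a g))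
    (fun b a k₂ k₁ k₀ => coeff (threeExp k₂ k₁ k₀) (HX b a))
    (fun a b k₂ k₁ k₀ => coeff (threeExp k₂ k₁ k₀) (HY a b))

theorem thetaMatrix_seriesOp : thetaMatrix (seriesOp φ ψ HX HY) = φ := by
  ext g a e
  rw [coeff_thetaMatrix, seriesOp, funOp_theta, ← eq_objExp]

theorem etaMatrix_seriesOp : etaMatrix (seriesOp φ ψ HX HY) = ψ := by
  ext a g e
  rw [coeff_etaMatrix, seriesOp, funOp_eta, ← eq_objExp]

theorem etaThetaSeries_seriesOp (b a : Fin n) :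
    etaThetaSeries ![.X, .Y, .X] (seriesOp φ ψ HX HY) 0 1 2 b a = HX b a := by
  ext e
  rw [etaThetaSeries, coeff_genSeries_of_cover (by simp) (by simp; decide), slotWord, slotWord,
    slotWord]
  refine (funOp_eta_theta (e 0) (e 1) (e 2) b a).trans ?_
  rw [← eq_threeExp]

theorem thetaEtaSeries_seriesOp (a b : Fin n) :
    thetaEtaSeries ![.Y, .X, .Y] (seriesOp φ ψ HX HY) 0 1 2 a b = HY a b := by
  ext e
  rw [thetaEtaSeries, coeff_genSeries_of_cover (by simp) (by simp; decide), slotWord, slotWord,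
    slotWord]
  refine (funOp_theta_eta (e 0) (e 1) (e 2) a b).trans ?_
  rw [← eq_threeExp]

theorem seriesOp_xi (v : List (Gen n)) (o : Obj) :
    seriesOp φ ψ HX HY v (.xi o) = if v = [.xi o] then 1 else 0 := by
  split_ifs with hv
  · subst hv
    exact (funOp_replicate 1 o).trans (if_pos rfl)
  · by_contra h
    rw [seriesOp, funOp] at h
    have hp : IsPath o o v := by_contra fun hp => h (if_neg hp)
    rw [if_pos (by exact hp)] at h
    have hk : parse v = (1, []) := by
      generalize parse v = p at h
      obtain ⟨k, l⟩ := p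
      rcases l with _ | ⟨⟨a₁, k₁⟩, _ | ⟨⟨a₂, k₂⟩, _ | ⟨⟨a₃, k₃⟩, l⟩⟩⟩
      · by_contra hk
        exact h (if_neg fun h => hk (by rw [h]))
      · cases a₁ <;> exact absurd rfl h
      · cases a₁ <;> cases a₂ <;> exact absurd rfl h
      · cases a₁ <;> cases a₂ <;> exact absurd rfl h
    have hl := length_parse v
    rw [hk] at hl
    obtain ⟨a, rfl⟩ := List.length_eq_one_iff.1 hl
    cases a with
    | xi o' => exact hv (by rw [show o' = o from hp.1])
    | _ => simp [parse] at hk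

theorem genSeries_nil_seriesOp {σ : Type*} {ob : σ → Obj} (s : σ) (b : Gen n) :
    genSeries ob s [] (fun v => seriesOp φ ψ HX HY v b) = if b = .xi (ob s) then X s else 0 := by
  split_ifs with hb
  · subst hb
    have : ∀ k, seriesOp φ ψ HX HY (List.replicate k (.xi (ob s))) (.xi (ob s)) =
      if k = 1 then 1 else 0 := fun k => funOp_replicate k (ob s)
    simp only [genSeries, slotEval, this]
    rw [slotSum_eq_add, slotSum_eq_first]
    · simp
    · simp
  · refine graded_funOp.genSeries_eq_zero (by trivial) ?_
    cases b <;> simp_all [Gen.tgt, Gen.src, Gen.deg]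
    grind

variable {φ ψ HX HY}

/-- The two hypotheses are exactly the pairing conditions for words of type ηθ and θη; identities
are covered by unitality and all other words by degree. -/
theorem isFunctorData_seriesOp
    (hX : ∀ b a, (X 0 - X 2) * HX b a = kd _ b a - ∑ g, rename (objMap (0 : Fin 3) 1) (ψ b g) *
      rename (objMap (2 : Fin 3) 1) (φ g a))
    (hY : ∀ a b, (X 0 - X 2) * HY a b = ∑ g, rename (objMap (1 : Fin 3) 0) (φ g a) *
      rename (objMap (1 : Fin 3) 2) (ψ b g) - kd _ a b) :
    IsFunctorData (seriesOp φ ψ HX HY) := by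
  have hg : Graded 0 (seriesOp φ ψ HX HY) := graded_funOp
  refine ⟨hg, funOp_one, funOp_unital, fun w => ?_⟩
  by_cases h1 : ∀ o, Gen.one o ∉ w
  swap
  · push Not at h1
    obtain ⟨o, ho⟩ := h1
    exact form_of_one_mem hg funOp_one funOp_unital (seriesOp_xi φ ψ HX HY) ho
  by_contra hne
  obtain ⟨o, hp, hd⟩ := exists_loop_of_form hg hne
  apply hne
  cases o with
  | X =>
    obtain ⟨k₂, b, k₁, a, k₀, rfl⟩ := hp.exists_eta_theta h1 hd
    have h₁ := hg.genSeries_form_eta_theta (ob := ![.X, .Y, .X]) (x := 2) (y := 1) (x' := 0)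
      rfl rfl rfl (genSeries_nil_seriesOp φ ψ HX HY) b a
    have h₂ : genSeries ![.X, .Y, .X] (0 : Fin 3) [(.eta b, 1), (.theta a, 2)] (twoForm R n) =
        kd _ b a := by
      rw [genSeries_twoForm rfl]
      simp only [List.map_cons, List.map_nil, twoForm_pair, pairing]
      by_cases hab : b = a <;> simp [hab, kd]
    rw [etaThetaSeries_seriesOp, hX] at h₁
    simp only [thetaSeries_eq_rename (ob := ![.X, .Y, .X]) (x := 2) (y := 1) rfl rfl,
      etaSeries_eq_rename (ob := ![.X, .Y, .X]) (x := 0) (y := 1) rfl rfl, thetaMatrix_seriesOp,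
      etaMatrix_seriesOp, sub_add_cancel] at h₁
    have h₃ := congrArg (coeff (threeExp k₂ k₁ k₀)) (h₁.trans h₂.symm)
    rw [coeff_genSeries_of_cover (by simp) (by simp; decide),
      coeff_genSeries_of_cover (by simp) (by simp; decide)] at h₃
    exact h₃
  | Y =>
    obtain ⟨k₂, a, k₁, b, k₀, rfl⟩ := hp.exists_theta_eta h1 hd
    have h₁ := hg.genSeries_form_theta_eta (ob := ![.Y, .X, .Y]) (x := 1) (y := 2) (y' := 0)
      rfl rfl rfl (genSeries_nil_seriesOp φ ψ HX HY) a b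
    have h₂ : genSeries ![.Y, .X, .Y] (0 : Fin 3) [(.theta a, 1), (.eta b, 2)] (twoForm R n) =
        -kd _ a b := by
      rw [genSeries_twoForm rfl]
      simp only [List.map_cons, List.map_nil, twoForm_pair, pairing]
      by_cases hab : a = b <;> simp [hab, kd]
    rw [thetaEtaSeries_seriesOp, hY] at h₁
    simp only [thetaSeries_eq_rename (ob := ![.Y, .X, .Y]) (x := 1) (y := 0) rfl rfl,
      etaSeries_eq_rename (ob := ![.Y, .X, .Y]) (x := 1) (y := 2) rfl rfl, thetaMatrix_seriesOp,
      etaMatrix_seriesOp, sub_sub_cancel_left] at h₁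
    have h₃ := congrArg (coeff (threeExp k₂ k₁ k₀)) (h₁.trans h₂.symm)
    rw [coeff_genSeries_of_cover (by simp) (by simp; decide),
      coeff_genSeries_of_cover (by simp) (by simp; decide)] at h₃
    exact h₃

/-- Every invertible matrix of power series is the matrix of a functor. -/
theorem exists_isFunctorData (h : φ * ψ = 1) :
    ∃ F : Ops R n, IsFunctorData F ∧ thetaMatrix F = φ ∧ etaMatrix F = ψ := by
  have h' : ψ * φ = 1 := mul_eq_one_comm.1 h
  have hT : ψ.transpose * φ.transpose = 1 := by rw [← Matrix.transpose_mul, h, Matrix.transpose_one]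
  -- This auxiliary family only realizes `φ` and `ψ` as generating series, so that their divided
  -- differences are series with an additional ξ.
  let F₀ : Ops R n := seriesOp φ ψ 0 0
  have e₁ : thetaMatrix F₀ = φ := thetaMatrix_seriesOp φ ψ 0 0
  have e₂ : etaMatrix F₀ = ψ := etaMatrix_seriesOp φ ψ 0 0
  refine ⟨_, isFunctorData_seriesOp (φ := φ) (ψ := ψ)
    -- Since ψφ = 1 at (x, y), the difference δ - ψ(x', y) φ(x, y) equals -(ψ(x', y) - ψ(x, y)) φ(x,
    -- y), and its quotient by x' - x is this series. For `HY` the roles of ψ and φ are exchanged.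
    (HX := fun b a => -∑ g, genSeries ![.X, .Y, .X] (0 : Fin 3) [(.xi .X, 2), (.eta b, 1)]
      (fun w => F₀ w (.eta g)) * rename (objMap (2 : Fin 3) 1) (φ g a))
    (HY := fun a b => ∑ g, genSeries ![.Y, .X, .Y] (0 : Fin 3) [(.xi .Y, 2), (.theta a, 1)]
      (fun w => F₀ w (.theta g)) * rename (objMap (1 : Fin 3) 2) (ψ b g)) ?_ ?_,
    thetaMatrix_seriesOp _ _ _ _, etaMatrix_seriesOp _ _ _ _⟩
  · intro b a
    have hd : ∀ g, (X 0 - X 2) * genSeries ![.X, .Y, .X] (0 : Fin 3) [(.xi .X, 2), (.eta b, 1)]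
        (fun w => F₀ w (.eta g)) = rename (objMap (0 : Fin 3) 1) (ψ b g) -
          rename (objMap (2 : Fin 3) 1) (ψ b g) := by
      intro g
      rw [← e₂, ← etaSeries_eq_rename (ob := ![.X, .Y, .X]) (x := 0) (y := 1) rfl rfl,
        ← etaSeries_eq_rename (ob := ![.X, .Y, .X]) (x := 2) (y := 1) rfl rfl]
      exact sub_mul_genSeries_xi_head (ob := ![.X, .Y, .X]) (s := 0) (t := 2) rfl _ _
    rw [mul_neg, Finset.mul_sum]
    simp only [← mul_assoc, hd, sub_mul, Finset.sum_sub_distrib, sum_rename_mul h']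
    ring
  · intro a b
    have hd : ∀ g, (X 0 - X 2) * genSeries ![.Y, .X, .Y] (0 : Fin 3) [(.xi .Y, 2), (.theta a, 1)]
        (fun w => F₀ w (.theta g)) = rename (objMap (1 : Fin 3) 0) (φ g a) -
          rename (objMap (1 : Fin 3) 2) (φ g a) := by
      intro g
      rw [← e₁, ← thetaSeries_eq_rename (ob := ![.Y, .X, .Y]) (x := 1) (y := 0) rfl rfl,
        ← thetaSeries_eq_rename (ob := ![.Y, .X, .Y]) (x := 1) (y := 2) rfl rfl]
      exact sub_mul_genSeries_xi_head (ob := ![.Y, .X, .Y]) (s := 0) (t := 2) rfl _ _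
    have hT' : φ.transpose * ψ.transpose = 1 := mul_eq_one_comm.1 hT
    rw [Finset.mul_sum]
    simp only [← mul_assoc, hd, sub_mul, Finset.sum_sub_distrib]
    congr 1
    exact sum_rename_mul hT' a b

end Construction

end

section

open MvPowerSeries IsCyclicOp

/-! ### Comparison of the equivalence relations. -/

section Comparison

variable {R : Type*} [CommRing R] {n : ℕ}

theorem exists_mul_eq_one_of_constTerm {φ : Matrix (Fin n) (Fin n) (MvPowerSeries Obj R)}
    (h : IsUnit (constTerm φ)) : ∃ ψ, φ * ψ = 1 := by
  have hd : IsUnit φ.det := by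
    rw [MvPowerSeries.isUnit_iff_constantCoeff, RingHom.map_det]
    exact (Matrix.isUnit_iff_isUnit_det _).1 h
  exact ⟨φ⁻¹, Matrix.mul_nonsing_inv _ hd⟩

theorem constTerm_etaMatrix (F : Ops R n) (a g : Fin n) :
    constTerm (etaMatrix F) a g = F [.eta a] (.eta g) := by
  rw [constTerm, Matrix.map_apply, ← coeff_zero_eq_constantCoeff_apply, coeff_etaMatrix]
  rfl

/-- The linear part preserves objects and degrees. It fixes identities by unitality, ξ by the
pairing, θ by hypothesis, and η because its matrix is inverse to that of θ. -/
theorem IsFunctorData.linear_eq_one {F : Ops R n} (hF : IsFunctorData F)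
    (h : constTerm (thetaMatrix F) = 1) :
    (Matrix.of fun c a => F [a] c : Matrix (Gen n) (Gen n) R) = 1 := by
  have h' : constTerm (etaMatrix F) = 1 := by
    have := congrArg constTerm hF.thetaMatrix_mul_etaMatrix
    rwa [constTerm_mul, constTerm_one, h, one_mul] at this
  have h0 : ∀ {a c : Gen n}, ¬(c.tgt = a.tgt ∧ c.src = a.src ∧ c.deg = a.deg) → F [a] c = 0 := by
    intro a c hac
    by_contra hne
    obtain ⟨-, hp, hd⟩ := hF.graded _ _ hne
    simp [IsPath, redDeg] at hp hd
    exact hac ⟨hp.1.symm, hp.2.symm, hd⟩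
  ext c a
  rw [Matrix.of_apply, Matrix.one_apply]
  cases a with
  | one o => exact hF.map_one o c
  | xi o =>
    split_ifs with hc
    · subst hc
      exact (hF.map_replicate_xi 1 o).trans (if_pos rfl)
    · refine h0 ?_
      rintro ⟨h₁, h₂, h₃⟩
      cases c <;> simp_all [Gen.tgt, Gen.src, Gen.deg]
      exact absurd (h₁.trans h₂.symm) (by decide)
  | theta a =>
    cases c with
    | theta g =>
      rw [← constTerm_thetaMatrix F, h]
      by_cases hga : g = a <;> simp [Matrix.one_apply, hga]
    | _ =>
      rw [if_neg (by simp)]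
      refine h0 ?_
      rintro ⟨h₁, h₂, h₃⟩
      simp_all [Gen.tgt, Gen.src, Gen.deg]
  | eta a =>
    cases c with
    | eta g =>
      rw [← constTerm_etaMatrix F, h']
      by_cases hga : g = a <;> simp [Matrix.one_apply, hga, eq_comm]
    | _ =>
      rw [if_neg (by simp)]
      refine h0 ?_
      rintro ⟨h₁, h₂, h₃⟩
      simp_all [Gen.tgt, Gen.src, Gen.deg]

/-- A gauge equivalence of the tensors comes from a cyclic functor. -/
theorem exists_cyclicFunctor {m m' : CyclicAInf R n}
    {φ : Matrix (Fin n) (Fin n) (MvPowerSeries Obj R)} (hφ : IsUnit (constTerm φ))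
    (h : m'.solution.r = gauge φ m.solution.r) :
    ∃ f : CyclicFunctor m m', thetaMatrix f.map = φ := by
  obtain ⟨ψ, hψ⟩ := exists_mul_eq_one_of_constTerm hφ
  obtain ⟨F, hF, rfl, -⟩ := exists_isFunctorData hψ
  have hg := (hF.gauge_iff m.isCyclicOp m'.isCyclicOp).1 h
  refine ⟨CyclicFunctor.ofFunctorData hF fun w h1 i => ?_, rfl⟩
  by_contra hne
  have hp : IsPath .Y .X w ∧ redDeg w = -2 := by
    by_cases h0 : blockSum m'.op F w (.theta i) = 0
    · rw [h0] at hne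
      obtain ⟨-, hp, hd⟩ := (hF.graded.insertion m.isCyclicOp.graded) _ _ (Ne.symm hne)
      exact ⟨hp, by simp only [Gen.deg] at hd; omega⟩
    · obtain ⟨-, hp, hd⟩ := (hF.graded.blockSum m'.isCyclicOp.graded) _ _ h0
      exact ⟨hp, by simp only [Gen.deg] at hd; omega⟩
  -- The defect is supported on words of type θηθ, whose values are the coefficients of the two
  -- series compared in `hg`.
  obtain ⟨k₃, i₂, k₂, j₁, k₁, i₁, k₀, rfl⟩ := hp.1.exists_two h1 hp.2
  have h₀ := congrArg (coeff (quadExp k₂ k₁ k₀ k₃)) (hg i₂ j₁ i₁ i)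
  rw [coeff_genSeries_of_cover (by simp) (by simp; decide),
    coeff_genSeries_of_cover (by simp) (by simp; decide), ← insertion_eq_derive,
    ← blockSum_eq_blockSubst] at h₀
  apply hne
  simpa [slotWord, quadExp] using h₀

/-- The matrix of θ ↦ θ transports equivalences in both directions; invertibility of f^1 is free by
`isUnit_linear`. -/
theorem cyclicEquiv_iff (m m' : CyclicAInf R n) :
    CyclicEquiv m m' ↔ GaugeEquiv m.solution m'.solution := by
  refine ⟨CyclicEquiv.gaugeEquiv, fun ⟨φ, hφ, h⟩ => ?_⟩
  obtain ⟨f, -⟩ := exists_cyclicFunctor hφ h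
  refine ⟨f, isUnit_linear fun a b => ?_⟩
  rw [← f.cyclic_one a b]
  exact Finset.sum_congr rfl fun c _ => Finset.sum_congr rfl fun d _ => mul_comm _ _

theorem strictCyclicEquiv_iff (m m' : CyclicAInf R n) :
    StrictCyclicEquiv m m' ↔ StrictGaugeEquiv m.solution m'.solution := by
  refine ⟨StrictCyclicEquiv.strictGaugeEquiv, fun ⟨φ, hφ, h⟩ => ?_⟩
  obtain ⟨f, rfl⟩ := exists_cyclicFunctor (hφ ▸ isUnit_one) h
  exact ⟨f, f.isFunctorData.linear_eq_one hφ⟩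

theorem gauge_one (r : Matrix (Fin n × Fin n) (Fin n × Fin n) (Coef R 2)) : gauge 1 r = r := by
  rw [gauge_eq (one_mul 1), gaugeAt_one, gaugeAt_one, gaugeAt_one, gaugeAt_one,
    Matrix.one_kronecker_one, one_mul, mul_one]

theorem gauge_mul {φ φ' : Matrix (Fin n) (Fin n) (MvPowerSeries Obj R)}
    (h : IsUnit (constTerm φ)) (h' : IsUnit (constTerm φ'))
    (r : Matrix (Fin n × Fin n) (Fin n × Fin n) (Coef R 2)) :
    gauge (φ' * φ) r = gauge φ' (gauge φ r) := by
  obtain ⟨ψ, hψ⟩ := exists_mul_eq_one_of_constTerm h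
  obtain ⟨ψ', hψ'⟩ := exists_mul_eq_one_of_constTerm h'
  have : φ' * φ * (ψ * ψ') = 1 := by
    rw [mul_assoc, ← mul_assoc φ, hψ, one_mul, hψ']
  rw [gauge_eq this, gauge_eq hψ, gauge_eq hψ']
  simp only [gaugeAt_mul, Matrix.mul_kronecker_mul, Matrix.mul_assoc]

theorem equivalence_gaugeEquiv : Equivalence (GaugeEquiv (R := R) (n := n)) where
  refl s := ⟨1, by rw [constTerm_one]; exact isUnit_one, (gauge_one _).symm⟩
  symm := by
    rintro s s' ⟨φ, hφ, h⟩
    obtain ⟨ψ, hψ⟩ := exists_mul_eq_one_of_constTerm hφ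
    have hψ' := mul_eq_one_comm.1 hψ
    have hu : IsUnit (constTerm ψ) :=
      IsUnit.of_mul_eq_one (constTerm φ) (by rw [← constTerm_mul, hψ', constTerm_one])
    exact ⟨ψ, hu, by rw [h, ← gauge_mul hφ hu, hψ', gauge_one]⟩
  trans := by
    rintro s s' s'' ⟨φ, hφ, h⟩ ⟨φ', hφ', h'⟩
    exact ⟨φ' * φ, by rw [constTerm_mul]; exact hφ'.mul hφ, by rw [h', h, gauge_mul hφ hφ']⟩

theorem equivalence_strictGaugeEquiv : Equivalence (StrictGaugeEquiv (R := R) (n := n)) where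
  refl s := ⟨1, constTerm_one, (gauge_one _).symm⟩
  symm := by
    rintro s s' ⟨φ, hφ, h⟩
    have hu : IsUnit (constTerm φ) := hφ ▸ isUnit_one
    obtain ⟨ψ, hψ⟩ := exists_mul_eq_one_of_constTerm hu
    have hψ' := mul_eq_one_comm.1 hψ
    have hc : constTerm ψ = 1 := by
      rw [← constTerm_one (R := R) (n := n), ← hψ, constTerm_mul, hφ, one_mul]
    exact ⟨ψ, hc, by rw [h, ← gauge_mul hu (hc ▸ isUnit_one), hψ', gauge_one]⟩
  trans := by
    rintro s s' s'' ⟨φ, hφ, h⟩ ⟨φ', hφ', h'⟩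
    exact ⟨φ' * φ, by rw [constTerm_mul, hφ, hφ', one_mul],
      by rw [h', h, gauge_mul (hφ ▸ isUnit_one) (hφ' ▸ isUnit_one)]⟩

/-- Functors need not be composed or inverted: the relation is the pullback of gauge equivalence,
where matrices are multiplied and inverted. -/
theorem equivalence_cyclicEquiv : Equivalence (CyclicEquiv (R := R) (n := n)) := by
  have : CyclicEquiv (R := R) (n := n) = fun m m' => GaugeEquiv m.solution m'.solution :=
    funext fun m => funext fun m' => propext (cyclicEquiv_iff m m')
  rw [this]
  exact equivalence_gaugeEquiv.comap _

theorem equivalence_strictCyclicEquiv : Equivalence (StrictCyclicEquiv (R := R) (n := n)) := by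
  have : StrictCyclicEquiv (R := R) (n := n) =
      fun m m' => StrictGaugeEquiv m.solution m'.solution :=
    funext fun m => funext fun m' => propext (strictCyclicEquiv_iff m m')
  rw [this]
  exact equivalence_strictGaugeEquiv.comap _

end Comparison

/-! ### Change of the coefficient ring. -/

section BaseChange

variable {R S : Type*} [CommRing R] [CommRing S] {n : ℕ} (g : R →+* S)

theorem map_sgn (z : ℤ) : g (sgn R z) = sgn S z := by simp [sgn]

theorem map_pairing (a b : Gen n) : g (pairing R a b) = pairing S a b := by
  cases a <;> cases b <;> simp [pairing] <;> split_ifs <;> simp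

theorem map_mu2 (a b c : Gen n) : g (mu2 R a b c) = mu2 S a b c := by
  cases a <;> cases b <;> simp [mu2] <;> split_ifs <;> simp [map_sgn]

/-- Extension of scalars of a cyclic `A_∞`-structure. -/
def CyclicAInf.baseChange (m : CyclicAInf R n) : CyclicAInf S n where
  op w c := g (m.op w c)
  homogeneous w c h := m.homogeneous w c fun h0 => h (by simp only [h0, map_zero])
  minimal a c := by rw [m.minimal, map_zero]
  op_two a b c := by rw [m.op_two, map_mu2]
  strictly_unital w o c hw ho := by rw [m.strictly_unital w o c hw ho, map_zero]
  ainf w hw c := by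
    have := congrArg g (m.ainf w hw c)
    simpa only [insertion, map_sum, map_mul, map_sgn, map_zero] using this
  cyclic a b w := by
    have := congrArg g (m.cyclic a b w)
    simpa only [map_sum, map_mul, map_sgn, map_pairing] using this

theorem Coef.baseChange_algebraMap {N : ℕ} (p : PS R N) :
    Coef.baseChange N g (algebraMap (PS R N) (Coef R N) p) =
      algebraMap (PS S N) (Coef S N) (MvPowerSeries.map g p) :=
  IsLocalization.Away.lift_eq _ _ _

/-- The regular part has values of the operations as coefficients, and the polar part is defined
over the integers. -/
theorem CyclicAInf.solution_baseChange (m : CyclicAInf R n) :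
    (m.baseChange g).solution.r = m.solution.r.map (Coef.baseChange 2 g) := by
  change tensor _ = (tensor _).map _
  ext ⟨i₁, i₂⟩ ⟨j₁, j₂⟩
  rw [Matrix.map_apply, tensor_singular_part, tensor_singular_part]
  simp only [Matrix.add_apply, Matrix.map_apply, Matrix.smul_apply, smul_eq_mul, map_add, map_mul,
    Coef.baseChange_algebraMap, Matrix.kroneckerMap_apply, flipMatrix, Matrix.of_apply]
  have hx : Coef.baseChange 2 g (dx R 0 1) = dx S 0 1 := by
    simp [dx, Coef.baseChange_algebraMap, xvar]
  have hy : Coef.baseChange 2 g (dy R 1 0) = dy S 1 0 := by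
    simp [dy, Coef.baseChange_algebraMap, yvar]
  rw [map_inverse_of_isUnit _ (isUnit_dx R (by decide)),
    map_inverse_of_isUnit _ (isUnit_dy R (by decide)), hx, hy]
  have k₁ : ∀ a b : Fin n, Coef.baseChange 2 g ((1 : Matrix (Fin n) (Fin n) (Coef R 2)) a b) =
      (1 : Matrix _ _ (Coef S 2)) a b := by
    intro a b; by_cases hab : a = b <;> simp [hab, Matrix.one_apply]
  have k₂ : ∀ (p : Prop) [Decidable p], Coef.baseChange 2 g (if p then (1 : Coef R 2) else 0) =
      if p then 1 else 0 := by
    intro p _; split_ifs <;> simp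
  rw [k₁, k₁, k₂]
  congr 3
  ext e
  rw [coeff_map, map_neg, map_neg, map_neg, quad, quad,
    coeff_genSeries_of_cover (by simp) (by simp; decide),
    coeff_genSeries_of_cover (by simp) (by simp; decide)]
  rfl

end BaseChange

/-! ### Passage to the quotients. -/

section Quotient

variable {α β : Type*} {r : α → α → Prop} {s : β → β → Prop}

/-- A surjection which reflects and preserves equivalence relations induces a bijection of the
quotients. -/
theorem exists_bijective_quot (hs : Equivalence s) {ρ : α → β}
    (hρ : Function.Surjective ρ) (h : ∀ a a', r a a' ↔ s (ρ a) (ρ a')) :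
    ∃ Φ : Quot r → Quot s, (∀ a, Φ (Quot.mk _ a) = Quot.mk _ (ρ a)) ∧ Function.Bijective Φ := by
  refine ⟨Quot.map ρ fun a a' => (h a a').1, fun _ => rfl, ?_, ?_⟩
  · rintro ⟨a⟩ ⟨a'⟩ haa
    exact Quot.sound ((h a a').2 (hs.eqvGen_iff.1 (Quot.eqvGen_exact haa)))
  · rintro ⟨b⟩
    obtain ⟨a, rfl⟩ := hρ b
    exact ⟨Quot.mk _ a, rfl⟩

end Quotient

end

end AYBE

end

theorem theoremA {R : Type*} [CommRing R] (n : ℕ) :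
    Equivalence (AYBE.StrictCyclicEquiv (R := R) (n := n)) ∧
    Equivalence (AYBE.CyclicEquiv (R := R) (n := n)) ∧
    Equivalence (AYBE.StrictGaugeEquiv (R := R) (n := n)) ∧
    Equivalence (AYBE.GaugeEquiv (R := R) (n := n)) ∧
    ∃ ρ : AYBE.CyclicAInf R n → AYBE.FormalSolution R n,
      (∀ m, AYBE.IsMasseyTensor m (ρ m).r) ∧
      (∃ Φ : Quot (AYBE.StrictCyclicEquiv (R := R) (n := n)) →
          Quot (AYBE.StrictGaugeEquiv (R := R) (n := n)),
        (∀ m, Φ (Quot.mk _ m) = Quot.mk _ (ρ m)) ∧ Function.Bijective Φ) ∧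
      (∃ Ψ : Quot (AYBE.CyclicEquiv (R := R) (n := n)) →
          Quot (AYBE.GaugeEquiv (R := R) (n := n)),
        (∀ m, Ψ (Quot.mk _ m) = Quot.mk _ (ρ m)) ∧ Function.Bijective Ψ) ∧
      (∀ (S : Type*) [CommRing S] (g : R →+* S) (m : AYBE.CyclicAInf R n),
        ∃ m' : AYBE.CyclicAInf S n, (∀ w c, m'.op w c = g (m.op w c)) ∧
          AYBE.IsMasseyTensor m' ((ρ m).r.map (AYBE.Coef.baseChange 2 g))) := by
  refine ⟨AYBE.equivalence_strictCyclicEquiv, AYBE.equivalence_cyclicEquiv,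
    AYBE.equivalence_strictGaugeEquiv, AYBE.equivalence_gaugeEquiv, AYBE.CyclicAInf.solution,
    AYBE.CyclicAInf.isMasseyTensor_solution,
    AYBE.exists_bijective_quot AYBE.equivalence_strictGaugeEquiv
      AYBE.CyclicAInf.solution_surjective AYBE.strictCyclicEquiv_iff,
    AYBE.exists_bijective_quot AYBE.equivalence_gaugeEquiv
      AYBE.CyclicAInf.solution_surjective AYBE.cyclicEquiv_iff,
    fun S _ g m => ⟨m.baseChange g, fun _ _ => rfl, ?_⟩⟩
  rw [← AYBE.CyclicAInf.solution_baseChange]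
  exact (m.baseChange g).isMasseyTensor_solution
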